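/- Let $G$ be an acyclic directed mixed graph on $n$ observable variables $V$ with values in a finite non-empty alphabet $\Sigma$: directed edges without directed cycles, and bidirected edges. Let $d$ be the maximum number of directed edges into a vertex. The c-components of $G$ are the classes of vertices connected by bidirected paths; let $k$ be the size of the largest one. A causal Bayes net on $G$ has, for every bidirected edge, an independent hidden variable with an arbitrary finite range, and for every $V_i\in V$ a conditional distribution given its parents in $G$ and the hidden variables on the bidirected edges at $V_i$. It defines the observational distribution $P(v)=\sum_u\prod_e P(u_e)\prod_i P(v_i\mid \mathrm{pa}_i,u)$ and, for $X\in V$ and $x\in\Sigma$, the interventional distribution $P_x$, in which the mechanism of $X$ is replaced by the constant $x$. Let $X\in V$ be such that no child of $X$ lies in the c-component $S_1$ of $X$. For $\alpha>0$, call the net $\alpha$-strongly positive with respect to $X$ if $P(Z=z)>\alpha$ for every assignment $z$ to $Z=S_1\cup\bigcup_{V_i\in S_1}\mathrm{Pa}(V_i)$. There are absolute constants $C>0$ and $c\in\mathbb N$ such that for all such $G$, $\Sigma$, $X$, all $\alpha>0$, $\epsilon,\delta\in(0,1)$, all interventions $x\in\Sigma$ and all $F\subseteq V$ with $|F|=f$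 there is an algorithm which, given $$m\le C\,T\,\log^{c}(2+T)\,\bigl(1+\log\tfrac1\delta\bigr),\qquad T=\frac{|\Sigma|^{2kd}\,n}{\alpha^{k}\epsilon^{2}},$$ independent samples from the observational distribution $P$ of any unknown causal Bayes net on $G$ that is $\alpha$-strongly positive with respect to $X$, runs in time at most $C\,m\,n\,|\Sigma|^{2kd}$ and returns data with the following two properties. (1) With probability at least $1-\delta$ the data are an evaluator for a distribution $\hat P$ on $\Sigma^F$ with $d_{\mathrm{TV}}(P_x|_F,\hat P)\le\epsilon$: from the data and any $w\in\Sigma^F$, the value $\hat P(w)$ is computed in time at most $C\,n|\Sigma|(kd+k)\,|\Sigma|^{n-f}$. (2) Without further samples, a randomized procedure turns the data in time at most $C\,n|\Sigma|(kd+k)\,\frac{|\Sigma|^{f}}{\epsilon^{2}}\bigl(1+\log\frac1\delta\bigr)$ into explicit data which, with overall probability at least $1-\delta$, are an evaluator for a distribution on $\Sigma^F$ within total variation distance $\epsilon$ of $P_x|_F$ that answers each query $w\in\Sigma^F$ in time at most $C(f+1)$. Here algorithms are randomized random access programs with unit-cost exact rational arithmetic, comparisons, indirect addressing and coins of computed rational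 bias. A program may depend on $G,\Sigma,X,x,F,\alpha,\epsilon,\delta$ but not on the net; it is a finite list of instructions without jumps, and its running time is its length. -/

import Mathlib

noncomputable section

open scoped ENNReal Classical

namespace CausalLearning

/-! ### Acyclic directed mixed graphs -/

/-- An acyclic directed mixed graph on `n` observable variables: `dir i j` is the directed edge
`i → j`, `bi` is the graph of bidirected edges. A pair may carry both kinds of edge. -/
structure ADMG (n : ℕ) where
  dir : Fin n → Fin n → Prop
  bi : SimpleGraph (Fin n)
  acyclic : ∀ i, ¬ Relation.TransGen dir i i

namespace ADMG

variable {n : ℕ} (G : ADMG n)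

/-- The observable parents of `i`. -/
def parents (i : Fin n) : Finset (Fin n) := Finset.univ.filter fun j => G.dir j i

/-- The maximum in-degree (directed edges only). -/
def inDegree : ℕ := Finset.univ.sup fun i => (G.parents i).card

/-- The c-component of `i`: all vertices joined to `i` by a path of bidirected edges. -/
def cComp (i : Fin n) : Finset (Fin n) := Finset.univ.filter fun j => G.bi.Reachable i j

/-- The size of the largest c-component. -/
def maxCComp : ℕ := Finset.univ.sup fun i => (G.cComp i).card

/-- `Pa⁺(S) = S ∪ ⋃_{i ∈ S} Pa(i)`. -/
def paPlus (S : Finset (Fin n)) : Finset (Fin n) := S ∪ S.biUnion G.parents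

/-- Identifiability with respect to `X`: no child of `X` lies in the c-component of `X`. -/
def Identifiable (X : Fin n) : Prop := ∀ j, G.dir X j → j ∉ G.cComp X

end ADMG

/-! ### Causal Bayes nets -/

/-- A (semi-Markovian) causal Bayes net over the ADMG `G` with alphabet `Fin s`: one independent
hidden variable for every bidirected edge, with an arbitrary finite range, and for every observable
`i` its conditional distribution given its observable parents and the hidden variables on the
bidirected edges at `i`. -/
structure CBN {n : ℕ} (G : ADMG n) (s : ℕ) where
  U : G.bi.edgeSet → Type
  finU : ∀ e, Fintype (U e)
  hid : ∀ e, PMF (U e)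
  cpd : ∀ i : Fin n, ({j // G.dir j i} → Fin s) →
    (∀ e : {e : G.bi.edgeSet // i ∈ (e : Sym2 (Fin n))}, U e.1) → PMF (Fin s)

namespace CBN

variable {n : ℕ} {G : ADMG n} {s : ℕ}

instance (M : CBN G s) (e : G.bi.edgeSet) : Fintype (M.U e) := M.finU e

/-- The conditional probability of `v i` given the parents' values in `v` and the hidden
values `u`. -/
def factor (M : CBN G s) (u : ∀ e, M.U e) (i : Fin n) (v : Fin n → Fin s) : ℝ≥0∞ :=
  M.cpd i (fun j => v j) (fun e => u e.1) (v i)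

/-- The probability that the observables take the values `v`:
`∑_u ∏_e P(u_e) ∏_i P(v_i ∣ pa_i, u)`. -/
def weight (M : CBN G s) (v : Fin n → Fin s) : ℝ≥0∞ :=
  ∑ u : (∀ e, M.U e), (∏ e, M.hid e (u e)) * ∏ i, M.factor u i v

theorem sum_update (i : Fin n) (g : (Fin n → Fin s) → ℝ≥0∞) :
    ∑ v, ∑ a, g (Function.update v i a) = s * ∑ v, g v := by
  have h : ∑ p : (Fin n → Fin s) × Fin s, g (Function.update p.1 i p.2)
      = ∑ p : (Fin n → Fin s) × Fin s, g p.1 := by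
    refine Finset.sum_bij' (fun p _ => (Function.update p.1 i p.2, p.1 i))
      (fun p _ => (Function.update p.1 i p.2, p.1 i)) ?_ ?_ ?_ ?_ ?_ <;> simp
  rw [Fintype.sum_prod_type, Fintype.sum_prod_type] at h
  rw [h]
  simp [Finset.mul_sum]

theorem sum_prod_factor (M : CBN G s) (u : ∀ e, M.U e) (A : Finset (Fin n)) :
    (s : ℝ≥0∞) ^ A.card * ∑ v, ∏ i ∈ A, M.factor u i v = (s : ℝ≥0∞) ^ n := by
  induction hA : A.card generalizing A with
  | zero =>
    rw [Finset.card_eq_zero] at hA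
    subst hA
    simp
  | succ c ih =>
    have hne : A.Nonempty := by
      rw [← Finset.card_pos]; omega
    obtain ⟨i, hi, hmax⟩ : ∃ i ∈ A, ∀ j ∈ A, ¬ G.dir i j := by
      have : IsTrans (Fin n) (fun a b => Relation.TransGen G.dir b a) :=
        ⟨fun a b c h1 h2 => h2.trans h1⟩
      have : Std.Irrefl (fun a b => Relation.TransGen G.dir b a) := ⟨G.acyclic⟩
      obtain ⟨i, hi, h⟩ := (Finite.wellFounded_of_trans_of_irrefl
        (fun a b => Relation.TransGen G.dir b a)).has_min (A : Set (Fin n)) hne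
      exact ⟨i, hi, fun j hj hd => h j hj (Relation.TransGen.single hd)⟩
    have hc : (A.erase i).card = c := by rw [Finset.card_erase_of_mem hi]; omega
    have key : s * ∑ v, ∏ j ∈ A, M.factor u j v = ∑ v, ∏ j ∈ A.erase i, M.factor u j v := by
      rw [← sum_update i]
      refine Finset.sum_congr rfl fun v _ => ?_
      have h1 : ∀ a, ∏ j ∈ A, M.factor u j (Function.update v i a)
          = M.cpd i (fun j => v j) (fun e => u e.1) a * ∏ j ∈ A.erase i, M.factor u j v := by
        intro a
        rw [← Finset.mul_prod_erase A _ hi]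
        congr 1
        · have : (fun j : {j // G.dir j i} => Function.update v i a j)
              = fun j : {j // G.dir j i} => v j := by
            funext j
            refine Function.update_of_ne ?_ _ _
            intro h
            have hj := j.2
            rw [h] at hj
            exact hmax i hi hj
          unfold factor
          rw [this, Function.update_self]
        · refine Finset.prod_congr rfl fun j hj => ?_
          have hji : j ≠ i := Finset.ne_of_mem_erase hj
          have : (fun l : {l // G.dir l j} => Function.update v i a l)
              = fun l : {l // G.dir l j} => v l := by
            funext l
            refine Function.update_of_ne ?_ _ _
            intro h
            have hl := l.2
            rw [h] at hl
            exact hmax j (Finset.mem_of_mem_erase hj) hl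
          unfold factor
          rw [this, Function.update_of_ne hji]
      simp_rw [h1]
      rw [← Finset.sum_mul]
      have := (M.cpd i (fun j => v j) (fun e => u e.1)).tsum_coe
      rw [tsum_fintype] at this
      rw [this, one_mul]
    rw [pow_succ, mul_assoc, key]
    exact ih _ hc

theorem sum_weight [NeZero s] (M : CBN G s) : ∑ v, M.weight v = 1 := by
  have h1 : ∀ u : (∀ e, M.U e), ∑ v, ∏ i, M.factor u i v = 1 := by
    intro u
    have h := M.sum_prod_factor u Finset.univ
    rw [Finset.card_univ, Fintype.card_fin] at h
    have h0 : (s : ℝ≥0∞) ^ n ≠ 0 := pow_ne_zero _ (by exact_mod_cast NeZero.ne s)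
    have ht : (s : ℝ≥0∞) ^ n ≠ ⊤ := ENNReal.pow_ne_top (ENNReal.natCast_ne_top s)
    exact (ENNReal.mul_right_inj h0 ht).1 (by rw [h, mul_one])
  unfold weight
  rw [Finset.sum_comm]
  simp_rw [← Finset.mul_sum, h1, mul_one]
  rw [← Fintype.prod_sum fun e (a : M.U e) => M.hid e a]
  refine Finset.prod_eq_one fun e _ => ?_
  have := (M.hid e).tsum_coe
  rwa [tsum_fintype] at this

/-- The observational distribution `P`. -/
def obs [NeZero s] (M : CBN G s) : PMF (Fin n → Fin s) := PMF.ofFintype M.weight M.sum_weight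

/-- The net after the intervention `X := x`: the mechanism of `X` is replaced by the constant `x`,
all the others are kept. -/
def intervene (M : CBN G s) (X : Fin n) (x : Fin s) : CBN G s where
  U := M.U
  finU := M.finU
  hid := M.hid
  cpd := fun i pa u => if i = X then PMF.pure x else M.cpd i pa u

/-- The interventional distribution `P_x` (as a distribution on all observables; `X` is
constantly `x`). -/
def interv [NeZero s] (M : CBN G s) (X : Fin n) (x : Fin s) : PMF (Fin n → Fin s) :=
  (M.intervene X x).obs

end CBN

/-- The marginal of a distribution on the set `F` of variables. -/
def marginal {n s : ℕ} (P : PMF (Fin n → Fin s)) (F : Finset (Fin n)) : PMF (F → Fin s) :=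
  P.map fun v i => v i

/-- `α`-strong positivity with respect to `X`: every assignment to `Pa⁺` of the c-component of `X`
has probability more than `α`. -/
def CBN.StronglyPositive {n : ℕ} {G : ADMG n} {s : ℕ} [NeZero s] (M : CBN G s) (X : Fin n)
    (α : ℝ) : Prop :=
  ∀ z, α < (marginal M.obs (G.paPlus (G.cComp X)) z).toReal

/-- Total variation distance on a finite type. -/
def tvDist {β : Type*} [Fintype β] (p q : PMF β) : ℝ :=
  (∑ b, |(p b).toReal - (q b).toReal|) / 2

/-- The law of `m` independent samples from `P`. -/
def iid {β : Type*} [Fintype β] (P : PMF β) (m : ℕ) : PMF (Fin m → β) :=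
  PMF.ofFintype (fun S => ∏ j, P (S j)) <| by
    have h := P.tsum_coe
    rw [tsum_fintype] at h
    rw [← Fintype.prod_sum fun (_ : Fin m) b => P b]
    simp [h]

/-! ### The machine model

A randomized random access machine with rational memory cells and unit cost arithmetic. Programs
are finite lists of instructions without jumps, so the number of executed steps, i.e. the running
time, is the length of the program, and a hard-wired table is paid for in the running time. -/

/-- Instructions. The arguments `a b c` are addresses of memory cells. -/
inductive Instr where
  /-- `mem[a] := q` -/
  | const (a : ℕ) (q : ℚ)
  /-- `mem[a] := input[i]` -/
  | read (a i : ℕ)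
  /-- `mem[a] := mem[b] + mem[c]` -/
  | plus (a b c : ℕ)
  /-- `mem[a] := mem[b] - mem[c]` -/
  | minus (a b c : ℕ)
  /-- `mem[a] := mem[b] * mem[c]` -/
  | times (a b c : ℕ)
  /-- `mem[a] := mem[b] / mem[c]` -/
  | divide (a b c : ℕ)
  /-- `mem[a] := 1` if `mem[b] ≤ mem[c]`, else `mem[a] := 0` -/
  | compare (a b c : ℕ)
  /-- indirect reading, `mem[a] := mem[mem[b]]` -/
  | load (a b : ℕ)
  /-- indirect writing, `mem[mem[a]] := mem[b]` -/
  | store (a b : ℕ)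
  /-- `mem[a]` becomes `1` with probability `mem[b]` (cut off to `[0, 1]`), else `0`,
  independently of the past -/
  | flip (a b : ℕ)

/-- The contents of the memory. -/
abbrev Mem := ℕ → ℚ

/-- A coin with bias `q`, cut off to `[0, 1]`. -/
def coin (q : ℚ) : PMF Bool :=
  PMF.ofFintype (fun r => bif r then min (ENNReal.ofReal (q : ℝ)) 1
    else 1 - min (ENNReal.ofReal (q : ℝ)) 1) <| by
    rw [Fintype.sum_bool]
    exact add_tsub_cancel_of_le (min_le_right _ _)

/-- The effect of one instruction, with input array `inp`. A cell content is used as the address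
given by its natural-number floor. -/
def Instr.step (inp : ℕ → ℚ) (μ : Mem) : Instr → PMF Mem
  | .const a q => PMF.pure (Function.update μ a q)
  | .read a i => PMF.pure (Function.update μ a (inp i))
  | .plus a b c => PMF.pure (Function.update μ a (μ b + μ c))
  | .minus a b c => PMF.pure (Function.update μ a (μ b - μ c))
  | .times a b c => PMF.pure (Function.update μ a (μ b * μ c))
  | .divide a b c => PMF.pure (Function.update μ a (μ b / μ c))
  | .compare a b c => PMF.pure (Function.update μ a (if μ b ≤ μ c then 1 else 0))
  | .load a b => PMF.pure (Function.update μ a (μ ⌊μ b⌋₊))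
  | .store a b => PMF.pure (Function.update μ ⌊μ a⌋₊ (μ b))
  | .flip a b => (coin (μ b)).map fun r => Function.update μ a (if r then 1 else 0)

/-- The distribution of the final memory when a program is run on the input array `inp` with
initial memory `μ`. -/
def run (inp : ℕ → ℚ) : List Instr → Mem → PMF Mem
  | [], μ => PMF.pure μ
  | I :: L, μ => (I.step inp μ).bind (run inp L)

/-- The input array that holds `m` samples one after the other: cell `j * n + i` holds the value of
variable `i` in sample `j`. The cells behind them are `0`. -/
def sampleInput {n s m : ℕ} (S : Fin m → Fin n → Fin s) : ℕ → ℚ := fun a =>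
  if h : a < m * n then
    ((S ⟨a / n, Nat.div_lt_of_lt_mul (by rwa [Nat.mul_comm] at h)⟩
      ⟨a % n, Nat.mod_lt _ (Nat.pos_of_ne_zero (by rintro rfl; simp at h))⟩ : Fin s) : ℕ)
  else 0

/-- The input array for the query `w`, an assignment to `F`: cell `i` holds `w i` for `i ∈ F`, all
other cells are `0`. -/
def queryInput {n s : ℕ} {F : Finset (Fin n)} (w : F → Fin s) : ℕ → ℚ := fun a =>
  if h : ∃ hn : a < n, (⟨a, hn⟩ : Fin n) ∈ F then ((w ⟨⟨a, h.1⟩, h.2⟩ : Fin s) : ℕ) else 0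

/-- The program `E` with the stored data `μ` is an evaluator for a distribution `q` on the
assignments to `F` with `tvDist D q ≤ ε`: for every query `w`, running `E` leaves `q w` in
cell `0`, with certainty. -/
def IsCloseEvaluator {n s : ℕ} {F : Finset (Fin n)} (E : List Instr) (μ : Mem)
    (D : PMF (F → Fin s)) (ε : ℝ) : Prop :=
  ∃ q : PMF (F → Fin s), tvDist D q ≤ ε ∧
    ∀ w, (run (queryInput w) E μ).map (fun ν => ((ν 0 : ℚ) : ℝ)) = PMF.pure (q w).toReal

/-- The memory after program `L` has been run, from an empty memory, on `m` independent samples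
from `P`. -/
def learned {n s : ℕ} (P : PMF (Fin n → Fin s)) (m : ℕ) (L : List Instr) : PMF Mem :=
  (iid P m).bind fun S => run (sampleInput S) L fun _ => 0

end CausalLearning

end

/-!
Fix a topological order and let the context of a vertex consist of the earlier vertices of its
c-component together with their parents and its own. Given its context, a vertex is independent of
all other earlier vertices, so `P` is the product of the conditionals of the vertices given their
contexts. When no child of `X` lies in the c-component `S₁` of `X`, the intervened law arises from
`P` by reading `X` as `x` in the conditionals outside `S₁`, drawing `X` itself with `S₁`, and
forgetting its drawn value.

The learner counts the patterns on the scopes, and add-`l` smoothing turns the counts into estimated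
conditionals. By Bernstein bounds on all counts, with high probability the `χ²`-divergence of each
estimated conditional from the true one, weighted by the law of its context, is at most
`O(sᵏᵈ⁺ᵏ l / m)`. Strong positivity bounds the law of the contexts under the intervention by `1 / α`
times the law under `P`, so along the chain rule these errors bound the Kullback–Leibler divergence,
and hence the squared total variation distance, of the two intervened laws. The evaluator sums the
product of the estimated conditionals over the assignments outside `F`; the tabulator samples from
the product vertex by vertex and tallies the outcomes on `F`.
-/

noncomputable section

open scoped ENNReal Classical

namespace CausalLearning

/-! ### Probabilities of events and couplings -/

section Prob

variable {β γ β' γ' : Type*}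

/-- The probability of the event `A`, as a real number. -/
def prob (p : PMF β) (A : Set β) : ℝ := (p.toOuterMeasure A).toReal

theorem toOuterMeasure_univ (p : PMF β) : p.toOuterMeasure Set.univ = 1 :=
  (p.toOuterMeasure_apply_eq_one_iff _).2 (Set.subset_univ _)

theorem toOuterMeasure_le_one (p : PMF β) (A : Set β) : p.toOuterMeasure A ≤ 1 :=
  (p.toOuterMeasure.mono (Set.subset_univ A)).trans_eq (toOuterMeasure_univ p)

theorem toOuterMeasure_ne_top (p : PMF β) (A : Set β) : p.toOuterMeasure A ≠ ⊤ :=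
  ne_top_of_le_ne_top ENNReal.one_ne_top (toOuterMeasure_le_one p A)

theorem prob_nonneg (p : PMF β) (A : Set β) : 0 ≤ prob p A := ENNReal.toReal_nonneg

theorem prob_univ (p : PMF β) : prob p Set.univ = 1 := by
  rw [prob, toOuterMeasure_univ, ENNReal.toReal_one]

theorem prob_mono_support {p : PMF β} {A B : Set β} (h : A ∩ p.support ⊆ B) :
    prob p A ≤ prob p B :=
  ENNReal.toReal_mono (toOuterMeasure_ne_top p B) (p.toOuterMeasure_mono h)

theorem prob_mono {p : PMF β} {A B : Set β} (h : A ⊆ B) : prob p A ≤ prob p B :=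
  prob_mono_support (Set.inter_subset_left.trans h)

theorem prob_le_one (p : PMF β) (A : Set β) : prob p A ≤ 1 :=
  (prob_mono (Set.subset_univ A)).trans_eq (prob_univ p)

theorem prob_union_le (p : PMF β) (A B : Set β) : prob p (A ∪ B) ≤ prob p A + prob p B := by
  have hA := toOuterMeasure_ne_top p A
  have hB := toOuterMeasure_ne_top p B
  rw [prob, prob, prob, ← ENNReal.toReal_add hA hB]
  exact ENNReal.toReal_mono (ENNReal.add_ne_top.2 ⟨hA, hB⟩)
    (MeasureTheory.measure_union_le A B)

theorem prob_iUnion_le {ι : Type*} [Fintype ι] (p : PMF β) (A : ι → Set β) :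
    prob p (⋃ i, A i) ≤ ∑ i, prob p (A i) := by
  simp only [prob]
  rw [← ENNReal.toReal_sum fun i _ => toOuterMeasure_ne_top p (A i)]
  exact ENNReal.toReal_mono (ENNReal.sum_ne_top.2 fun i _ => toOuterMeasure_ne_top p (A i))
    (MeasureTheory.measure_iUnion_fintype_le _ A)

theorem one_sub_le_prob {p : PMF β} {A : Set β} {δ : ℝ} (h : prob p Aᶜ ≤ δ) :
    1 - δ ≤ prob p A := by
  have h1 := prob_union_le p A Aᶜ
  rw [Set.union_compl_self, prob_univ] at h1
  linarith

theorem prob_map (f : β → γ) (p : PMF β) (A : Set γ) : prob (p.map f) A = prob p (f ⁻¹' A) := by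
  rw [prob, PMF.toOuterMeasure_map_apply, prob]

theorem prob_bind_le (p : PMF β) (f : β → PMF γ) (A : Set β) (B : Set γ) {η : ℝ} (hη : 0 ≤ η)
    (h : ∀ b ∉ A, prob (f b) B ≤ η) : prob (p.bind f) B ≤ prob p A + η := by
  have hB : ∀ b ∉ A, (f b).toOuterMeasure B ≤ ENNReal.ofReal η := fun b hb =>
    (ENNReal.le_ofReal_iff_toReal_le (toOuterMeasure_ne_top _ _) hη).2 (h b hb)
  have hsum : (p.bind f).toOuterMeasure B ≤ p.toOuterMeasure A + ENNReal.ofReal η := by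
    rw [PMF.toOuterMeasure_bind_apply, PMF.toOuterMeasure_apply]
    calc ∑' b, p b * (f b).toOuterMeasure B
        ≤ ∑' b, (A.indicator p b + p b * ENNReal.ofReal η) := by
          refine ENNReal.tsum_le_tsum fun b => ?_
          by_cases hb : b ∈ A
          · rw [Set.indicator_of_mem hb]
            exact le_add_right (mul_le_of_le_one_right' (toOuterMeasure_le_one _ _))
          · exact le_add_left (mul_le_mul_right (hB b hb) _)
      _ = ∑' b, A.indicator p b + ENNReal.ofReal η := by
          rw [ENNReal.tsum_add, ENNReal.tsum_mul_right, PMF.tsum_coe, one_mul]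
  calc prob (p.bind f) B ≤ (p.toOuterMeasure A + ENNReal.ofReal η).toReal :=
        ENNReal.toReal_mono
          (ENNReal.add_ne_top.2 ⟨toOuterMeasure_ne_top p A, ENNReal.ofReal_ne_top⟩) hsum
    _ = prob p A + η := by
        rw [ENNReal.toReal_add (toOuterMeasure_ne_top p A) ENNReal.ofReal_ne_top,
          ENNReal.toReal_ofReal hη, prob]

/-- `p` and `q` have a coupling that is supported on the relation `r`. A program is analysed by
coupling its random memory with the random object it computes. -/
def Coupled (p : PMF β) (q : PMF γ) (r : β → γ → Prop) : Prop :=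
  ∃ c : PMF (β × γ), c.map Prod.fst = p ∧ c.map Prod.snd = q ∧ ∀ x ∈ c.support, r x.1 x.2

theorem Coupled.pure {r : β → γ → Prop} {b : β} {c : γ} (h : r b c) :
    Coupled (PMF.pure b) (PMF.pure c) r :=
  ⟨PMF.pure (b, c), by simp [PMF.pure_map], by simp [PMF.pure_map], by simpa using h⟩

theorem Coupled.pure_left {q : PMF γ} {r : β → γ → Prop} {b : β} (h : ∀ c, r b c) :
    Coupled (PMF.pure b) q r :=
  ⟨q.map (Prod.mk b), by rw [PMF.map_comp]; exact PMF.map_const q b,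
    by rw [PMF.map_comp]; exact PMF.map_id q, by simpa using fun c _ => h c⟩

theorem Coupled.refl (p : PMF β) : Coupled p p Eq := by
  refine ⟨p.map fun b => (b, b), ?_, ?_, by simp⟩ <;> rw [PMF.map_comp] <;> exact PMF.map_id p

theorem Coupled.prod (p : PMF β) (q : PMF γ) : Coupled p q fun _ _ => True := by
  refine ⟨p.bind fun a => q.map (Prod.mk a), ?_, ?_, fun _ _ => trivial⟩
  · simp only [PMF.map_bind, PMF.map_comp]
    exact (congrArg p.bind (funext fun a => PMF.map_const q a)).trans (PMF.bind_pure p)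
  · simp only [PMF.map_bind, PMF.map_comp]
    exact (congrArg p.bind (funext fun _ => PMF.map_id q)).trans (PMF.bind_const p q)

theorem Coupled.bind {p : PMF β} {q : PMF γ} {r : β → γ → Prop} {f : β → PMF β'} {g : γ → PMF γ'}
    {r' : β' → γ' → Prop} (h : Coupled p q r) (hf : ∀ b c, r b c → Coupled (f b) (g c) r') :
    Coupled (p.bind f) (q.bind g) r' := by
  obtain ⟨c, rfl, rfl, hc⟩ := h
  have hd : ∀ x : β × γ, ∃ d : PMF (β' × γ'), d.map Prod.fst = f x.1 ∧ d.map Prod.snd = g x.2 ∧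
      (r x.1 x.2 → ∀ y ∈ d.support, r' y.1 y.2) := by
    intro x
    by_cases hx : r x.1 x.2
    · obtain ⟨d, hfst, hsnd, hr'⟩ := hf _ _ hx
      exact ⟨d, hfst, hsnd, fun _ => hr'⟩
    · obtain ⟨d, hfst, hsnd, -⟩ := Coupled.prod (f x.1) (g x.2)
      exact ⟨d, hfst, hsnd, fun h => (hx h).elim⟩
  choose d hfst hsnd hr' using hd
  refine ⟨c.bind d, ?_, ?_, fun y hy => ?_⟩
  · rw [PMF.map_bind, PMF.bind_map]
    exact congrArg c.bind (funext hfst)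
  · rw [PMF.map_bind, PMF.bind_map]
    exact congrArg c.bind (funext hsnd)
  · obtain ⟨x, hx, hy⟩ := (PMF.mem_support_bind_iff _ _ _).1 hy
    exact hr' x (hc x hx) y hy

theorem Coupled.bind_left {p : PMF β} {q : PMF γ} {r : β → γ → Prop} {f : β → PMF β'}
    {r' : β' → γ → Prop} (h : Coupled p q r) (hf : ∀ b c, r b c → Coupled (f b) (PMF.pure c) r') :
    Coupled (p.bind f) q r' := by
  simpa only [PMF.bind_pure] using h.bind hf

theorem Coupled.map_right {p : PMF β} {q : PMF γ} {r : β → γ → Prop} {g : γ → γ'}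
    {r' : β → γ' → Prop} (h : Coupled p q r) (hg : ∀ b c, r b c → r' b (g c)) :
    Coupled p (q.map g) r' := by
  have := h.bind (f := PMF.pure) (g := PMF.pure ∘ g) fun b c hbc => Coupled.pure (hg b c hbc)
  rwa [PMF.bind_pure, PMF.bind_pure_comp] at this

theorem Coupled.mono {p : PMF β} {q : PMF γ} {r r' : β → γ → Prop} (h : Coupled p q r)
    (hr : ∀ b c, r b c → r' b c) : Coupled p q r' :=
  h.imp fun _ ⟨hfst, hsnd, hd⟩ => ⟨hfst, hsnd, fun x hx => hr _ _ (hd x hx)⟩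

theorem Coupled.of_map_right {p : PMF β} {q : PMF γ} {g : γ → γ'}
    (hg : Function.Injective g) {r : β → γ' → Prop} (h : Coupled p (q.map g) r) :
    Coupled p q fun b c => r b (g c) := by
  obtain ⟨d, hfst, hsnd, hd⟩ := h
  have : Nonempty γ := ⟨q.support_nonempty.some⟩
  refine ⟨d.map (Prod.map id (Function.invFun g)), ?_, ?_, fun y hy => ?_⟩
  · rw [PMF.map_comp]
    exact hfst
  · rw [PMF.map_comp, show Prod.snd ∘ Prod.map id (Function.invFun g) = Function.invFun g ∘ Prod.snd
      from rfl, ← PMF.map_comp, hsnd, PMF.map_comp, Function.invFun_comp hg, PMF.map_id]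
  · obtain ⟨z, hz, rfl⟩ := (PMF.mem_support_map_iff _ _ _).1 hy
    have hmem : z.2 ∈ (q.map g).support := hsnd ▸ (PMF.mem_support_map_iff _ _ _).2 ⟨z, hz, rfl⟩
    obtain ⟨c, -, hc⟩ := (PMF.mem_support_map_iff _ _ _).1 hmem
    rw [Prod.map_snd, Function.invFun_eq ⟨c, hc⟩]
    exact hd z hz

theorem Coupled.prob_le {p : PMF β} {q : PMF γ} {r : β → γ → Prop} (h : Coupled p q r) {A : Set β}
    {B : Set γ} (hAB : ∀ b c, r b c → b ∈ A → c ∈ B) : prob p A ≤ prob q B := by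
  obtain ⟨c, rfl, rfl, hc⟩ := h
  rw [prob_map, prob_map]
  exact prob_mono_support fun x ⟨hxA, hx⟩ => hAB _ _ (hc x hx) hxA

variable [Fintype β]

theorem sum_toReal (p : PMF β) : ∑ b, (p b).toReal = 1 := by
  rw [← ENNReal.toReal_sum fun b _ => p.apply_ne_top b, ← tsum_fintype (L := .unconditional _),
    p.tsum_coe, ENNReal.toReal_one]

theorem prob_eq_sum (p : PMF β) (A : Set β) :
    prob p A = ∑ b, if b ∈ A then (p b).toReal else 0 := by
  rw [prob, PMF.toOuterMeasure_apply_fintype, ENNReal.toReal_sum]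
  · exact Finset.sum_congr rfl fun b _ => by by_cases h : b ∈ A <;> simp [h]
  · exact fun b _ => ne_top_of_le_ne_top (p.apply_ne_top b) (Set.indicator_le_self A p b)

end Prob

/-! ### Concentration of counts -/

section Concentration

variable {β : Type*} (P : PMF β) {m : ℕ} (J : Finset (Fin m)) (A : Set β)

/-- The number of samples with index in `J` that fall into `A`. -/
def countIn (S : Fin m → β) : ℕ :=
  (J.filter fun j => S j ∈ A).card

/-- The samples for which the number of hits of `A` differs from its mean by more than the
Bernstein bound at confidence `2 * exp (-l)`. -/
def deviates (l : ℝ) : Set (Fin m → β) :=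
  {S | 4 * l * (J.card * prob P A + l) < (countIn J A S - J.card * prob P A) ^ 2}

variable {P J A} in
theorem sq_sub_le_of_notMem_deviates {l : ℝ} {S : Fin m → β} (h : S ∉ deviates P J A l) :
    (countIn J A S - J.card * prob P A) ^ 2 ≤ 4 * l * (J.card * prob P A + l) := not_lt.1 h

variable [Fintype β]

theorem iid_toReal (S : Fin m → β) : (iid P m S).toReal = ∏ j, (P (S j)).toReal := by
  simp [iid, PMF.ofFintype_apply, ENNReal.toReal_prod]

theorem sum_iid_mul_prod (g : β → ℝ) :
    ∑ S, (iid P m S).toReal * ∏ j ∈ J, g (S j) = (∑ b, (P b).toReal * g b) ^ J.card := by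
  calc ∑ S, (iid P m S).toReal * ∏ j ∈ J, g (S j)
      = ∑ S : Fin m → β, ∏ j, (P (S j)).toReal * if j ∈ J then g (S j) else 1 := by
        refine Finset.sum_congr rfl fun S _ => ?_
        rw [iid_toReal, Finset.prod_mul_distrib, Finset.prod_ite_mem, Finset.univ_inter]
    _ = ∏ j, ∑ b, (P b).toReal * if j ∈ J then g b else 1 :=
        (Fintype.prod_sum fun (j : Fin m) b => (P b).toReal * if j ∈ J then g b else 1).symm
    _ = ∏ j, if j ∈ J then ∑ b, (P b).toReal * g b else 1 := by
        refine Finset.prod_congr rfl fun j _ => ?_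
        by_cases hj : j ∈ J <;> simp [hj, sum_toReal]
    _ = (∑ b, (P b).toReal * g b) ^ J.card := by
        rw [Finset.prod_ite_mem, Finset.univ_inter, Finset.prod_const]

theorem prob_le_exp_mul_sum (g : β → ℝ) (c : ℝ) :
    prob P {b | c ≤ g b} ≤ Real.exp (-c) * ∑ b, (P b).toReal * Real.exp (g b) := by
  rw [prob_eq_sum, Finset.mul_sum]
  refine Finset.sum_le_sum fun b _ => ?_
  split_ifs with hb
  · rw [mul_left_comm, ← Real.exp_add]
    exact le_mul_of_one_le_right ENNReal.toReal_nonneg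
      (Real.one_le_exp (by linarith [show c ≤ g b from hb]))
  · positivity

theorem sum_iid_mul_exp_countIn_le {t : ℝ} (ht : |t| ≤ 1) :
    ∑ S, (iid P m S).toReal * Real.exp (t * countIn J A S)
      ≤ Real.exp ((t + t ^ 2) * (J.card * prob P A)) := by
  have hexp : ∀ S : Fin m → β,
      Real.exp (t * countIn J A S) = ∏ j ∈ J, Real.exp (if S j ∈ A then t else 0) := by
    intro S
    rw [← Real.exp_sum, Finset.sum_ite, Finset.sum_const, Finset.sum_const_zero, add_zero,
      nsmul_eq_mul, mul_comm, countIn]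
  have hone : ∑ b, (P b).toReal * Real.exp (if b ∈ A then t else 0)
      = prob P A * (Real.exp t - 1) + 1 := by
    calc ∑ b, (P b).toReal * Real.exp (if b ∈ A then t else 0)
        = ∑ b, ((if b ∈ A then (P b).toReal else 0) * (Real.exp t - 1) + (P b).toReal) := by
          refine Finset.sum_congr rfl fun b _ => ?_
          by_cases hb : b ∈ A <;> simp [hb, mul_sub]
      _ = prob P A * (Real.exp t - 1) + 1 := by
          rw [Finset.sum_add_distrib, sum_toReal, prob_eq_sum, Finset.sum_mul]
  have hnonneg : 0 ≤ prob P A * (Real.exp t - 1) + 1 :=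
    hone ▸ Finset.sum_nonneg fun b _ => by positivity
  have hexp_t : Real.exp t - 1 ≤ t + t ^ 2 := by
    linarith [(abs_le.1 (Real.abs_exp_sub_one_sub_id_le ht)).2]
  simp_rw [hexp]
  rw [sum_iid_mul_prod P J fun b => Real.exp (if b ∈ A then t else 0), hone]
  calc (prob P A * (Real.exp t - 1) + 1) ^ J.card
      ≤ Real.exp (prob P A * (Real.exp t - 1)) ^ J.card :=
        pow_le_pow_left₀ hnonneg (Real.add_one_le_exp _) _
    _ = Real.exp ((Real.exp t - 1) * (J.card * prob P A)) := by
        rw [← Real.exp_nat_mul]; ring_nf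
    _ ≤ Real.exp ((t + t ^ 2) * (J.card * prob P A)) :=
        Real.exp_le_exp.2 (mul_le_mul_of_nonneg_right hexp_t
          (mul_nonneg (Nat.cast_nonneg _) (prob_nonneg P A)))

theorem prob_iid_countIn_chernoff {t : ℝ} (ht : |t| ≤ 1) (l : ℝ) :
    prob (iid P m) {S | t ^ 2 * (J.card * prob P A) + l
      ≤ t * (countIn J A S - J.card * prob P A)} ≤ Real.exp (-l) := by
  set μ := J.card * prob P A
  calc prob (iid P m) {S | t ^ 2 * μ + l ≤ t * (countIn J A S - μ)}
      ≤ prob (iid P m) {S | (t + t ^ 2) * μ + l ≤ t * countIn J A S} :=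
        prob_mono fun S hS => by
          rw [Set.mem_ofPred_eq] at hS ⊢
          linarith
    _ ≤ Real.exp (-((t + t ^ 2) * μ + l)) * Real.exp ((t + t ^ 2) * μ) :=
        (prob_le_exp_mul_sum _ _ _).trans (mul_le_mul_of_nonneg_left
          (sum_iid_mul_exp_countIn_le P J A ht) (Real.exp_pos _).le)
    _ = Real.exp (-l) := by rw [← Real.exp_add]; ring_nf

theorem prob_iid_deviates_le {l : ℝ} (hl : 0 < l) :
    prob (iid P m) (deviates P J A l) ≤ 2 * Real.exp (-l) := by
  set μ := J.card * prob P A with hμ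
  have hμ0 : 0 ≤ μ := mul_nonneg (Nat.cast_nonneg _) (prob_nonneg P A)
  have hpos : 0 < μ + l := by linarith
  -- this choice of `t` balances the two terms `t ^ 2 * μ` and `l` of the Chernoff exponent
  set t := √(l / (μ + l))
  have hsq : t ^ 2 = l / (μ + l) := Real.sq_sqrt (by positivity)
  have ht : |t| ≤ 1 := by
    rw [abs_of_nonneg (Real.sqrt_nonneg _)]
    exact Real.sqrt_le_one.2 ((div_le_one hpos).2 (by linarith))
  have htμ : t ^ 2 * μ ≤ l := by
    rw [hsq, div_mul_eq_mul_div, div_le_iff₀ hpos]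
    nlinarith
  have hcover : deviates P J A l ⊆
      {S | t ^ 2 * μ + l ≤ t * (countIn J A S - μ)} ∪
      {S | (-t) ^ 2 * μ + l ≤ (-t) * (countIn J A S - μ)} := by
    intro S hS
    simp only [deviates, Set.mem_ofPred_eq, ← hμ] at hS
    have hsq_le : (2 * l) ^ 2 ≤ (t * (countIn J A S - μ)) ^ 2 := by
      rw [mul_pow t, hsq, div_mul_eq_mul_div, le_div_iff₀ hpos]
      nlinarith
    have habs := sq_le_sq.1 hsq_le
    rw [abs_of_pos (by linarith : (0 : ℝ) < 2 * l)] at habs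
    simp only [Set.mem_union, Set.mem_ofPred_eq, neg_sq]
    rcases le_abs'.1 habs with h | h
    · exact Or.inr (by linarith)
    · exact Or.inl (by linarith)
  calc prob (iid P m) (deviates P J A l)
      ≤ prob (iid P m) {S | t ^ 2 * μ + l ≤ t * (countIn J A S - μ)}
        + prob (iid P m) {S | (-t) ^ 2 * μ + l ≤ (-t) * (countIn J A S - μ)} :=
        (prob_mono hcover).trans (prob_union_le _ _ _)
    _ ≤ Real.exp (-l) + Real.exp (-l) :=
        add_le_add (prob_iid_countIn_chernoff P J A ht l)
          (prob_iid_countIn_chernoff P J A (by rwa [abs_neg]) l)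
    _ = 2 * Real.exp (-l) := (two_mul _).symm

end Concentration

/-! ### Smoothed frequencies -/

section Smoothing

variable {l μ N : ℝ}

theorem add_le_six_mul_of_sq_sub_le (hl : 0 < l) (hN : 0 ≤ N)
    (hdev : (N - μ) ^ 2 ≤ 4 * l * (μ + l)) : μ + l ≤ 6 * (N + l) := by
  by_contra! hcon
  nlinarith

theorem sq_smoothed_error_le {Na p c : ℝ} (hl : 0 < l) (hp : 0 ≤ p) (hp1 : p ≤ 1) (hμ : 0 ≤ μ)
    (hdev : (N - μ) ^ 2 ≤ 4 * l * (μ + l))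
    (hdeva : (Na - p * μ) ^ 2 ≤ 4 * l * (p * μ + l)) :
    (p * (N + c) - (Na + l)) ^ 2 ≤ 4 * ((5 * l + 4 * l * p) * (p * μ + l) + (p * c) ^ 2) := by
  have hpμ := mul_nonneg hp hμ
  have sq_sum_four_le : ∀ a b c d : ℝ,
      (a + b + c + d) ^ 2 ≤ 4 * (a ^ 2 + b ^ 2 + c ^ 2 + d ^ 2) := fun a b c d => by
    nlinarith [sq_nonneg (a - b), sq_nonneg (a - c), sq_nonneg (a - d), sq_nonneg (b - c),
      sq_nonneg (b - d), sq_nonneg (c - d)]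
  have hcount : (p * (N - μ)) ^ 2 ≤ 4 * l * p * (p * μ + l) :=
    calc (p * (N - μ)) ^ 2 = p ^ 2 * (N - μ) ^ 2 := mul_pow _ _ _
      _ ≤ p ^ 2 * (4 * l * (μ + l)) := mul_le_mul_of_nonneg_left hdev (sq_nonneg p)
      _ = 4 * l * p * (p * μ + p * l) := by ring
      _ ≤ 4 * l * p * (p * μ + l) := by gcongr; exact mul_le_of_le_one_left hl.le hp1
  have hshift : l ^ 2 ≤ l * (p * μ + l) := by nlinarith [mul_nonneg hl.le hpμ]
  calc (p * (N + c) - (Na + l)) ^ 2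
      = (p * (N - μ) + -(Na - p * μ) + p * c + -l) ^ 2 := by ring
    _ ≤ 4 * ((p * (N - μ)) ^ 2 + (Na - p * μ) ^ 2 + (p * c) ^ 2 + l ^ 2) := by
        simpa only [neg_sq] using sq_sum_four_le (p * (N - μ)) (-(Na - p * μ)) (p * c) (-l)
    _ ≤ 4 * ((5 * l + 4 * l * p) * (p * μ + l) + (p * c) ^ 2) := by linarith

theorem smoothed_term_le {Na p c : ℝ} (hl : 0 < l) (hc : l ≤ c) (hp : 0 ≤ p) (hp1 : p ≤ 1)
    (hμ : 0 ≤ μ) (hN : 0 ≤ N) (hNa : 0 ≤ Na) (hdev : (N - μ) ^ 2 ≤ 4 * l * (μ + l))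
    (hdeva : (Na - p * μ) ^ 2 ≤ 4 * l * (p * μ + l)) :
    μ * ((p - (Na + l) / (N + c)) ^ 2 / ((Na + l) / (N + c)))
      ≤ 720 * l + (576 * l + 24 * c) * p := by
  have hU : 0 < Na + l := by linarith
  have hW : 0 < N + c := by linarith
  have hpμ : p * μ + l ≤ 6 * (Na + l) := add_le_six_mul_of_sq_sub_le hl hNa hdeva
  have hμ6 : μ ≤ 6 * (N + c) := by linarith [add_le_six_mul_of_sq_sub_le hl hN hdev]
  have hpμ' : p * μ ≤ 6 * (Na + l) := by linarith
  have hcW : c ≤ N + c := by linarith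
  have hquot : (p - (Na + l) / (N + c)) ^ 2 / ((Na + l) / (N + c))
      = (p * (N + c) - (Na + l)) ^ 2 / ((Na + l) * (N + c)) := by field_simp
  rw [hquot, ← mul_div_assoc, div_le_iff₀ (mul_pos hU hW)]
  calc μ * (p * (N + c) - (Na + l)) ^ 2
      ≤ μ * (4 * ((5 * l + 4 * l * p) * (p * μ + l) + (p * c) ^ 2)) :=
        mul_le_mul_of_nonneg_left (sq_smoothed_error_le hl hp hp1 hμ hdev hdeva) hμ
    _ = 4 * (5 * l + 4 * l * p) * (μ * (p * μ + l)) + 4 * (p * c) * ((p * μ) * c) := by ring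
    _ ≤ 4 * (5 * l + 4 * l * p) * ((6 * (N + c)) * (6 * (Na + l)))
          + 4 * (p * c) * ((6 * (Na + l)) * (N + c)) := by
        have hc0 : 0 ≤ c := hl.le.trans hc
        gcongr
    _ = (720 * l + (576 * l + 24 * c) * p) * ((Na + l) * (N + c)) := by ring

theorem smoothed_chi_sq_le {κ : Type*} [Fintype κ] [Nonempty κ] {p Na : κ → ℝ} (hl : 0 < l)
    (hp : ∀ a, 0 ≤ p a) (hp1 : ∑ a, p a = 1) (hμ : 0 ≤ μ) (hN : 0 ≤ N) (hNa : ∀ a, 0 ≤ Na a)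
    (hdev : (N - μ) ^ 2 ≤ 4 * l * (μ + l))
    (hdeva : ∀ a, (Na a - p a * μ) ^ 2 ≤ 4 * l * (p a * μ + l)) :
    μ * ∑ a, (p a - (Na a + l) / (N + Fintype.card κ * l)) ^ 2
        / ((Na a + l) / (N + Fintype.card κ * l)) ≤ 1320 * (Fintype.card κ * l) := by
  have hle : l ≤ Fintype.card κ * l :=
    le_mul_of_one_le_left hl.le (by exact_mod_cast Fintype.card_pos (α := κ))
  have hple : ∀ a, p a ≤ 1 := fun a =>
    hp1 ▸ Finset.single_le_sum (fun b _ => hp b) (Finset.mem_univ a)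
  rw [Finset.mul_sum]
  calc _ ≤ ∑ a, (720 * l + (576 * l + 24 * (Fintype.card κ * l)) * p a) :=
        Finset.sum_le_sum fun a _ =>
          smoothed_term_le hl hle (hp a) (hple a) hμ hN (hNa a) hdev (hdeva a)
    _ = 720 * (Fintype.card κ * l) + 576 * l + 24 * (Fintype.card κ * l) := by
        rw [Finset.sum_add_distrib, ← Finset.mul_sum Finset.univ p, hp1, Finset.sum_const,
          nsmul_eq_mul, Finset.card_univ]
        ring
    _ ≤ 1320 * (Fintype.card κ * l) := by linarith

end Smoothing

/-! ### Total variation, Kullback-Leibler and χ² -/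

section Divergence

variable {Ω : Type*} [Fintype Ω] {p q : Ω → ℝ}

/-- The Bhattacharyya coefficient of two densities on a finite type; `2 - 2 * bhattacharyya p q`
is their squared Hellinger distance. -/
def bhattacharyya (p q : Ω → ℝ) : ℝ := ∑ v, √(p v) * √(q v)

theorem two_sub_two_mul_bhattacharyya_le_kl (hp : ∀ v, 0 ≤ p v) (hq : ∀ v, 0 < q v)
    (hp1 : ∑ v, p v = 1) :
    2 - 2 * bhattacharyya p q ≤ ∑ v, p v * Real.log (p v / q v) := by
  have hsum : 2 - 2 * bhattacharyya p q = ∑ v, (2 * p v - 2 * (√(p v) * √(q v))) := by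
    rw [Finset.sum_sub_distrib, ← Finset.mul_sum, ← Finset.mul_sum, hp1, mul_one, bhattacharyya]
  rw [hsum]
  refine Finset.sum_le_sum fun v _ => ?_
  rcases (hp v).eq_or_lt with hv | hv
  · simp [← hv]
  have ha : 0 < √(p v) := Real.sqrt_pos.2 hv
  have hb : 0 < √(q v) := Real.sqrt_pos.2 (hq v)
  have hlog : Real.log (p v / q v) = -(2 * Real.log (√(q v) / √(p v))) := by
    have : p v / q v = ((√(q v) / √(p v)) ^ 2)⁻¹ := by
      rw [div_pow, Real.sq_sqrt (hp v), Real.sq_sqrt (hq v).le, inv_div]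
    rw [this, Real.log_inv, Real.log_pow, Nat.cast_ofNat]
  have hmul : p v * (√(q v) / √(p v)) = √(p v) * √(q v) := by
    rw [← mul_div_assoc, mul_comm (p v), mul_div_assoc, Real.div_sqrt, mul_comm]
  rw [hlog]
  nlinarith [Real.log_le_sub_one_of_pos (div_pos hb ha)]

theorem sq_tv_le_one_sub_sq_bhattacharyya (hp : ∀ v, 0 ≤ p v) (hq : ∀ v, 0 ≤ q v)
    (hp1 : ∑ v, p v = 1) (hq1 : ∑ v, q v = 1) :
    ((∑ v, |p v - q v|) / 2) ^ 2 ≤ 1 - bhattacharyya p q ^ 2 := by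
  have hminus : ∑ v, |√(p v) - √(q v)| ^ 2 = 2 - 2 * bhattacharyya p q := by
    simp only [sq_abs, sub_sq, Real.sq_sqrt (hp _), Real.sq_sqrt (hq _), Finset.sum_add_distrib,
      Finset.sum_sub_distrib, mul_assoc, ← Finset.mul_sum, hp1, hq1, bhattacharyya]
    ring
  have hplus : ∑ v, (√(p v) + √(q v)) ^ 2 = 2 + 2 * bhattacharyya p q := by
    simp only [add_sq, Real.sq_sqrt (hp _), Real.sq_sqrt (hq _), Finset.sum_add_distrib,
      mul_assoc, ← Finset.mul_sum, hp1, hq1, bhattacharyya]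
    ring
  have habs : ∀ v, |√(p v) - √(q v)| * (√(p v) + √(q v)) = |p v - q v| := fun v => by
    rw [← abs_of_nonneg (add_nonneg (Real.sqrt_nonneg (p v)) (Real.sqrt_nonneg (q v))), ← abs_mul]
    congr 1
    linear_combination Real.sq_sqrt (hp v) - Real.sq_sqrt (hq v)
  have hcs := Finset.sum_mul_sq_le_sq_mul_sq Finset.univ (fun v => |√(p v) - √(q v)|)
    (fun v => √(p v) + √(q v))
  simp only [habs, hminus, hplus] at hcs
  linarith

theorem sq_tv_le_kl (hp : ∀ v, 0 ≤ p v) (hq : ∀ v, 0 < q v) (hp1 : ∑ v, p v = 1)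
    (hq1 : ∑ v, q v = 1) :
    ((∑ v, |p v - q v|) / 2) ^ 2 ≤ ∑ v, p v * Real.log (p v / q v) :=
  calc ((∑ v, |p v - q v|) / 2) ^ 2 ≤ 1 - bhattacharyya p q ^ 2 :=
        sq_tv_le_one_sub_sq_bhattacharyya hp (fun v => (hq v).le) hp1 hq1
    _ ≤ 2 - 2 * bhattacharyya p q := by linarith [sq_nonneg (bhattacharyya p q - 1)]
    _ ≤ _ := two_sub_two_mul_bhattacharyya_le_kl hp hq hp1

theorem kl_le_chi_sq (hp : ∀ a, 0 ≤ p a) (hq : ∀ a, 0 < q a) (hp1 : ∑ a, p a = 1)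
    (hq1 : ∑ a, q a = 1) :
    ∑ a, p a * Real.log (p a / q a) ≤ ∑ a, (p a - q a) ^ 2 / q a := by
  have hterm : ∀ a, (p a - q a) ^ 2 / q a = p a * (p a / q a - 1) + (q a - p a) := fun a => by
    have := (hq a).ne'
    field_simp
    ring
  have hchi : ∑ a, (p a - q a) ^ 2 / q a = ∑ a, p a * (p a / q a - 1) := by
    simp only [hterm, Finset.sum_add_distrib, Finset.sum_sub_distrib, hp1, hq1, sub_self, add_zero]
  rw [hchi]
  refine Finset.sum_le_sum fun a _ => ?_
  rcases (hp a).eq_or_lt with ha | ha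
  · simp [← ha]
  · exact mul_le_mul_of_nonneg_left (Real.log_le_sub_one_of_pos (div_pos ha (hq a))) (hp a)

end Divergence

/-! ### Chains of conditional distributions -/

section Chain

variable {ι κ : Type*} [DecidableEq ι]

theorem dependsOn_update {β : Type*} {g : (ι → κ) → β} {D : Set ι} (hg : DependsOn g D)
    {i : ι} (hi : i ∉ D) (v : ι → κ) (a : κ) : g (Function.update v i a) = g v :=
  hg fun _ hj => Function.update_of_ne (ne_of_mem_of_not_mem hj hi) _ _

theorem eqOn_update {D : Set ι} {v w : ι → κ} (h : ∀ j ∈ D, v j = w j) (i : ι) (a : κ) :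
    ∀ j ∈ D, Function.update v i a j = Function.update w i a j := fun j hj => by
  rcases eq_or_ne j i with rfl | hji
  · rw [Function.update_self, Function.update_self]
  · rw [Function.update_of_ne hji, Function.update_of_ne hji, h j hj]

theorem sum_sum_update [Fintype ι] [Fintype κ] (i : ι) (g : (ι → κ) → ℝ) :
    ∑ v, ∑ a, g (Function.update v i a) = Fintype.card κ * ∑ v, g v := by
  have hswap : ∑ p : (ι → κ) × κ, g (Function.update p.1 i p.2) = ∑ p : (ι → κ) × κ, g p.1 := by
    refine Finset.sum_bij' (fun p _ => (Function.update p.1 i p.2, p.1 i))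
      (fun p _ => (Function.update p.1 i p.2, p.1 i)) ?_ ?_ ?_ ?_ ?_ <;> simp
  rw [← Fintype.sum_prod_type', hswap, Fintype.sum_prod_type, Finset.mul_sum]
  simp

/-- `r i` is a conditional density of coordinate `i`, given the coordinates of smaller rank. -/
structure IsChain [Fintype κ] (rank : ι → ℕ) (r : ι → (ι → κ) → ℝ) : Prop where
  dep : ∀ i, DependsOn (r i) {j | rank j ≤ rank i}
  sum_one : ∀ i v, ∑ a, r i (Function.update v i a) = 1

variable [Fintype κ] {rank : ι → ℕ} {r r' : ι → (ι → κ) → ℝ}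

theorem IsChain.dependsOn_prod (hr : IsChain rank r) {A : Finset ι} {t : ℕ}
    (hA : ∀ j ∈ A, rank j ≤ t) : DependsOn (fun v => ∏ j ∈ A, r j v) {j | rank j ≤ t} :=
  fun _ _ h => Finset.prod_congr rfl fun j hj => hr.dep j fun k hk => h k (hk.trans (hA j hj))

theorem IsChain.prod_update (hr : IsChain rank r) {A : Finset ι} {i : ι}
    (hA : ∀ j ∈ A, rank j < rank i) (v : ι → κ) (a : κ) :
    ∏ j ∈ A, r j (Function.update v i a) = ∏ j ∈ A, r j v :=
  Finset.prod_congr rfl fun j hj => dependsOn_update (hr.dep j) (not_le.2 (hA j hj)) v a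

variable [Fintype ι]

theorem IsChain.card_pow_mul_sum_mul_prod (hr : IsChain rank r) (hrank : Function.Injective rank)
    (h : (ι → κ) → ℝ) (B : Finset ι) (hB : DependsOn h (B : Set ι)ᶜ) :
    (Fintype.card κ : ℝ) ^ B.card * ∑ v, h v * ∏ j ∈ B, r j v = ∑ v, h v := by
  induction hc : B.card generalizing B with
  | zero => simp [Finset.card_eq_zero.1 hc]
  | succ c ih =>
    obtain ⟨i, hi, hmax⟩ := B.exists_max_image rank (Finset.card_pos.1 (by omega))
    have hlt : ∀ j ∈ B.erase i, rank j < rank i := fun j hj =>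
      (hmax j (Finset.mem_of_mem_erase hj)).lt_of_ne (hrank.ne (Finset.ne_of_mem_erase hj))
    have hlast : ∀ v : ι → κ, ∑ a, h (Function.update v i a)
        * ∏ j ∈ B, r j (Function.update v i a) = h v * ∏ j ∈ B.erase i, r j v := fun v =>
      calc _ = ∑ a, r i (Function.update v i a) * (h v * ∏ j ∈ B.erase i, r j v) :=
            Finset.sum_congr rfl fun a _ => by
              rw [dependsOn_update hB (by simpa using hi), ← Finset.mul_prod_erase B _ hi,
                hr.prod_update hlt]
              ring
        _ = _ := by rw [← Finset.sum_mul, hr.sum_one, one_mul]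
    rw [pow_succ, mul_assoc, ← sum_sum_update i]
    simp only [hlast]
    exact ih _ (hB.mono (by simp)) (by rw [Finset.card_erase_of_mem hi]; omega)

theorem IsChain.card_pow_mul_sum_prod_mul (hr : IsChain rank r) (hrank : Function.Injective rank)
    (t : ℕ) {g : (ι → κ) → ℝ} (hg : DependsOn g {j | rank j ≤ t}) :
    (Fintype.card κ : ℝ) ^ (Finset.univ.filter fun j => t < rank j).card
        * ∑ v, (∏ j, r j v) * g v
      = ∑ v, (∏ j with rank j ≤ t, r j v) * g v := by
  have hdep : DependsOn (fun v => (∏ j with rank j ≤ t, r j v) * g v)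
      ((Finset.univ.filter fun j => t < rank j : Finset ι) : Set ι)ᶜ := fun v w hvw => by
    have hvw' : ∀ j ∈ {j | rank j ≤ t}, v j = w j := fun j hj => hvw j (by simpa using hj)
    exact congrArg₂ (· * ·) (hr.dependsOn_prod (by simp) hvw') (hg hvw')
  rw [← hr.card_pow_mul_sum_mul_prod hrank _ _ hdep]
  refine congrArg _ (Finset.sum_congr rfl fun v _ => ?_)
  rw [← Finset.prod_filter_mul_prod_filter_not Finset.univ fun j => rank j ≤ t]
  simp only [not_le]
  ring

theorem IsChain.card_mul_sum_prod_mul (hr : IsChain rank r) (hrank : Function.Injective rank)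
    (i : ι) (g : (ι → κ) → ℝ) :
    Fintype.card κ * ∑ v, (∏ j with rank j ≤ rank i, r j v) * g v
      = ∑ v, (∏ j with rank j < rank i, r j v)
          * ∑ a, r i (Function.update v i a) * g (Function.update v i a) := by
  have hsplit : (Finset.univ.filter fun j => rank j ≤ rank i)
      = insert i (Finset.univ.filter fun j => rank j < rank i) := by
    ext j
    simp [le_iff_eq_or_lt, hrank.eq_iff]
  rw [← sum_sum_update i]
  refine Finset.sum_congr rfl fun v _ => ?_
  rw [Finset.mul_sum]
  refine Finset.sum_congr rfl fun a _ => ?_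
  rw [hsplit, Finset.prod_insert (by simp), hr.prod_update (by simp)]
  ring

variable [Nonempty κ]

theorem IsChain.sum_prod (hr : IsChain rank r) (hrank : Function.Injective rank) :
    ∑ v, ∏ j, r j v = 1 := by
  have h := hr.card_pow_mul_sum_mul_prod hrank (fun _ => 1) Finset.univ fun _ _ _ => rfl
  simp only [one_mul, Finset.sum_const, Finset.card_univ, Fintype.card_fun, nsmul_eq_mul, mul_one,
    Nat.cast_pow] at h
  exact (mul_eq_left₀ (by positivity)).1 h

theorem IsChain.sum_mul_eq (hr : IsChain rank r) (hrank : Function.Injective rank) (i : ι)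
    {g : (ι → κ) → ℝ} (hg : DependsOn g {j | rank j ≤ rank i}) :
    ∑ v, (∏ j, r j v) * g v
      = ∑ v, (∏ j, r j v) * ∑ a, r i (Function.update v i a) * g (Function.update v i a) := by
  have hmean : DependsOn (fun v => ∑ a, r i (Function.update v i a) * g (Function.update v i a))
      {j | rank j ≤ rank i} := fun v w hvw => Finset.sum_congr rfl fun a _ => by
    rw [hr.dep i (eqOn_update hvw i a), hg (eqOn_update hvw i a)]
  have hκ : (Fintype.card κ : ℝ) ≠ 0 := by positivity
  refine mul_left_cancel₀ (pow_ne_zero (Finset.univ.filter fun j => rank i < rank j).card hκ) ?_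
  rw [hr.card_pow_mul_sum_prod_mul hrank _ hg, hr.card_pow_mul_sum_prod_mul hrank _ hmean]
  refine mul_left_cancel₀ hκ ?_
  rw [hr.card_mul_sum_prod_mul hrank, hr.card_mul_sum_prod_mul hrank]
  simp only [Function.update_idem, ← Finset.sum_mul, hr.sum_one, one_mul]

/-- The `χ²`-divergence of the conditional densities of coordinate `i`, given the others. -/
def chiSq (r r' : ι → (ι → κ) → ℝ) (i : ι) (v : ι → κ) : ℝ :=
  ∑ a, (r i (Function.update v i a) - r' i (Function.update v i a)) ^ 2
    / r' i (Function.update v i a)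

theorem sq_tv_le_sum_chiSq (hr : IsChain rank r) (hr' : IsChain rank r')
    (hrank : Function.Injective rank) (h0 : ∀ i v, 0 ≤ r i v) (h0' : ∀ i v, 0 < r' i v) :
    ((∑ v, |∏ j, r j v - ∏ j, r' j v|) / 2) ^ 2 ≤ ∑ i, ∑ v, (∏ j, r j v) * chiSq r r' i v := by
  have hprod : ∀ v, 0 ≤ ∏ j, r j v := fun v => Finset.prod_nonneg fun j _ => h0 j v
  have hlog : ∀ v, (∏ j, r j v) * Real.log ((∏ j, r j v) / ∏ j, r' j v)
      = ∑ i, (∏ j, r j v) * Real.log (r i v / r' i v) := fun v => by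
    by_cases hz : ∏ j, r j v = 0
    · simp [hz]
    rw [← Finset.prod_div_distrib, Real.log_prod, Finset.mul_sum]
    exact fun i hi => div_ne_zero (Finset.prod_ne_zero_iff.1 hz i hi) (h0' i v).ne'
  have hdep : ∀ i, DependsOn (fun v => Real.log (r i v / r' i v)) {j | rank j ≤ rank i} :=
    fun i v w hvw => congrArg Real.log (congrArg₂ _ (hr.dep i hvw) (hr'.dep i hvw))
  calc ((∑ v, |∏ j, r j v - ∏ j, r' j v|) / 2) ^ 2
      ≤ ∑ v, (∏ j, r j v) * Real.log ((∏ j, r j v) / ∏ j, r' j v) :=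
        sq_tv_le_kl hprod (fun v => Finset.prod_pos fun j _ => h0' j v) (hr.sum_prod hrank)
          (hr'.sum_prod hrank)
    _ = ∑ i, ∑ v, (∏ j, r j v) * Real.log (r i v / r' i v) := by
        simp only [hlog]
        exact Finset.sum_comm
    _ ≤ ∑ i, ∑ v, (∏ j, r j v) * chiSq r r' i v := Finset.sum_le_sum fun i _ => by
        rw [hr.sum_mul_eq hrank i (hdep i)]
        exact Finset.sum_le_sum fun v _ => mul_le_mul_of_nonneg_left
          (kl_le_chi_sq (fun a => h0 _ _) (fun a => h0' _ _) (hr.sum_one i v) (hr'.sum_one i v))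
          (hprod v)

end Chain

/-! ### Functions of disjoint sets of coordinates, and cylinders -/

section Coordinates

variable {ι : Type*} [Fintype ι]

theorem sum_prod_mul_of_dependsOn [DecidableEq ι] {U : ι → Type*} [∀ e, Fintype (U e)]
    {w : ∀ e, U e → ℝ}
    (hw : ∀ e, ∑ a, w e a = 1) {E : Set ι} {f g : (∀ e, U e) → ℝ} (hf : DependsOn f E)
    (hg : DependsOn g Eᶜ) :
    ∑ u, (∏ e, w e (u e)) * (f u * g u)
      = (∑ u, (∏ e, w e (u e)) * f u) * ∑ u, (∏ e, w e (u e)) * g u := by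
  have hone : ∑ u : (∀ e, U e), ∏ e, w e (u e) = 1 := by
    rw [← Fintype.prod_sum]
    exact Finset.prod_eq_one fun e _ => hw e
  let mix (a b : ∀ e, U e) (e : ι) : U e := if e ∈ E then a e else b e
  have hmix : ∀ a b, mix (mix a b) (mix b a) = a := fun a b => by
    funext e
    by_cases he : e ∈ E <;> simp [mix, he]
  have hprod : ∀ a b, (∏ e, w e (a e)) * ∏ e, w e (b e)
      = (∏ e, w e (mix a b e)) * ∏ e, w e (mix b a e) := fun a b => by
    rw [← Finset.prod_mul_distrib, ← Finset.prod_mul_distrib]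
    refine Finset.prod_congr rfl fun e _ => ?_
    by_cases he : e ∈ E <;> simp [mix, he, mul_comm]
  have hf' : ∀ a b, f (mix a b) = f a := fun a b => hf fun e he => if_pos he
  have hg' : ∀ a b, g (mix a b) = g b := fun a b => hg fun e he => if_neg he
  rw [Finset.sum_mul_sum, ← Fintype.sum_prod_type', ← mul_one (∑ u, _), ← hone,
    Finset.sum_mul_sum, ← Fintype.sum_prod_type']
  refine (Finset.sum_bij' (fun p _ => (mix p.1 p.2, mix p.2 p.1))
    (fun p _ => (mix p.1 p.2, mix p.2 p.1)) (by simp) (by simp)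
    (fun p _ => by simp [hmix]) (fun p _ => by simp [hmix]) fun p _ => ?_).symm
  calc _ = ((∏ e, w e (p.1 e)) * ∏ e, w e (p.2 e)) * (f p.1 * g p.2) := by ring
    _ = _ := by rw [hprod, hf', hg']; ring

/-- The assignments that agree with `v` on `D`. -/
def cyl {ι κ : Type*} (D : Finset ι) (v : ι → κ) : Set (ι → κ) := {w | ∀ j ∈ D, w j = v j}

theorem cyl_congr {ι κ : Type*} {D : Finset ι} {v w : ι → κ} (h : ∀ j ∈ D, v j = w j) :
    cyl D v = cyl D w :=
  Set.ext fun u => forall₂_congr fun j hj => by rw [h j hj]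

theorem mem_cyl_comm {ι κ : Type*} {D : Finset ι} {v w : ι → κ} : v ∈ cyl D w ↔ w ∈ cyl D v :=
  forall₂_congr fun _ _ => eq_comm

theorem update_mem_cyl_iff {ι κ : Type*} [DecidableEq ι] {D : Finset ι} {i : ι} (hi : i ∈ D)
    {v w : ι → κ} {a : κ} :
    Function.update w i a ∈ cyl D v ↔ a = v i ∧ w ∈ cyl (D.erase i) v := by
  constructor
  · intro h
    refine ⟨by simpa using h i hi, fun j hj => ?_⟩
    have := h j (Finset.mem_of_mem_erase hj)
    rwa [Function.update_of_ne (Finset.ne_of_mem_erase hj)] at this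
  · rintro ⟨rfl, h⟩ j hj
    rcases eq_or_ne j i with rfl | hji
    · exact Function.update_self _ _ _
    · rw [Function.update_of_ne hji, h j (Finset.mem_erase.2 ⟨hji, hj⟩)]

theorem exists_extension {ι κ : Type*} [Nonempty κ] (D : Finset ι) (z : D → κ) :
    ∃ v : ι → κ, ∀ j : D, v j = z j :=
  ⟨fun j => if h : j ∈ D then z ⟨j, h⟩ else Classical.arbitrary κ, fun j => by simp⟩

variable {κ : Type*} [Fintype κ] [Nonempty κ] [DecidableEq ι]

theorem sum_le_of_forall_cyl_le (P : PMF (ι → κ)) (D : Finset ι) {g : (ι → κ) → ℝ}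
    (hg : DependsOn g (D : Set ι)) {b : ℝ} (hb : ∀ v, prob P (cyl D v) * g v ≤ b) :
    ∑ v, (P v).toReal * g v ≤ (Fintype.card κ : ℝ) ^ D.card * b := by
  have hfiber : ∀ z : D → κ, ∑ v with (fun j : D => v j) = z, (P v).toReal * g v ≤ b := fun z => by
    obtain ⟨v, hv⟩ := exists_extension D z
    have hmem : ∀ w, (fun j : D => w j) = z ↔ w ∈ cyl D v := fun w => by
      simp only [funext_iff, ← hv, Subtype.forall, cyl, Set.mem_ofPred_eq]
    calc _ = prob P (cyl D v) * g v := by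
          simp only [hmem, Finset.sum_filter, prob_eq_sum, Finset.sum_mul, ite_mul, zero_mul]
          refine Finset.sum_congr rfl fun w _ => ?_
          split_ifs with hw
          · rw [hg fun j hj => hw j hj]
          · rfl
      _ ≤ b := hb v
  rw [← Finset.sum_fiberwise Finset.univ fun v (j : D) => v j]
  exact (Finset.sum_le_sum fun z _ => hfiber z).trans_eq (by simp)

theorem prob_iid_deviates_cyl_le (P : PMF (ι → κ)) {m : ℕ} (J : Finset (Fin m)) (D : Finset ι)
    {l : ℝ} (hl : 0 < l) :
    prob (iid P m) {S | ∃ v, S ∈ deviates P J (cyl D v) l}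
      ≤ (Fintype.card κ : ℝ) ^ D.card * (2 * Real.exp (-l)) := by
  choose ext hext using exists_extension (κ := κ) D
  have hsub : {S | ∃ v, S ∈ deviates P J (cyl D v) l}
      ⊆ ⋃ z : D → κ, deviates P J (cyl D (ext z)) l := by
    rintro S ⟨v, hv⟩
    refine Set.mem_iUnion.2 ⟨fun j => v j, ?_⟩
    rwa [cyl_congr fun j hj => hext (fun j => v j) ⟨j, hj⟩]
  calc _ ≤ ∑ z : D → κ, prob (iid P m) (deviates P J (cyl D (ext z)) l) :=
        (prob_mono hsub).trans (prob_iUnion_le _ _)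
    _ ≤ ∑ _z : D → κ, 2 * Real.exp (-l) :=
        Finset.sum_le_sum fun z _ => prob_iid_deviates_le P J _ hl
    _ = _ := by simp

end Coordinates

/-! ### Distributions on finite types -/

section FiniteDistributions

variable {Ω Ω' : Type*} [Fintype Ω]

/-- The distribution with the given real weights. -/
def pmfOfReal (f : Ω → ℝ) (h0 : ∀ v, 0 ≤ f v) (h1 : ∑ v, f v = 1) : PMF Ω :=
  PMF.ofFintype (fun v => ENNReal.ofReal (f v)) <| by
    rw [← ENNReal.ofReal_sum_of_nonneg fun v _ => h0 v, h1, ENNReal.ofReal_one]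

theorem pmfOfReal_toReal (f : Ω → ℝ) (h0 : ∀ v, 0 ≤ f v) (h1 : ∑ v, f v = 1) (v : Ω) :
    (pmfOfReal f h0 h1 v).toReal = f v := by
  rw [pmfOfReal, PMF.ofFintype_apply, ENNReal.toReal_ofReal (h0 v)]

theorem pmf_ext_toReal {β : Type*} {p q : PMF β} (h : ∀ v, (p v).toReal = (q v).toReal) : p = q :=
  PMF.ext fun v => (ENNReal.toReal_eq_toReal_iff' (p.apply_ne_top v) (q.apply_ne_top v)).1 (h v)

theorem map_toReal [DecidableEq Ω'] (p : PMF Ω) (f : Ω → Ω') (w : Ω') :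
    (p.map f w).toReal = ∑ v, if f v = w then (p v).toReal else 0 := by
  rw [PMF.map_apply, tsum_fintype, ENNReal.toReal_sum]
  · refine Finset.sum_congr rfl fun v _ => ?_
    by_cases h : f v = w <;> simp [h, Ne.symm]
  · intro v _
    split_ifs <;> simp [p.apply_ne_top v]

theorem sum_map_toReal_mul [Fintype Ω'] (p : PMF Ω) (f : Ω → Ω') (g : Ω' → ℝ) :
    ∑ w, (p.map f w).toReal * g w = ∑ v, (p v).toReal * g (f v) := by
  simp only [map_toReal, Finset.sum_mul, ite_mul, zero_mul]
  rw [Finset.sum_comm]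
  simp

theorem marginal_toReal {n s : ℕ} (P : PMF (Fin n → Fin s)) (D : Finset (Fin n))
    (v : Fin n → Fin s) : (marginal P D fun j => v j).toReal = prob P (cyl D v) := by
  rw [marginal, map_toReal, prob_eq_sum]
  refine Finset.sum_congr rfl fun w _ => if_congr ?_ rfl rfl
  simp only [funext_iff, Subtype.forall, cyl, Set.mem_ofPred_eq]

theorem tvDist_nonneg (p q : PMF Ω) : 0 ≤ tvDist p q :=
  div_nonneg (Finset.sum_nonneg fun _ _ => abs_nonneg _) two_pos.le

theorem tvDist_map_le [Fintype Ω'] (p q : PMF Ω) (f : Ω → Ω') :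
    tvDist (p.map f) (q.map f) ≤ tvDist p q := by
  refine div_le_div_of_nonneg_right ?_ two_pos.le
  calc ∑ w, |(p.map f w).toReal - (q.map f w).toReal|
      ≤ ∑ w, ∑ v, if f v = w then |(p v).toReal - (q v).toReal| else 0 := by
        refine Finset.sum_le_sum fun w _ => ?_
        rw [map_toReal, map_toReal, ← Finset.sum_sub_distrib]
        refine (Finset.abs_sum_le_sum_abs _ _).trans (Finset.sum_le_sum fun v _ => ?_)
        split_ifs <;> simp
    _ = ∑ v, |(p v).toReal - (q v).toReal| := by
        rw [Finset.sum_comm]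
        simp

theorem tvDist_triangle (p q r : PMF Ω) : tvDist p r ≤ tvDist p q + tvDist q r := by
  rw [tvDist, tvDist, tvDist, ← add_div, ← Finset.sum_add_distrib]
  exact div_le_div_of_nonneg_right (Finset.sum_le_sum fun v _ => abs_sub_le _ _ _) two_pos.le

end FiniteDistributions

/-! ### The conditional distributions of a c-component -/

namespace ADMG

variable {n : ℕ} (G : ADMG n)

theorem mem_cComp {i j : Fin n} : j ∈ G.cComp i ↔ G.bi.Reachable i j := by simp [cComp]

theorem self_mem_cComp (i : Fin n) : i ∈ G.cComp i := G.mem_cComp.2 (SimpleGraph.Reachable.refl i)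

theorem cComp_comm {i j : Fin n} : j ∈ G.cComp i ↔ i ∈ G.cComp j := by
  rw [mem_cComp, mem_cComp, SimpleGraph.reachable_comm]

theorem mem_cComp_of_adj {i j k : Fin n} (hj : j ∈ G.cComp i) (h : G.bi.Adj j k) :
    k ∈ G.cComp i :=
  G.mem_cComp.2 ((G.mem_cComp.1 hj).trans h.reachable)

theorem cComp_eq_of_mem {i j : Fin n} (h : j ∈ G.cComp i) : G.cComp j = G.cComp i := by
  ext k
  have hij := G.mem_cComp.1 h
  rw [mem_cComp, mem_cComp]
  exact ⟨hij.trans, hij.symm.trans⟩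

theorem card_cComp_le (i : Fin n) : (G.cComp i).card ≤ G.maxCComp :=
  Finset.le_sup (f := fun i => (G.cComp i).card) (Finset.mem_univ i)

theorem mem_paPlus {S : Finset (Fin n)} {j : Fin n} :
    j ∈ G.paPlus S ↔ j ∈ S ∨ ∃ i ∈ S, G.dir j i := by
  simp [paPlus, parents]

theorem paPlus_mono {S S' : Finset (Fin n)} (h : S ⊆ S') : G.paPlus S ⊆ G.paPlus S' :=
  Finset.union_subset_union h (Finset.biUnion_subset_biUnion_of_subset_left _ h)

theorem card_parents_le (i : Fin n) : (G.parents i).card ≤ G.inDegree :=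
  Finset.le_sup (f := fun i => (G.parents i).card) (Finset.mem_univ i)

theorem card_paPlus_le (S : Finset (Fin n)) : (G.paPlus S).card ≤ S.card * (G.inDegree + 1) :=
  calc (G.paPlus S).card ≤ S.card + (S.biUnion G.parents).card := Finset.card_union_le _ _
    _ ≤ S.card + S.card * G.inDegree := by
        gcongr
        exact Finset.card_biUnion_le_card_mul _ _ _ fun i _ => G.card_parents_le i
    _ = S.card * (G.inDegree + 1) := by ring

/-- A topological numbering of the vertices: the number of ancestors, with ties broken by the
index. -/
def rank (i : Fin n) : ℕ :=
  (Finset.univ.filter fun j => Relation.TransGen G.dir j i).card * n + i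

theorem rank_injective : Function.Injective G.rank := fun i j h => by
  have hmod := congrArg (· % n) h
  simp only [rank, Nat.mul_add_mod_self_right, Nat.mod_eq_of_lt i.2, Nat.mod_eq_of_lt j.2] at hmod
  exact Fin.ext hmod

theorem rank_lt {i j : Fin n} (h : G.dir i j) : G.rank i < G.rank j := by
  have hlt : (Finset.univ.filter fun k => Relation.TransGen G.dir k i).card
      < (Finset.univ.filter fun k => Relation.TransGen G.dir k j).card := by
    refine Finset.card_lt_card (Finset.ssubset_iff_of_subset ?_ |>.2 ⟨i, ?_, ?_⟩)
    · exact Finset.monotone_filter_right _ fun k _ hk => hk.tail h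
    · simpa using Relation.TransGen.single h
    · simpa using G.acyclic i
  have := Nat.mul_le_mul_right n (Nat.succ_le_of_lt hlt)
  rw [Nat.succ_mul] at this
  have := i.2
  simp only [rank]
  omega

/-- The members of the c-component of `i` that come before `i` in the topological order. -/
def before (i : Fin n) : Finset (Fin n) := (G.cComp i).filter fun j => G.rank j < G.rank i

/-- The variables that occur in the conditional distribution of `i` given its predecessors, which
are `Pa⁺` of `i` and of the earlier members of its c-component. -/
def scope (i : Fin n) : Finset (Fin n) := G.paPlus (insert i (G.before i))

/-- The variables on which the conditional distribution of `i` given its predecessors depends. -/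
def context (i : Fin n) : Finset (Fin n) := (G.scope i).erase i

theorem self_mem_scope (i : Fin n) : i ∈ G.scope i :=
  G.mem_paPlus.2 (Or.inl (Finset.mem_insert_self _ _))

theorem insert_before_subset (i : Fin n) : insert i (G.before i) ⊆ G.cComp i :=
  Finset.insert_subset (G.self_mem_cComp i) (Finset.filter_subset _ _)

theorem scope_subset (i : Fin n) : G.scope i ⊆ G.paPlus (G.cComp i) :=
  G.paPlus_mono (G.insert_before_subset i)

theorem rank_lt_of_mem_paPlus_before {i j : Fin n} (h : j ∈ G.paPlus (G.before i)) :
    G.rank j < G.rank i := by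
  rcases G.mem_paPlus.1 h with h | ⟨k, hk, hd⟩
  · exact (Finset.mem_filter.1 h).2
  · exact (G.rank_lt hd).trans (Finset.mem_filter.1 hk).2

theorem rank_le_of_mem_scope {i j : Fin n} (h : j ∈ G.scope i) : G.rank j ≤ G.rank i := by
  have hins : ∀ k ∈ insert i (G.before i), G.rank k ≤ G.rank i := by
    simpa only [Finset.forall_mem_insert, le_refl, true_and] using
      fun k hk => (Finset.mem_filter.1 hk).2.le
  rcases G.mem_paPlus.1 h with h | ⟨k, hk, hd⟩
  · exact hins j h
  · exact (G.rank_lt hd).le.trans (hins k hk)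

/-- The bound `k * d + k` on the number of variables in a scope, where `k` is the size of the
largest c-component and `d` the maximum in-degree. -/
def width : ℕ := G.maxCComp * G.inDegree + G.maxCComp

theorem card_scope_le (i : Fin n) : (G.scope i).card ≤ G.width :=
  calc (G.scope i).card ≤ (insert i (G.before i)).card * (G.inDegree + 1) := G.card_paPlus_le _
    _ ≤ G.maxCComp * (G.inDegree + 1) := Nat.mul_le_mul_right _
        ((Finset.card_le_card (G.insert_before_subset i)).trans (G.card_cComp_le i))
    _ = G.width := Nat.mul_succ _ _

theorem card_context_add_one (i : Fin n) : (G.context i).card + 1 = (G.scope i).card :=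
  Finset.card_erase_add_one (G.self_mem_scope i)

end ADMG

namespace CBN

variable {n : ℕ} {G : ADMG n} {s : ℕ} (M : CBN G s)

/-- The c-factor of the set `A` of variables: `∑_u ∏_e P(u_e) ∏_{i ∈ A} P(v_i ∣ pa_i, u)`. -/
def setFactor (A : Finset (Fin n)) (v : Fin n → Fin s) : ℝ :=
  ∑ u : (∀ e, M.U e), (∏ e, (M.hid e (u e)).toReal) * ∏ i ∈ A, (M.factor u i v).toReal

theorem factor_toReal_le_one (u : ∀ e, M.U e) (i : Fin n) (v : Fin n → Fin s) :
    (M.factor u i v).toReal ≤ 1 :=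
  ENNReal.toReal_le_of_le_ofReal zero_le_one (ENNReal.ofReal_one ▸ PMF.coe_le_one _ _)

theorem factor_congr (u : ∀ e, M.U e) (i : Fin n) {v w : Fin n → Fin s}
    (h : ∀ j, j = i ∨ G.dir j i → v j = w j) : M.factor u i v = M.factor u i w := by
  have hpa : (fun j : {j // G.dir j i} => v j) = fun j : {j // G.dir j i} => w j :=
    funext fun j => h j (Or.inr j.2)
  rw [factor, factor, hpa, h i (Or.inl rfl)]

theorem factor_congr_hidden {u u' : ∀ e, M.U e} (i : Fin n) (v : Fin n → Fin s)
    (h : ∀ e : G.bi.edgeSet, i ∈ (e : Sym2 (Fin n)) → u e = u' e) :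
    M.factor u i v = M.factor u' i v := by
  have hhid : (fun e : {e : G.bi.edgeSet // i ∈ (e : Sym2 (Fin n))} => u e.1)
      = fun e : {e : G.bi.edgeSet // i ∈ (e : Sym2 (Fin n))} => u' e.1 :=
    funext fun e => h e.1 e.2
  rw [factor, factor, hhid]

theorem factor_update_self (u : ∀ e, M.U e) (i : Fin n) (v : Fin n → Fin s) (a : Fin s) :
    M.factor u i (Function.update v i a) = M.cpd i (fun j => v j) (fun e => u e.1) a := by
  have hpa : (fun j : {j // G.dir j i} => Function.update v i a j)
      = fun j : {j // G.dir j i} => v j :=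
    funext fun j => Function.update_of_ne
      (fun hji => G.acyclic i (.single (by simpa only [hji] using j.2))) _ _
  rw [factor, hpa, Function.update_self]

theorem factor_update_of_ne (u : ∀ e, M.U e) {i j : Fin n} (hne : j ≠ i) (hdir : ¬ G.dir i j)
    (v : Fin n → Fin s) (a : Fin s) :
    M.factor u j (Function.update v i a) = M.factor u j v := by
  refine M.factor_congr u j ?_
  rintro k (rfl | hk)
  · exact Function.update_of_ne hne _ _
  · refine Function.update_of_ne ?_ _ _
    rintro rfl
    exact hdir hk

theorem setFactor_nonneg (A : Finset (Fin n)) (v : Fin n → Fin s) : 0 ≤ M.setFactor A v :=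
  Finset.sum_nonneg fun _ _ => mul_nonneg (Finset.prod_nonneg fun _ _ => ENNReal.toReal_nonneg)
    (Finset.prod_nonneg fun _ _ => ENNReal.toReal_nonneg)

theorem setFactor_empty (v : Fin n → Fin s) : M.setFactor ∅ v = 1 := by
  simp only [setFactor, Finset.prod_empty, mul_one]
  rw [← Fintype.prod_sum fun e (a : M.U e) => (M.hid e a).toReal]
  exact Finset.prod_eq_one fun e _ => sum_toReal _

theorem setFactor_anti {A B : Finset (Fin n)} (h : A ⊆ B) (v : Fin n → Fin s) :
    M.setFactor B v ≤ M.setFactor A v := by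
  refine Finset.sum_le_sum fun u _ => mul_le_mul_of_nonneg_left ?_
    (Finset.prod_nonneg fun _ _ => ENNReal.toReal_nonneg)
  rw [← Finset.prod_sdiff h]
  exact mul_le_of_le_one_left (Finset.prod_nonneg fun _ _ => ENNReal.toReal_nonneg)
    (Finset.prod_le_one (fun _ _ => ENNReal.toReal_nonneg) fun i _ => M.factor_toReal_le_one u i v)

theorem setFactor_le_one (A : Finset (Fin n)) (v : Fin n → Fin s) : M.setFactor A v ≤ 1 :=
  (M.setFactor_anti (Finset.empty_subset A) v).trans_eq (M.setFactor_empty v)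

theorem dependsOn_setFactor (A : Finset (Fin n)) :
    DependsOn (M.setFactor A) (G.paPlus A : Set (Fin n)) := fun v w h => by
  refine Finset.sum_congr rfl fun u _ => congrArg _ (Finset.prod_congr rfl fun i hi => ?_)
  rw [M.factor_congr u i]
  rintro j (rfl | hj)
  · exact h _ (G.mem_paPlus.2 (Or.inl hi))
  · exact h _ (G.mem_paPlus.2 (Or.inr ⟨i, hi, hj⟩))

theorem sum_setFactor_update {A : Finset (Fin n)} {i : Fin n} (hi : i ∈ A)
    (hch : ∀ j ∈ A, ¬ G.dir i j) (v : Fin n → Fin s) :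
    ∑ a, M.setFactor A (Function.update v i a) = M.setFactor (A.erase i) v := by
  have hsplit : ∀ u a, ∏ j ∈ A, (M.factor u j (Function.update v i a)).toReal
      = (M.cpd i (fun j => v j) (fun e => u e.1) a).toReal
        * ∏ j ∈ A.erase i, (M.factor u j v).toReal := fun u a => by
    rw [← Finset.mul_prod_erase A _ hi, factor_update_self]
    refine congrArg _ (Finset.prod_congr rfl fun j hj => ?_)
    rw [M.factor_update_of_ne u (Finset.ne_of_mem_erase hj) (hch j (Finset.mem_of_mem_erase hj))]
  simp only [setFactor, hsplit]
  rw [Finset.sum_comm]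
  refine Finset.sum_congr rfl fun u _ => ?_
  rw [← Finset.mul_sum, ← Finset.sum_mul, sum_toReal, one_mul]

theorem setFactor_union {A B : Finset (Fin n)} (hd : Disjoint A B)
    (h : ∀ a ∈ A, ∀ b ∈ B, ¬ G.bi.Adj a b) (v : Fin n → Fin s) :
    M.setFactor (A ∪ B) v = M.setFactor A v * M.setFactor B v := by
  simp only [setFactor, Finset.prod_union hd]
  refine sum_prod_mul_of_dependsOn (w := fun e a => (M.hid e a).toReal) (fun e => sum_toReal _)
    (E := {e | ∃ a ∈ A, a ∈ (e : Sym2 (Fin n))})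
    (f := fun u => ∏ i ∈ A, (M.factor u i v).toReal)
    (g := fun u => ∏ i ∈ B, (M.factor u i v).toReal) ?_ ?_
  · refine fun u u' hu => Finset.prod_congr rfl fun a ha => ?_
    rw [M.factor_congr_hidden a v fun e hae => hu e ⟨a, ha, hae⟩]
  · refine fun u u' hu => Finset.prod_congr rfl fun b hb => ?_
    rw [M.factor_congr_hidden b v fun e hbe => hu e ?_]
    rintro ⟨a, ha, hae⟩
    have hab : (e : Sym2 (Fin n)) = s(a, b) :=
      (Sym2.mem_and_mem_iff (Finset.disjoint_iff_ne.1 hd a ha b hb)).1 ⟨hae, hbe⟩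
    exact h a ha b hb (SimpleGraph.mem_edgeSet G.bi |>.1 (hab ▸ e.2))

theorem obs_toReal [NeZero s] (v : Fin n → Fin s) :
    (M.obs v).toReal = M.setFactor Finset.univ v := by
  rw [obs, PMF.ofFintype_apply, weight, ENNReal.toReal_sum]
  · simp only [setFactor, ENNReal.toReal_mul, ENNReal.toReal_prod]
  · exact fun u _ => ENNReal.mul_ne_top (ENNReal.prod_ne_top fun e _ => PMF.apply_ne_top _ _)
      (ENNReal.prod_ne_top fun i _ => PMF.apply_ne_top _ _)

theorem interv_toReal [NeZero s] (X : Fin n) (x : Fin s) (v : Fin n → Fin s) :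
    (M.interv X x v).toReal = if v X = x then M.setFactor (Finset.univ.erase X) v else 0 := by
  have hne : ∀ (u : ∀ e, M.U e) (i : Fin n), i ≠ X →
      (M.intervene X x).factor u i v = M.factor u i v := fun u i hi => by
    simp [factor, intervene, hi]
  have hX : ∀ u : ∀ e, M.U e,
      ((M.intervene X x).factor u X v).toReal = if v X = x then 1 else 0 := fun u => by
    simp only [factor, intervene, if_true, PMF.pure_apply]
    split_ifs <;> simp
  have hprod : ∀ u : ∀ e, M.U e, ∏ i, ((M.intervene X x).factor u i v).toReal
      = (if v X = x then 1 else 0) * ∏ i ∈ Finset.univ.erase X, (M.factor u i v).toReal :=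
    fun u => by
      rw [← Finset.mul_prod_erase _ _ (Finset.mem_univ X), hX]
      exact congrArg _ (Finset.prod_congr rfl fun i hi => by
        rw [hne u i (Finset.ne_of_mem_erase hi)])
  calc (M.interv X x v).toReal
      = ∑ u : (∀ e, M.U e), (∏ e, (M.hid e (u e)).toReal)
          * ∏ i, ((M.intervene X x).factor u i v).toReal := obs_toReal _ _
    _ = _ := by
      simp only [hprod]
      split_ifs <;> simp [setFactor]

/-- The conditional probability of `v i` given the values `v` of the predecessors of `i`, uniform
where the conditioning event has probability zero. -/
def cond (i : Fin n) (v : Fin n → Fin s) : ℝ :=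
  if M.setFactor (G.before i) v = 0 then 1 / s
  else M.setFactor (insert i (G.before i)) v / M.setFactor (G.before i) v

theorem cond_nonneg (i : Fin n) (v : Fin n → Fin s) : 0 ≤ M.cond i v := by
  unfold cond
  split_ifs
  · positivity
  · exact div_nonneg (M.setFactor_nonneg _ _) (M.setFactor_nonneg _ _)

theorem cond_mul_setFactor (i : Fin n) (v : Fin n → Fin s) :
    M.cond i v * M.setFactor (G.before i) v = M.setFactor (insert i (G.before i)) v := by
  unfold cond
  split_ifs with h
  · rw [h, mul_zero]
    exact le_antisymm (M.setFactor_nonneg _ _)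
      ((M.setFactor_anti (Finset.subset_insert i _) v).trans h.le)
  · exact div_mul_cancel₀ _ h

theorem dependsOn_cond (i : Fin n) : DependsOn (M.cond i) (G.scope i : Set (Fin n)) :=
  fun v w h => by
    rw [cond, cond, M.dependsOn_setFactor (insert i (G.before i)) h,
      M.dependsOn_setFactor (G.before i) fun j hj => h j
        (G.paPlus_mono (Finset.subset_insert i _) hj)]

theorem isChain_cond [NeZero s] : IsChain G.rank M.cond := by
  refine ⟨fun i => (M.dependsOn_cond i).mono fun j hj => G.rank_le_of_mem_scope hj, fun i v => ?_⟩
  have hpast : ∀ a,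
      M.setFactor (G.before i) (Function.update v i a) = M.setFactor (G.before i) v :=
    fun a => dependsOn_update (M.dependsOn_setFactor _)
      (fun h => lt_irrefl _ (G.rank_lt_of_mem_paPlus_before h)) v a
  have hchild : ∀ j ∈ insert i (G.before i), ¬ G.dir i j := fun j hj hd =>
    (G.rank_le_of_mem_scope (G.mem_paPlus.2 (Or.inl hj))).not_gt (G.rank_lt hd)
  have hi : i ∉ G.before i := by simp [ADMG.before]
  simp only [cond, hpast]
  split_ifs with h
  · simp [NeZero.ne s]
  · rw [← Finset.sum_div, M.sum_setFactor_update (Finset.mem_insert_self _ _) hchild,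
      Finset.erase_insert hi, div_self h]

theorem cond_mul_setFactor_erase {A : Finset (Fin n)} {i : Fin n} (hi : i ∈ A)
    (hbefore : G.before i ⊆ A) (hmax : ∀ j ∈ A, G.rank j ≤ G.rank i) (v : Fin n → Fin s) :
    M.cond i v * M.setFactor (A.erase i) v = M.setFactor A v := by
  have hnot : i ∉ G.before i := by simp [ADMG.before]
  have hA : A = insert i (G.before i) ∪ A \ G.cComp i := by
    refine (Finset.union_subset (Finset.insert_subset hi hbefore) Finset.sdiff_subset).antisymm' ?_
    intro j hj
    rcases eq_or_ne j i with rfl | hji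
    · exact Finset.mem_union_left _ (Finset.mem_insert_self _ _)
    by_cases hjc : j ∈ G.cComp i
    · exact Finset.mem_union_left _ (Finset.mem_insert_of_mem (Finset.mem_filter.2
        ⟨hjc, (hmax j hj).lt_of_ne (G.rank_injective.ne hji)⟩))
    · exact Finset.mem_union_right _ (Finset.mem_sdiff.2 ⟨hj, hjc⟩)
  have herase : A.erase i = G.before i ∪ A \ G.cComp i := by
    conv_lhs => rw [hA]
    rw [Finset.insert_union, Finset.erase_insert]
    simp [hnot, G.self_mem_cComp i]
  have hadj : ∀ a ∈ insert i (G.before i), ∀ b ∈ A \ G.cComp i, ¬ G.bi.Adj a b :=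
    fun a ha b hb hab => (Finset.mem_sdiff.1 hb).2
      (G.mem_cComp_of_adj (G.insert_before_subset i ha) hab)
  have hdisj : Disjoint (insert i (G.before i)) (A \ G.cComp i) :=
    Finset.disjoint_sdiff.mono_left (G.insert_before_subset i)
  rw [herase, M.setFactor_union (hdisj.mono_left (Finset.subset_insert _ _))
    fun a ha => hadj a (Finset.mem_insert_of_mem ha), ← mul_assoc, M.cond_mul_setFactor,
    ← M.setFactor_union hdisj hadj, ← hA]

theorem prod_cond (A : Finset (Fin n)) (hA : ∀ i ∈ A, G.before i ⊆ A) (v : Fin n → Fin s) :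
    ∏ i ∈ A, M.cond i v = M.setFactor A v := by
  induction hc : A.card generalizing A with
  | zero => rw [Finset.card_eq_zero.1 hc, Finset.prod_empty, M.setFactor_empty]
  | succ c ih =>
    obtain ⟨i, hi, hmax⟩ := A.exists_max_image G.rank (Finset.card_pos.1 (by omega))
    have hclosed : ∀ j ∈ A.erase i, G.before j ⊆ A.erase i := fun j hj k hk => by
      have hjA := Finset.mem_of_mem_erase hj
      refine Finset.mem_erase.2 ⟨?_, hA j hjA hk⟩
      rintro rfl
      exact (hmax j hjA).not_gt (Finset.mem_filter.1 hk).2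
    rw [← Finset.mul_prod_erase A _ hi,
      ih _ hclosed (by rw [Finset.card_erase_of_mem hi]; omega),
      M.cond_mul_setFactor_erase hi (hA i hi) hmax]

theorem obs_eq_prod_cond [NeZero s] (v : Fin n → Fin s) :
    (M.obs v).toReal = ∏ i, M.cond i v := by
  rw [M.obs_toReal, M.prod_cond _ fun i _ => Finset.subset_univ _]

theorem prob_cyl_scope [NeZero s] (i : Fin n) (v : Fin n → Fin s) :
    prob M.obs (cyl (G.scope i) v) = M.cond i v * prob M.obs (cyl (G.context i) v) := by
  have hind : ∀ D : Finset (Fin n), prob M.obs (cyl D v)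
      = ∑ w, (∏ j, M.cond j w) * if w ∈ cyl D v then 1 else 0 := fun D => by
    simp only [prob_eq_sum, M.obs_eq_prod_cond, mul_ite, mul_one, mul_zero]
  have hdep : DependsOn (fun w => if w ∈ cyl (G.scope i) v then (1 : ℝ) else 0)
      {j | G.rank j ≤ G.rank i} := fun w w' h => by
    have hiff : w ∈ cyl (G.scope i) v ↔ w' ∈ cyl (G.scope i) v :=
      forall₂_congr fun j hj => by rw [h j (G.rank_le_of_mem_scope hj)]
    simp only [hiff]
  rw [hind, hind, M.isChain_cond.sum_mul_eq G.rank_injective i hdep, Finset.mul_sum]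
  refine Finset.sum_congr rfl fun w _ => ?_
  simp only [update_mem_cyl_iff (G.self_mem_scope i)]
  rw [ADMG.context, mul_left_comm,
    Finset.sum_eq_single (v i) (fun a _ ha => by simp [ha]) (by simp)]
  by_cases hw : w ∈ cyl ((G.scope i).erase i) v
  · have hmem : Function.update w i (v i) ∈ cyl (G.scope i) v :=
      (update_mem_cyl_iff (G.self_mem_scope i)).2 ⟨rfl, hw⟩
    simp [M.dependsOn_cond i hmem, hw]
  · simp [hw]

end CBN

theorem sum_ite_update_eq {ι κ : Type*} [Fintype ι] [DecidableEq ι] [Fintype κ] [DecidableEq κ]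
    {i : ι} {w : ι → κ} (g : (ι → κ) → ℝ) :
    (∑ v, if Function.update v i (w i) = w then g v else 0)
      = ∑ a, g (Function.update w i a) := by
  have hv : ∀ v, Function.update v i (w i) = w → Function.update w i (v i) = v := fun v h => by
    rw [← h, Function.update_idem, Function.update_eq_self]
  rw [← Finset.sum_filter]
  refine Finset.sum_nbij' (fun v => v i) (fun a => Function.update w i a) (by simp) (by simp)
    (fun v h => hv v (Finset.mem_filter.1 h).2) (by simp)
    fun v h => by rw [hv v (Finset.mem_filter.1 h).2]

theorem IsChain.sum_cyl_prod_compl {ι κ : Type*} [Fintype ι] [DecidableEq ι] [Fintype κ]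
    [Nonempty κ] {rank : ι → ℕ} {r : ι → (ι → κ) → ℝ} (hr : IsChain rank r)
    (hrank : Function.Injective rank) (A : Finset ι) (w : ι → κ) :
    (∑ v, if v ∈ cyl A w then ∏ i ∈ Aᶜ, r i v else 0) = 1 := by
  have hclamp : IsChain rank fun i (v : ι → κ) =>
      if i ∈ A then (if v i = w i then 1 else 0) else r i v := by
    refine ⟨fun i v v' h => ?_, fun i v => ?_⟩
    · rw [h i (le_refl (rank i)), hr.dep i h]
    · split_ifs
      · simp
      · exact hr.sum_one i v
  rw [← hclamp.sum_prod hrank]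
  refine Finset.sum_congr rfl fun v _ => ?_
  rw [← Finset.prod_mul_prod_compl A,
    Finset.prod_congr rfl fun i hi => if_neg (Finset.mem_compl.1 hi),
    Finset.prod_congr rfl fun i hi => if_pos hi, Finset.prod_ite_zero, Finset.prod_const_one]
  simp only [cyl, Set.mem_ofPred_eq, ite_mul, one_mul, zero_mul]
  congr

/-! ### The split distribution -/

namespace ADMG

variable {n : ℕ} (G : ADMG n) {s : ℕ} (X : Fin n) (x : Fin s)

/-- The assignment as seen by variable `i` under the split of `X`: the variables in the c-component
of `X` see the natural value of `X`, all others see the value `x`. -/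
def twist (i : Fin n) (v : Fin n → Fin s) : Fin n → Fin s :=
  if i ∈ G.cComp X then v else Function.update v X x

theorem twist_update (i : Fin n) (v : Fin n → Fin s) (a : Fin s) :
    G.twist X x i (Function.update v i a) = Function.update (G.twist X x i v) i a := by
  unfold twist
  split_ifs with h
  · rfl
  · exact Function.update_comm (by rintro rfl; exact h (G.self_mem_cComp _)) _ _ _

theorem twist_congr (i : Fin n) {v w : Fin n → Fin s} {D : Set (Fin n)}
    (h : ∀ j ∈ D, v j = w j) : ∀ j ∈ D, G.twist X x i v j = G.twist X x i w j := by
  unfold twist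
  split_ifs
  · exact h
  · exact eqOn_update h X x

theorem isChain_twist {r : Fin n → (Fin n → Fin s) → ℝ} (hr : IsChain G.rank r) :
    IsChain G.rank fun i v => r i (G.twist X x i v) := by
  refine ⟨fun i v w h => hr.dep i (G.twist_congr X x i h), fun i v => ?_⟩
  simp only [twist_update]
  exact hr.sum_one i _

theorem chiSq_twist (r r' : Fin n → (Fin n → Fin s) → ℝ) (i : Fin n) (v : Fin n → Fin s) :
    chiSq (fun i v => r i (G.twist X x i v)) (fun i v => r' i (G.twist X x i v)) i v
      = chiSq r r' i (G.twist X x i v) := by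
  simp only [chiSq, twist_update]

theorem before_subset_cComp {i : Fin n} (hi : i ∈ G.cComp X) : G.before i ⊆ G.cComp X :=
  (Finset.filter_subset _ _).trans (G.cComp_eq_of_mem hi).subset

theorem before_subset_compl_cComp {i : Fin n} (hi : i ∈ (G.cComp X)ᶜ) :
    G.before i ⊆ (G.cComp X)ᶜ := fun j hj => by
  rw [Finset.mem_compl] at hi ⊢
  intro hjX
  have hij := G.cComp_comm.1 (Finset.mem_filter.1 hj).1
  rw [G.cComp_eq_of_mem hjX] at hij
  exact hi hij

theorem disjoint_compl_cComp {A : Finset (Fin n)} (hA : A ⊆ G.cComp X) :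
    Disjoint A (G.cComp X)ᶜ :=
  Finset.disjoint_left.2 fun _ ha hb => Finset.mem_compl.1 hb (hA ha)

theorem not_adj_compl_cComp {A : Finset (Fin n)} (hA : A ⊆ G.cComp X) :
    ∀ a ∈ A, ∀ b ∈ (G.cComp X)ᶜ, ¬ G.bi.Adj a b := fun _ ha _ hb hab =>
  Finset.mem_compl.1 hb (G.mem_cComp_of_adj (hA ha) hab)

end ADMG

namespace CBN

variable {n : ℕ} {G : ADMG n} {s : ℕ} (M : CBN G s) (X : Fin n) (x : Fin s)

theorem setFactor_union_compl {A : Finset (Fin n)} (hA : A ⊆ G.cComp X) (v : Fin n → Fin s) :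
    M.setFactor (A ∪ (G.cComp X)ᶜ) v = M.setFactor A v * M.setFactor (G.cComp X)ᶜ v :=
  M.setFactor_union (G.disjoint_compl_cComp X hA) (G.not_adj_compl_cComp X hA) v

theorem prod_cond_cComp (v : Fin n → Fin s) :
    ∏ i ∈ G.cComp X, M.cond i v = M.setFactor (G.cComp X) v :=
  M.prod_cond _ (fun _ hi => G.before_subset_cComp X hi) v

theorem prod_cond_compl_cComp (v : Fin n → Fin s) :
    ∏ i ∈ (G.cComp X)ᶜ, M.cond i v = M.setFactor (G.cComp X)ᶜ v :=
  M.prod_cond _ (fun _ hi => G.before_subset_compl_cComp X hi) v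

/-- The weights of the split distribution, in which `X` keeps its natural value while its children
receive the value `x`. -/
def splitLaw (v : Fin n → Fin s) : ℝ := ∏ i, M.cond i (G.twist X x i v)

theorem splitLaw_eq (v : Fin n → Fin s) :
    M.splitLaw X x v = M.setFactor (G.cComp X) v
      * M.setFactor (G.cComp X)ᶜ (Function.update v X x) := by
  rw [splitLaw, ← Finset.prod_mul_prod_compl (G.cComp X), ← M.prod_cond_cComp,
    ← M.prod_cond_compl_cComp]
  congr 1
  · exact Finset.prod_congr rfl fun i hi => by rw [ADMG.twist, if_pos hi]
  · exact Finset.prod_congr rfl fun i hi => by rw [ADMG.twist, if_neg (Finset.mem_compl.1 hi)]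

theorem splitLaw_nonneg (v : Fin n → Fin s) : 0 ≤ M.splitLaw X x v :=
  Finset.prod_nonneg fun i _ => M.cond_nonneg i _

variable [NeZero s]

theorem sum_splitLaw : ∑ v, M.splitLaw X x v = 1 :=
  (G.isChain_twist X x M.isChain_cond).sum_prod G.rank_injective

theorem obs_split (v : Fin n → Fin s) :
    (M.obs v).toReal = M.setFactor (G.cComp X) v * M.setFactor (G.cComp X)ᶜ v := by
  rw [M.obs_toReal, ← M.setFactor_union_compl X subset_rfl, Finset.union_compl]

theorem interv_split (v : Fin n → Fin s) :
    (M.interv X x v).toReal = if v X = x then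
      M.setFactor ((G.cComp X).erase X) v * M.setFactor (G.cComp X)ᶜ v else 0 := by
  have herase : Finset.univ.erase X = (G.cComp X).erase X ∪ (G.cComp X)ᶜ := by
    rw [← Finset.union_compl (G.cComp X), Finset.erase_union_distrib,
      Finset.erase_eq_of_notMem (s := (G.cComp X)ᶜ) (by simpa using G.self_mem_cComp X)]
  rw [M.interv_toReal, herase, M.setFactor_union_compl X (Finset.erase_subset _ _)]

/-- The split distribution. Forgetting the natural value of `X` turns it into the interventional
distribution, see `interv_eq_map`. -/
def splitPMF : PMF (Fin n → Fin s) :=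
  pmfOfReal (M.splitLaw X x) (M.splitLaw_nonneg X x) (M.sum_splitLaw X x)

theorem interv_eq_map (hid : G.Identifiable X) :
    M.interv X x = (M.splitPMF X x).map fun v => Function.update v X x := by
  refine pmf_ext_toReal fun w => ?_
  rw [map_toReal, M.interv_split]
  simp only [splitPMF, pmfOfReal_toReal]
  split_ifs with hw
  · subst hw
    rw [sum_ite_update_eq]
    simp only [M.splitLaw_eq, Function.update_idem, Function.update_eq_self]
    rw [← Finset.sum_mul, M.sum_setFactor_update (G.self_mem_cComp X) fun j hj hd => hid j hd hj]
  · refine (Finset.sum_eq_zero fun v _ => if_neg ?_).symm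
    rintro rfl
    exact hw (Function.update_self _ _ _)

theorem sum_setFactor_compl (w : Fin n → Fin s) :
    (∑ v, if v ∈ cyl (G.cComp X) w then M.setFactor (G.cComp X)ᶜ v else 0) = 1 := by
  simp only [← M.prod_cond_compl_cComp]
  exact M.isChain_cond.sum_cyl_prod_compl G.rank_injective _ w

theorem prob_cyl_paPlus_le_setFactor (w : Fin n → Fin s) :
    prob M.obs (cyl (G.paPlus (G.cComp X)) w) ≤ M.setFactor (G.cComp X) w := by
  have hsub : cyl (G.paPlus (G.cComp X)) w ⊆ cyl (G.cComp X) w :=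
    fun v hv j hj => hv j (G.mem_paPlus.2 (Or.inl hj))
  calc prob M.obs (cyl (G.paPlus (G.cComp X)) w)
      ≤ ∑ v, M.setFactor (G.cComp X) w
          * (if v ∈ cyl (G.cComp X) w then M.setFactor (G.cComp X)ᶜ v else 0) := by
        rw [prob_eq_sum]
        refine Finset.sum_le_sum fun v _ => ?_
        by_cases hv : v ∈ cyl (G.paPlus (G.cComp X)) w
        · rw [if_pos hv, if_pos (hsub hv), M.obs_split X, M.dependsOn_setFactor _ hv]
        · rw [if_neg hv]
          refine mul_nonneg (M.setFactor_nonneg _ _) ?_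
          split_ifs <;> simp [M.setFactor_nonneg]
    _ = _ := by rw [← Finset.mul_sum, M.sum_setFactor_compl, mul_one]

section StronglyPositive

variable {M X} {α : ℝ}

theorem StronglyPositive.lt_prob (h : M.StronglyPositive X α) (v : Fin n → Fin s) :
    α < prob M.obs (cyl (G.paPlus (G.cComp X)) v) :=
  marginal_toReal M.obs _ v ▸ h _

theorem StronglyPositive.interv_le (h : M.StronglyPositive X α) (hα : 0 < α) (v : Fin n → Fin s) :
    (M.interv X x v).toReal ≤ α⁻¹ * (M.obs v).toReal := by
  rw [M.interv_split]
  split_ifs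
  · rw [M.obs_split X, ← mul_assoc]
    refine mul_le_mul_of_nonneg_right ((M.setFactor_le_one _ _).trans ?_) (M.setFactor_nonneg _ _)
    exact (one_le_inv_mul₀ hα).2 ((h.lt_prob v).le.trans (M.prob_cyl_paPlus_le_setFactor X v))
  · positivity

theorem StronglyPositive.le_sum_obs_mul (h : M.StronglyPositive X α) (hα : 0 < α)
    {g : (Fin n → Fin s) → ℝ} (hg : ∀ v, 0 ≤ g v)
    (hdep : DependsOn g (G.paPlus (G.cComp X) : Set (Fin n))) (v : Fin n → Fin s) :
    g v ≤ α⁻¹ * ∑ w, (M.obs w).toReal * g w := by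
  rw [le_inv_mul_iff₀ hα]
  calc α * g v ≤ prob M.obs (cyl (G.paPlus (G.cComp X)) v) * g v :=
        mul_le_mul_of_nonneg_right (h.lt_prob v).le (hg v)
    _ ≤ ∑ w, (M.obs w).toReal * g w := by
        rw [prob_eq_sum, Finset.sum_mul]
        refine Finset.sum_le_sum fun w _ => ?_
        split_ifs with hw
        · rw [hdep hw]
        · rw [zero_mul]
          exact mul_nonneg ENNReal.toReal_nonneg (hg w)

end StronglyPositive

/-- Under the split distribution, the context of every variable is at most `ρ` times as likely as
under the observational distribution, so that estimates from observational samples can be used. -/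
def Dominated (ρ : ℝ) : Prop :=
  ∀ (i : Fin n) (g : (Fin n → Fin s) → ℝ), (∀ v, 0 ≤ g v) →
    DependsOn g (G.context i : Set (Fin n)) →
    ∑ v, M.splitLaw X x v * g (G.twist X x i v) ≤ ρ * ∑ v, (M.obs v).toReal * g v

variable {M X} in
theorem StronglyPositive.dominated (hid : G.Identifiable X) {α : ℝ} (hα : 0 < α)
    (hpos : M.StronglyPositive X α) : M.Dominated X x α⁻¹ := by
  intro i g hg hdep
  by_cases hi : i ∈ G.cComp X
  · have hsub : (G.context i : Set (Fin n)) ⊆ G.paPlus (G.cComp X) := fun j hj =>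
      G.cComp_eq_of_mem hi ▸ G.scope_subset i (Finset.mem_of_mem_erase hj)
    calc ∑ v, M.splitLaw X x v * g (G.twist X x i v)
        ≤ ∑ v, M.splitLaw X x v * (α⁻¹ * ∑ v, (M.obs v).toReal * g v) :=
          Finset.sum_le_sum fun v _ => mul_le_mul_of_nonneg_left
            (hpos.le_sum_obs_mul hα hg (hdep.mono hsub) _) (M.splitLaw_nonneg X x v)
      _ = _ := by rw [← Finset.sum_mul, M.sum_splitLaw, one_mul]
  · calc ∑ v, M.splitLaw X x v * g (G.twist X x i v)
        = ∑ v, (M.interv X x v).toReal * g v := by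
          rw [M.interv_eq_map X x hid, sum_map_toReal_mul]
          simp only [splitPMF, pmfOfReal_toReal, ADMG.twist, hi, if_false]
      _ ≤ ∑ v, α⁻¹ * (M.obs v).toReal * g v := Finset.sum_le_sum fun v _ =>
          mul_le_mul_of_nonneg_right (hpos.interv_le x hα v) (hg v)
      _ = _ := by simp only [Finset.mul_sum, mul_assoc]

theorem dominated_of_no_edges (h : ∀ i j, ¬ G.dir i j) : M.Dominated X x 1 := by
  intro i g _ hdep
  have hpa : ∀ S, G.paPlus S = S := fun S => by
    ext j
    simp [G.mem_paPlus, h]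
  rw [one_mul]
  refine le_of_eq (Finset.sum_congr rfl fun v _ => ?_)
  congr 1
  · rw [M.splitLaw_eq, M.obs_split X]
    refine congrArg _ (dependsOn_update (M.dependsOn_setFactor _) ?_ v x)
    simp [hpa, G.self_mem_cComp]
  · unfold ADMG.twist
    split_ifs with hi
    · rfl
    · refine dependsOn_update hdep (fun hX => hi ?_) v x
      have hX' : X ∈ G.scope i := Finset.mem_of_mem_erase hX
      rw [ADMG.scope, hpa] at hX'
      exact G.cComp_comm.1 (G.insert_before_subset i hX')

end CBN

/-! ### Smoothed estimates of the conditional distributions -/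

namespace ADMG

variable {n : ℕ} (G : ADMG n) {s m : ℕ} (J : Finset (Fin m)) (l : ℕ) (S : Fin m → Fin n → Fin s)

/-- The estimate of the conditional probability of `v i` given the context, from the samples with
indices in `J` and with `l` virtual samples added for each value. -/
def est (i : Fin n) (v : Fin n → Fin s) : ℝ :=
  (countIn J (cyl (G.scope i) v) S + l) / (countIn J (cyl (G.context i) v) S + s * l)

theorem est_congr {i : Fin n} {v w : Fin n → Fin s} (h : ∀ j ∈ G.scope i, v j = w j) :
    G.est J l S i v = G.est J l S i w := by
  rw [est, est, cyl_congr h,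
    cyl_congr (D := G.context i) fun j hj => h j (Finset.mem_of_mem_erase hj)]

theorem cyl_context_update (i : Fin n) (v : Fin n → Fin s) (a : Fin s) :
    cyl (G.context i) (Function.update v i a) = cyl (G.context i) v :=
  cyl_congr fun _ hj => Function.update_of_ne (Finset.ne_of_mem_erase hj) _ _

theorem sum_countIn_scope (i : Fin n) (v : Fin n → Fin s) :
    ∑ a, countIn J (cyl (G.scope i) (Function.update v i a)) S
      = countIn J (cyl (G.context i) v) S := by
  unfold countIn
  rw [Finset.card_eq_sum_card_fiberwise (f := fun j => S j i) (t := Finset.univ) (by simp)]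
  refine Finset.sum_congr rfl fun a _ => congrArg _ ?_
  ext j
  have hmem : S j ∈ cyl (G.scope i) (Function.update v i a)
      ↔ a = S j i ∧ S j ∈ cyl (G.context i) v := by
    rw [mem_cyl_comm, update_mem_cyl_iff (G.self_mem_scope i), mem_cyl_comm, context]
  simp only [Finset.mem_filter, and_assoc, hmem]
  tauto

theorem dependsOn_chiSq_est {r : Fin n → (Fin n → Fin s) → ℝ} {i : Fin n}
    (hr : DependsOn (r i) (G.scope i : Set (Fin n))) :
    DependsOn (chiSq r (G.est J l S) i) (G.context i : Set (Fin n)) := fun v w h => by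
  refine Finset.sum_congr rfl fun a _ => ?_
  have hupdate : ∀ j ∈ (G.scope i : Set (Fin n)),
      Function.update v i a j = Function.update w i a j := fun j hj => by
    rcases eq_or_ne j i with rfl | hji
    · rw [Function.update_self, Function.update_self]
    · rw [Function.update_of_ne hji, Function.update_of_ne hji, h j (Finset.mem_erase.2 ⟨hji, hj⟩)]
  rw [hr hupdate, G.est_congr J l S hupdate]

variable {l} [NeZero s]

theorem est_den_pos (hl : 0 < l) (i : Fin n) (v : Fin n → Fin s) :
    (0 : ℝ) < countIn J (cyl (G.context i) v) S + s * l := by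
  have hs := Nat.pos_of_neZero s
  positivity

theorem est_pos (hl : 0 < l) (i : Fin n) (v : Fin n → Fin s) : 0 < G.est J l S i v :=
  div_pos (by positivity) (G.est_den_pos J S hl i v)

theorem isChain_est (hl : 0 < l) : IsChain G.rank (G.est J l S) := by
  refine ⟨fun i v w h => G.est_congr J l S fun j hj => h j (G.rank_le_of_mem_scope hj),
    fun i v => ?_⟩
  simp only [est, cyl_context_update]
  rw [← Finset.sum_div, div_eq_one_iff_eq (G.est_den_pos J S hl i v).ne',
    Finset.sum_add_distrib, ← Nat.cast_sum, G.sum_countIn_scope]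
  simp

/-- The estimate of the split distribution. -/
def estPMF (X : Fin n) (x : Fin s) (hl : 0 < l) : PMF (Fin n → Fin s) :=
  pmfOfReal (fun v => ∏ i, G.est J l S i (G.twist X x i v))
    (fun _ => Finset.prod_nonneg fun i _ => (G.est_pos J S hl i _).le)
    ((G.isChain_twist X x (G.isChain_est J S hl)).sum_prod G.rank_injective)

end ADMG

/-- The values of `v` on `F` after the intervention `X := x`. -/
def readOff {n s : ℕ} (F : Finset (Fin n)) (X : Fin n) (x : Fin s) (v : Fin n → Fin s) :
    F → Fin s :=
  fun j => Function.update v X x j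

namespace CBN

variable {n : ℕ} {G : ADMG n} {s : ℕ} [NeZero s] (M : CBN G s) {m : ℕ} (J : Finset (Fin m))

/-- The samples for which the number of occurrences of some assignment to some scope or context is
far from its mean. -/
def badSamples (l : ℕ) : Set (Fin m → Fin n → Fin s) :=
  ⋃ i : Fin n, {S | ∃ v, S ∈ deviates M.obs J (cyl (G.scope i) v) l} ∪
    {S | ∃ v, S ∈ deviates M.obs J (cyl (G.context i) v) l}

theorem prob_iid_badSamples_le {l : ℕ} (hl : 0 < l) :
    prob (iid M.obs m) (M.badSamples J l)
      ≤ 4 * n * (s : ℝ) ^ G.width * Real.exp (-l) := by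
  set K := G.width
  have hs : (1 : ℝ) ≤ s := by exact_mod_cast Nat.pos_of_neZero s
  have hcyl : ∀ D : Finset (Fin n), D.card ≤ K →
      prob (iid M.obs m) {S | ∃ v, S ∈ deviates M.obs J (cyl D v) l}
        ≤ (s : ℝ) ^ K * (2 * Real.exp (-l)) := fun D hD => by
    refine (prob_iid_deviates_cyl_le M.obs J D (Nat.cast_pos.2 hl)).trans ?_
    rw [Fintype.card_fin]
    gcongr
  have hcontext : ∀ i, (G.context i).card ≤ K := fun i =>
    (Finset.card_erase_le).trans (G.card_scope_le i)
  calc prob (iid M.obs m) (M.badSamples J l)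
      ≤ ∑ _i : Fin n, ((s : ℝ) ^ K * (2 * Real.exp (-l)) + (s : ℝ) ^ K * (2 * Real.exp (-l))) :=
        (prob_iUnion_le _ _).trans (Finset.sum_le_sum fun i _ => (prob_union_le _ _ _).trans
          (add_le_add (hcyl _ (G.card_scope_le i)) (hcyl _ (hcontext i))))
    _ = _ := by
        rw [Finset.sum_const, Finset.card_univ, Fintype.card_fin, nsmul_eq_mul]
        ring

variable {M J} {l : ℕ} {S : Fin m → Fin n → Fin s}

theorem notMem_deviates_of_notMem_badSamples (hS : S ∉ M.badSamples J l) (i : Fin n)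
    (v : Fin n → Fin s) : S ∉ deviates M.obs J (cyl (G.scope i) v) l
      ∧ S ∉ deviates M.obs J (cyl (G.context i) v) l :=
  ⟨fun h => hS (Set.mem_iUnion.2 ⟨i, Or.inl ⟨v, h⟩⟩),
    fun h => hS (Set.mem_iUnion.2 ⟨i, Or.inr ⟨v, h⟩⟩)⟩

theorem prob_mul_chiSq_le (hl : 0 < l) (hJ : J.Nonempty) (hS : S ∉ M.badSamples J l) (i : Fin n)
    (v : Fin n → Fin s) :
    prob M.obs (cyl (G.context i) v) * chiSq M.cond (G.est J l S) i v
      ≤ 1320 * (s * l) / J.card := by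
  have hJ' : (0 : ℝ) < J.card := Nat.cast_pos.2 hJ.card_pos
  have h := smoothed_chi_sq_le (l := (l : ℝ)) (μ := J.card * prob M.obs (cyl (G.context i) v))
    (N := countIn J (cyl (G.context i) v) S) (p := fun a => M.cond i (Function.update v i a))
    (Na := fun a => countIn J (cyl (G.scope i) (Function.update v i a)) S) (Nat.cast_pos.2 hl)
    (fun a => M.cond_nonneg i _) (M.isChain_cond.sum_one i v)
    (mul_nonneg hJ'.le (prob_nonneg _ _)) (Nat.cast_nonneg _) (fun a => Nat.cast_nonneg _)
    (sq_sub_le_of_notMem_deviates (notMem_deviates_of_notMem_badSamples hS i v).2) fun a => ?_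
  · rw [le_div_iff₀ hJ']
    refine le_trans (le_of_eq ?_) (by simpa only [Fintype.card_fin] using h)
    simp only [chiSq, ADMG.est, ADMG.cyl_context_update]
    ring
  · have hdev := sq_sub_le_of_notMem_deviates
      (notMem_deviates_of_notMem_badSamples hS i (Function.update v i a)).1
    rwa [M.prob_cyl_scope, ADMG.cyl_context_update, mul_left_comm] at hdev

theorem sum_splitLaw_mul_chiSq_le {X : Fin n} {x : Fin s} {ρ : ℝ} (hρ : 0 ≤ ρ)
    (hdom : M.Dominated X x ρ) (hl : 0 < l) (hJ : J.Nonempty) (hS : S ∉ M.badSamples J l)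
    (i : Fin n) :
    ∑ v, M.splitLaw X x v * chiSq M.cond (G.est J l S) i (G.twist X x i v)
      ≤ ρ * ((s : ℝ) ^ G.width * (1320 * l) / J.card) := by
  have hs : (1 : ℝ) ≤ s := by exact_mod_cast Nat.pos_of_neZero s
  have hdep := G.dependsOn_chiSq_est J l S (M.dependsOn_cond i)
  refine (hdom i _ (fun v => Finset.sum_nonneg fun a _ =>
    div_nonneg (sq_nonneg _) (G.est_pos J S hl i _).le) hdep).trans
    (mul_le_mul_of_nonneg_left ?_ hρ)
  calc ∑ v, (M.obs v).toReal * chiSq M.cond (G.est J l S) i v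
      ≤ (s : ℝ) ^ (G.context i).card * (1320 * (s * l) / J.card) := by
        simpa only [Fintype.card_fin] using
          sum_le_of_forall_cyl_le M.obs (G.context i) hdep (prob_mul_chiSq_le hl hJ hS i)
    _ = (s : ℝ) ^ ((G.context i).card + 1) * (1320 * l) / J.card := by rw [pow_succ]; ring
    _ ≤ _ := by
        rw [G.card_context_add_one]
        gcongr
        exact G.card_scope_le i

theorem sq_tvDist_splitPMF_estPMF_le {X : Fin n} {x : Fin s} {ρ : ℝ} (hρ : 0 ≤ ρ)
    (hdom : M.Dominated X x ρ) (hl : 0 < l) (hJ : J.Nonempty) (hS : S ∉ M.badSamples J l) :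
    tvDist (M.splitPMF X x) (G.estPMF J S X x hl) ^ 2
      ≤ ρ * (n * (s : ℝ) ^ G.width * (1320 * l) / J.card) := by
  have hchain := sq_tv_le_sum_chiSq (G.isChain_twist X x M.isChain_cond)
    (G.isChain_twist X x (G.isChain_est J S hl)) G.rank_injective (fun i v => M.cond_nonneg i _)
    (fun i v => G.est_pos J S hl i _)
  simp only [ADMG.chiSq_twist] at hchain
  calc tvDist (M.splitPMF X x) (G.estPMF J S X x hl) ^ 2
      ≤ ∑ i, ∑ v, M.splitLaw X x v * chiSq M.cond (G.est J l S) i (G.twist X x i v) := by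
        simpa only [tvDist, splitPMF, splitLaw, ADMG.estPMF, pmfOfReal_toReal] using hchain
    _ ≤ ∑ _i : Fin n,
        ρ * ((s : ℝ) ^ G.width * (1320 * l) / J.card) :=
        Finset.sum_le_sum fun i _ => sum_splitLaw_mul_chiSq_le hρ hdom hl hJ hS i
    _ = _ := by
        rw [Finset.sum_const, Finset.card_univ, Fintype.card_fin, nsmul_eq_mul]
        ring

theorem marginal_interv_eq_map_readOff {X : Fin n} (hid : G.Identifiable X) (x : Fin s)
    (F : Finset (Fin n)) :
    marginal (M.interv X x) F = (M.splitPMF X x).map (readOff F X x) := by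
  rw [M.interv_eq_map X x hid, marginal, PMF.map_comp]
  rfl

theorem sq_tvDist_map_readOff_estPMF_le {X : Fin n} {x : Fin s} {ρ : ℝ} (hid : G.Identifiable X)
    (F : Finset (Fin n)) (hρ : 0 ≤ ρ) (hdom : M.Dominated X x ρ) (hl : 0 < l) (hJ : J.Nonempty)
    (hS : S ∉ M.badSamples J l) :
    tvDist (marginal (M.interv X x) F) ((G.estPMF J S X x hl).map (readOff F X x)) ^ 2
      ≤ ρ * (n * (s : ℝ) ^ G.width * (1320 * l) / J.card) := by
  refine le_trans ?_ (sq_tvDist_splitPMF_estPMF_le hρ hdom hl hJ hS)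
  rw [marginal_interv_eq_map_readOff hid]
  exact pow_le_pow_left₀ (tvDist_nonneg _ _) (tvDist_map_le _ _ _) 2

end CBN

/-! ### Running programs -/

section Runs

variable {inp : ℕ → ℚ}

theorem run_append (L L' : List Instr) (μ : Mem) :
    run inp (L ++ L') μ = (run inp L μ).bind (run inp L') := by
  induction L generalizing μ with
  | nil => simp [run]
  | cons I L ih =>
    simp only [List.cons_append, run, PMF.bind_bind]
    exact congrArg _ (funext ih)

variable (inp) in
/-- The program `L` turns the memory `μ` into `ν`, with certainty. -/
def Runs (L : List Instr) (μ ν : Mem) : Prop := run inp L μ = PMF.pure ν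

theorem Runs.nil (μ : Mem) : Runs inp [] μ μ := rfl

theorem Runs.append {L L' : List Instr} {μ ν ξ : Mem} (h : Runs inp L μ ν)
    (h' : Runs inp L' ν ξ) : Runs inp (L ++ L') μ ξ := by
  unfold Runs at *
  rw [run_append, h, PMF.pure_bind, h']

variable {κ : Type*}

theorem exists_runs_flatMap {f : κ → List Instr} (inv : List κ → Mem → Prop)
    (hf : ∀ l j μ, inv l μ → ∃ ν, Runs inp (f j) μ ν ∧ inv (l ++ [j]) ν) {μ : Mem}
    (hμ : inv [] μ) (l : List κ) : ∃ ν, Runs inp (l.flatMap f) μ ν ∧ inv l ν := by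
  induction l using List.reverseRecOn with
  | nil => exact ⟨μ, Runs.nil μ, hμ⟩
  | append_singleton l j ih =>
    obtain ⟨ν, hrun, hν⟩ := ih
    obtain ⟨ξ, hrun', hξ⟩ := hf l j ν hν
    refine ⟨ξ, ?_, hξ⟩
    rw [List.flatMap_append, List.flatMap_singleton]
    exact hrun.append hrun'

theorem exists_runs_assign {I : κ → Instr} {cell : κ → ℕ} {val : κ → ℚ}
    (hI : ∀ j μ, (I j).step inp μ = PMF.pure (Function.update μ (cell j) (val j)))
    (hcell : Function.Injective cell) (l : List κ) (μ : Mem) :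
    ∃ ν, Runs inp (l.map I) μ ν ∧
      (∀ j ∈ l, ν (cell j) = val j) ∧ ∀ a, (∀ j ∈ l, a ≠ cell j) → ν a = μ a := by
  rw [List.map_eq_flatMap]
  refine exists_runs_flatMap (fun l ν => (∀ j ∈ l, ν (cell j) = val j) ∧
    ∀ a, (∀ j ∈ l, a ≠ cell j) → ν a = μ a) (fun l j ν ⟨hval, hkeep⟩ => ?_) (by simp) l
  refine ⟨Function.update ν (cell j) (val j), by simp [Runs, run, hI], fun k hk => ?_,
    fun a ha => ?_⟩
  · rcases eq_or_ne k j with rfl | hkj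
    · exact Function.update_self ..
    · rw [Function.update_of_ne (hcell.ne hkj), hval k (by simpa [hkj] using hk)]
  · rw [Function.update_of_ne (ha j (by simp)), hkeep a fun k hk => ha k (by simp [hk])]

end Runs

/-! ### Codes of assignments -/

section Codes

variable {κ : Type*} {s : ℕ}

/-- The number with the digits `v j`, `j ∈ l`, in base `s`, the first one being the least
significant. It is the index under which counts for the assignment `v` are stored. -/
def codeOf (l : List κ) (v : κ → Fin s) : ℕ :=
  Nat.ofDigits s (l.map fun j => (v j : ℕ))

theorem codeOf_cons (j : κ) (l : List κ) (v : κ → Fin s) :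
    codeOf (j :: l) v = v j + s * codeOf l v := by
  simp [codeOf, Nat.ofDigits_cons]

theorem codeOf_lt (hs : 2 ≤ s) (l : List κ) (v : κ → Fin s) : codeOf l v < s ^ l.length := by
  simpa [codeOf] using Nat.ofDigits_lt_base_pow_length (b := s) (l := l.map fun j => (v j : ℕ))
    (by omega) (by simp)

theorem codeOf_lt_of_nodup (hs : 2 ≤ s) [Fintype κ] {l : List κ} (hl : l.Nodup) (v : κ → Fin s) :
    codeOf l v < s ^ Fintype.card κ :=
  (codeOf_lt hs l v).trans_le (Nat.pow_le_pow_right (by omega) hl.length_le_card)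

theorem codeOf_eq_iff (hs : 2 ≤ s) {l : List κ} {v w : κ → Fin s} :
    codeOf l v = codeOf l w ↔ ∀ j ∈ l, v j = w j := by
  refine ⟨fun h => ?_, fun h => ?_⟩
  · have := Nat.ofDigits_inj_of_len_eq (b := s) (by omega) (by simp) (by simp) (by simp) h
    rw [List.map_inj_left] at this
    exact fun j hj => Fin.ext (this j hj)
  · exact congrArg (Nat.ofDigits s) (List.map_congr_left fun j hj => by rw [h j hj])

/-- The program that writes the number with the digits stored in the cells `l`, in the base stored
in cell `2`, to cell `1`. -/
def horner : List ℕ → List Instr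
  | [] => [.const 1 0]
  | a :: l => horner l ++ [.times 1 1 2, .plus 1 1 a]

theorem length_horner (l : List ℕ) : (horner l).length = 2 * l.length + 1 := by
  induction l with
  | nil => rfl
  | cons a l ih => simp [horner, ih]; ring

theorem runs_horner_step (inp : ℕ → ℚ) {j : κ} {l : List κ} {v : κ → Fin s} {a : ℕ} {μ : Mem}
    (hcode : μ 1 = (codeOf l v : ℕ)) (hbase : μ 2 = s) (hdigit : μ a = (v j : ℕ)) (ha : a ≠ 1) :
    Runs inp [.times 1 1 2, .plus 1 1 a] μ (Function.update μ 1 (codeOf (j :: l) v : ℕ)) := by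
  simp only [Runs, run, Instr.step, PMF.pure_bind, Function.update_self, Function.update_idem,
    Function.update_of_ne ha, hcode, hbase, hdigit, codeOf_cons]
  congr 2
  push_cast
  ring

theorem runs_horner (inp : ℕ → ℚ) {cell : κ → ℕ} {l : List κ} {v : κ → Fin s} {μ : Mem}
    (hbase : μ 2 = s) (hcell : ∀ j ∈ l, cell j ≠ 1) (hv : ∀ j ∈ l, μ (cell j) = (v j : ℕ)) :
    Runs inp (horner (l.map cell)) μ (Function.update μ 1 (codeOf l v : ℕ)) := by
  induction l with
  | nil => simp [Runs, horner, run, Instr.step, codeOf]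
  | cons j l ih =>
    have hj := hcell j List.mem_cons_self
    have hstep := runs_horner_step inp (j := j) (l := l) (v := v) (a := cell j)
      (μ := Function.update μ 1 (codeOf l v : ℕ)) (Function.update_self ..)
      (by rw [Function.update_of_ne (by norm_num), hbase])
      (by rw [Function.update_of_ne hj, hv j List.mem_cons_self]) hj
    rw [Function.update_idem] at hstep
    exact (ih (fun k hk => hcell k (List.mem_cons_of_mem _ hk))
      fun k hk => hv k (List.mem_cons_of_mem _ hk)).append hstep

end Codes

/-! ### Tables -/

/-- The address of entry `c` of table `t`. Cells below `20` are registers, cell `20 + j` holds the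
value of variable `j`, and cell `20 + n` the value of the intervention. -/
def tab (n s t c : ℕ) : ℕ := 21 + n + t * s ^ n + c

theorem tab_inj {n s t c t' c' : ℕ} (hc : c < s ^ n) (hc' : c' < s ^ n) :
    tab n s t c = tab n s t' c' ↔ t = t' ∧ c = c' := by
  refine ⟨fun h => ?_, by rintro ⟨rfl, rfl⟩; rfl⟩
  have hindex : t * s ^ n + c = t' * s ^ n + c' := by unfold tab at h; omega
  have hmod := congrArg (· % s ^ n) hindex
  simp only [Nat.mul_add_mod_self_right, Nat.mod_eq_of_lt hc, Nat.mod_eq_of_lt hc'] at hmod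
  exact ⟨Nat.eq_of_mul_eq_mul_right (Nat.zero_lt_of_lt hc) (by omega), hmod⟩

theorem le_tab (n s t c : ℕ) : 21 + n ≤ tab n s t c := by unfold tab; omega

theorem floor_tab (n s t c : ℕ) : ⌊((tab n s t 0 : ℕ) : ℚ) + (c : ℚ)⌋₊ = tab n s t c := by
  rw [← Nat.cast_add, Nat.floor_natCast]; rfl

/-- The program that adds the content of cell `9` to the entry of table `t` whose index is in
cell `1`. -/
def bump (n s t : ℕ) : List Instr :=
  [.const 3 (tab n s t 0 : ℕ), .plus 3 3 1, .load 4 3, .plus 4 4 9, .store 3 4]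

theorem exists_runs_bump (inp : ℕ → ℚ) (n s t : ℕ) {c : ℕ} {μ : Mem} (hc : μ 1 = c) :
    ∃ ν, Runs inp (bump n s t) μ ν ∧
      ∀ a, a ≠ 3 → a ≠ 4 → ν a = μ a + if a = tab n s t c then μ 9 else 0 := by
  have htab : tab n s t c ≠ 3 := by have := le_tab n s t c; omega
  refine ⟨_, by simp only [Runs, bump, run, Instr.step, PMF.pure_bind]; rfl, fun a h3 h4 => ?_⟩
  simp only [Function.update_self, Function.update_of_ne (by norm_num : (1 : ℕ) ≠ 3),
    Function.update_of_ne (by norm_num : (3 : ℕ) ≠ 4),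
    Function.update_of_ne (by norm_num : (9 : ℕ) ≠ 4),
    Function.update_of_ne (by norm_num : (9 : ℕ) ≠ 3), hc, floor_tab n s t c,
    Function.update_of_ne htab]
  by_cases ha : a = tab n s t c
  · subst ha
    simp
  · simp [ha, h3, h4]

/-! ### The learner -/

theorem varCell_injective {n : ℕ} : Function.Injective fun j : Fin n => 20 + (j : ℕ) :=
  fun i j h => Fin.ext (by simpa using h)

theorem sampleInput_apply {n s m : ℕ} (S : Fin m → Fin n → Fin s) (j : Fin m) (t : Fin n) :
    sampleInput S (j * n + t) = (S j t : ℕ) := by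
  have hlt : (j : ℕ) * n + t < m * n :=
    calc (j : ℕ) * n + t < (j + 1) * n := by rw [Nat.succ_mul]; exact Nat.add_lt_add_left t.2 _
      _ ≤ m * n := Nat.mul_le_mul_right n j.2
  have hdiv : ((j : ℕ) * n + t) / n = j := by
    rw [mul_comm, Nat.mul_add_div t.pos, Nat.div_eq_of_lt t.2, add_zero]
  have hmod : ((j : ℕ) * n + t) % n = t := by
    rw [Nat.mul_add_mod_self_right, Nat.mod_eq_of_lt t.2]
  rw [sampleInput, dif_pos hlt]
  simp only [hdiv, hmod]

/-- The first `m` of `N` samples. -/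
def used (N m : ℕ) : Finset (Fin N) := Finset.univ.filter fun j => (j : ℕ) < m

theorem card_used {N m : ℕ} (h : m ≤ N) : (used N m).card = m := by
  rw [used, Fin.card_filter_val_lt]
  exact min_eq_right h

theorem used_succ {N m : ℕ} (h : m < N) : used N (m + 1) = insert ⟨m, h⟩ (used N m) := by
  ext j
  simp only [used, Finset.mem_filter, Finset.mem_univ, true_and, Finset.mem_insert, Fin.ext_iff]
  omega

namespace ADMG

variable {n : ℕ} (G : ADMG n) (s : ℕ)

/-- The context of `i` as a list. -/
def contextList (i : Fin n) : List (Fin n) := (G.context i).toList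

/-- The scope of `i` as a list that starts with `i`, so that the code of an assignment to the scope
arises from that of its restriction to the context by one more Horner step. -/
def scopeList (i : Fin n) : List (Fin n) := i :: G.contextList i

theorem mem_contextList {i j : Fin n} : j ∈ G.contextList i ↔ j ∈ G.context i := Finset.mem_toList

theorem mem_scopeList {i j : Fin n} : j ∈ G.scopeList i ↔ j ∈ G.scope i := by
  rw [scopeList, List.mem_cons, mem_contextList, ← Finset.mem_insert, context,
    Finset.insert_erase (G.self_mem_scope i)]

theorem nodup_contextList (i : Fin n) : (G.contextList i).Nodup := Finset.nodup_toList _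

theorem nodup_scopeList (i : Fin n) : (G.scopeList i).Nodup :=
  List.nodup_cons.2 ⟨fun h => Finset.notMem_erase _ _ (G.mem_contextList.1 h),
    G.nodup_contextList i⟩

theorem length_contextList_lt (i : Fin n) :
    (G.contextList i).length < G.width := by
  have hcard := G.card_context_add_one i
  have hle := G.card_scope_le i
  rw [contextList, Finset.length_toList]
  omega

/-- The program that counts the sample stored in the variable cells for the conditional
distribution of `i`, in table `2 * i` for the context and `2 * i + 1` for the scope. -/
def countStep (i : Fin n) : List Instr :=
  horner ((G.contextList i).map fun j : Fin n => 20 + (j : ℕ)) ++ (bump n s (2 * i) ++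
    ([.times 1 1 2, .plus 1 1 (20 + i)] ++ bump n s (2 * i + 1)))

/-- The program that reads sample `j` and counts it. -/
def sampleBlock (j : ℕ) : List Instr :=
  ((List.finRange n).map fun t => .read (20 + (t : ℕ)) (j * n + t)) ++
    (List.finRange n).flatMap (G.countStep s)

/-- The learner: it counts the first `m` samples. -/
def learner (m : ℕ) : List Instr :=
  [.const 2 s, .const 9 1] ++ (List.range m).flatMap (G.sampleBlock s)

variable {s}

/-- What counting the sample `v` for the variable `i` adds to cell `a`. -/
def hit (i : Fin n) (v : Fin n → Fin s) (a : ℕ) : ℚ :=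
  (if a = tab n s (2 * i) (codeOf (G.contextList i) v) then 1 else 0) +
    if a = tab n s (2 * i + 1) (codeOf (G.scopeList i) v) then 1 else 0

theorem hit_eq_zero (i : Fin n) (v : Fin n → Fin s) {a : ℕ} (ha : a < 21 + n) :
    G.hit i v a = 0 := by
  have hcontext := le_tab n s (2 * i) (codeOf (G.contextList i) v)
  have hscope := le_tab n s (2 * i + 1) (codeOf (G.scopeList i) v)
  rw [hit, if_neg (by omega), if_neg (by omega), add_zero]

theorem exists_runs_countStep (inp : ℕ → ℚ) (i : Fin n) {v : Fin n → Fin s} {μ : Mem}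
    (h2 : μ 2 = s) (h9 : μ 9 = 1) (hv : ∀ j : Fin n, μ (20 + j) = (v j : ℕ)) :
    ∃ ν, Runs inp (G.countStep s i) μ ν ∧
      ∀ a, a ≠ 1 → a ≠ 3 → a ≠ 4 → ν a = μ a + G.hit i v a := by
  have hcode := runs_horner inp (cell := fun j : Fin n => 20 + (j : ℕ)) (l := G.contextList i) h2
    (fun j _ => by omega) (fun j _ => hv j)
  set μ₁ := Function.update μ 1 (codeOf (G.contextList i) v : ℚ) with hμ₁
  have keep₁ : ∀ a, a ≠ 1 → μ₁ a = μ a := fun a ha => Function.update_of_ne ha _ _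
  obtain ⟨μ₂, hbump, hμ₂⟩ := exists_runs_bump inp n s (2 * i) (μ := μ₁) (Function.update_self ..)
  have keep₂ : ∀ a, a ≠ 3 → a ≠ 4 → a < 21 + n → μ₂ a = μ₁ a := fun a h3 h4 ha => by
    have := le_tab n s (2 * i) (codeOf (G.contextList i) v)
    rw [hμ₂ a h3 h4, if_neg (by omega), add_zero]
  have hcode' := runs_horner_step inp (j := i) (l := G.contextList i) (v := v) (a := 20 + i)
    (μ := μ₂) (by rw [keep₂ 1 (by omega) (by omega) (by omega), hμ₁, Function.update_self])
    (by rw [keep₂ 2 (by omega) (by omega) (by omega), keep₁ 2 (by omega), h2])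
    (by rw [keep₂ _ (by omega) (by omega) (by omega), keep₁ _ (by omega), hv]) (by omega)
  set μ₃ := Function.update μ₂ 1 (codeOf (i :: G.contextList i) v : ℚ)
  have keep₃ : ∀ a, a ≠ 1 → μ₃ a = μ₂ a := fun a ha => Function.update_of_ne ha _ _
  obtain ⟨μ₄, hbump', hμ₄⟩ := exists_runs_bump inp n s (2 * i + 1) (μ := μ₃)
    (Function.update_self ..)
  refine ⟨μ₄, hcode.append (hbump.append (hcode'.append hbump')), fun a h1 h3 h4 => ?_⟩
  have one₁ : μ₁ 9 = 1 := by rw [keep₁ 9 (by omega), h9]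
  have one₃ : μ₃ 9 = 1 := by rw [keep₃ 9 (by omega), keep₂ 9 (by omega) (by omega) (by omega), one₁]
  rw [hμ₄ a h3 h4, keep₃ a h1, hμ₂ a h3 h4, keep₁ a h1, one₁, one₃, hit, add_assoc]
  rfl

theorem exists_runs_countSteps (inp : ℕ → ℚ) {v : Fin n → Fin s} {μ : Mem} (h2 : μ 2 = s)
    (h9 : μ 9 = 1) (hv : ∀ j : Fin n, μ (20 + j) = (v j : ℕ)) (l : List (Fin n)) :
    ∃ ν, Runs inp (l.flatMap (G.countStep s)) μ ν ∧
      ∀ a, a ≠ 1 → a ≠ 3 → a ≠ 4 → ν a = μ a + (l.map fun i => G.hit i v a).sum := by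
  refine exists_runs_flatMap (fun l ν => ∀ a, a ≠ 1 → a ≠ 3 → a ≠ 4 →
    ν a = μ a + (l.map fun i => G.hit i v a).sum) (fun l i ν hν => ?_) (by simp) l
  have keep : ∀ a, a ≠ 1 → a ≠ 3 → a ≠ 4 → a < 21 + n → ν a = μ a := fun a h1 h3 h4 ha => by
    simp [hν a h1 h3 h4, hit_eq_zero _ _ _ ha]
  obtain ⟨ξ, hrun, hξ⟩ := G.exists_runs_countStep inp i (μ := ν)
    (by rw [keep 2 (by omega) (by omega) (by omega) (by omega), h2])
    (by rw [keep 9 (by omega) (by omega) (by omega) (by omega), h9])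
    (fun j => by rw [keep _ (by omega) (by omega) (by omega) (by omega), hv])
  refine ⟨ξ, hrun, fun a h1 h3 h4 => ?_⟩
  rw [hξ a h1 h3 h4, hν a h1 h3 h4, List.map_append, List.sum_append, List.map_singleton,
    List.sum_singleton, add_assoc]

theorem exists_runs_sampleBlock {inp : ℕ → ℚ} {j : ℕ} {v : Fin n → Fin s} {μ : Mem} (h2 : μ 2 = s)
    (h9 : μ 9 = 1) (hv : ∀ t : Fin n, inp (j * n + t) = (v t : ℕ)) :
    ∃ ν, Runs inp (G.sampleBlock s j) μ ν ∧ ν 2 = s ∧ ν 9 = 1 ∧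
      ∀ a, 21 + n ≤ a → ν a = μ a + ∑ i, G.hit i v a := by
  obtain ⟨ν, hread, hcell, hkeep⟩ := exists_runs_assign (inp := inp)
    (I := fun t : Fin n => .read (20 + (t : ℕ)) (j * n + t)) (fun _ _ => rfl) varCell_injective
    (List.finRange n) μ
  have keep : ∀ a, a < 20 ∨ 20 + n ≤ a → ν a = μ a := fun a ha => hkeep a fun t _ => by omega
  obtain ⟨ξ, hcount, hξ⟩ := G.exists_runs_countSteps inp (v := v) (μ := ν)
    (by rw [keep 2 (by omega), h2]) (by rw [keep 9 (by omega), h9])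
    (fun t => by rw [hcell t (List.mem_finRange t), hv]) (List.finRange n)
  simp only [← List.ofFn_eq_map, List.sum_ofFn] at hξ
  have keep' : ∀ a, a ≠ 1 → a ≠ 3 → a ≠ 4 → a < 20 → ξ a = μ a := fun a h1 h3 h4 ha => by
    rw [hξ a h1 h3 h4, Finset.sum_eq_zero fun i _ => G.hit_eq_zero i v (by omega), add_zero,
      keep a (.inl ha)]
  refine ⟨ξ, hread.append hcount, ?_, ?_, fun a ha => ?_⟩
  · rw [keep' 2 (by omega) (by omega) (by omega) (by omega), h2]
  · rw [keep' 9 (by omega) (by omega) (by omega) (by omega), h9]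
  · rw [hξ a (by omega) (by omega) (by omega), keep a (by omega)]

theorem exists_runs_sampleBlocks {N : ℕ} (S : Fin N → Fin n → Fin s) {m : ℕ} (hm : m ≤ N) {μ : Mem}
    (h2 : μ 2 = s) (h9 : μ 9 = 1) :
    ∃ ν, Runs (sampleInput S) ((List.range m).flatMap (G.sampleBlock s)) μ ν ∧
      ν 2 = s ∧ ν 9 = 1 ∧
      ∀ a, 21 + n ≤ a → ν a = μ a + ∑ j ∈ used N m, ∑ i, G.hit i (S j) a := by
  induction m with
  | zero => exact ⟨μ, Runs.nil _, h2, h9, by simp [used]⟩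
  | succ m ih =>
    obtain ⟨ν, hrun, ν2, ν9, hν⟩ := ih (by omega)
    obtain ⟨ξ, hrun', ξ2, ξ9, hξ⟩ := G.exists_runs_sampleBlock ν2 ν9 (sampleInput_apply S ⟨m, hm⟩)
    refine ⟨ξ, ?_, ξ2, ξ9, fun a ha => ?_⟩
    · rw [List.range_succ, List.flatMap_append, List.flatMap_singleton]
      exact hrun.append hrun'
    · rw [used_succ hm, Finset.sum_insert (by simp [used]), hξ a ha, hν a ha]
      ring

/-- The memory `μ` holds the counts of the samples `S` in `J`, and an empty output table. -/
structure Holds {N : ℕ} (J : Finset (Fin N)) (S : Fin N → Fin n → Fin s) (μ : Mem) : Prop where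
  context (i : Fin n) (v : Fin n → Fin s) :
    μ (tab n s (2 * i) (codeOf (G.contextList i) v)) = countIn J (cyl (G.context i) v) S
  scope (i : Fin n) (v : Fin n → Fin s) :
    μ (tab n s (2 * i + 1) (codeOf (G.scopeList i) v)) = countIn J (cyl (G.scope i) v) S
  out (c : ℕ) (hc : c < s ^ n) : μ (tab n s (2 * n) c) = 0

theorem codeOf_contextList_lt (hs : 2 ≤ s) (i : Fin n) (v : Fin n → Fin s) :
    codeOf (G.contextList i) v < s ^ n := by
  simpa only [Fintype.card_fin] using codeOf_lt_of_nodup hs (G.nodup_contextList i) v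

theorem codeOf_scopeList_lt (hs : 2 ≤ s) (i : Fin n) (v : Fin n → Fin s) :
    codeOf (G.scopeList i) v < s ^ n := by
  simpa only [Fintype.card_fin] using codeOf_lt_of_nodup hs (G.nodup_scopeList i) v

theorem codeOf_contextList_eq_iff (hs : 2 ≤ s) {i : Fin n} {v w : Fin n → Fin s} :
    codeOf (G.contextList i) v = codeOf (G.contextList i) w ↔ v ∈ cyl (G.context i) w := by
  simp only [codeOf_eq_iff hs, mem_contextList]
  rfl

theorem codeOf_scopeList_eq_iff (hs : 2 ≤ s) {i : Fin n} {v w : Fin n → Fin s} :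
    codeOf (G.scopeList i) v = codeOf (G.scopeList i) w ↔ v ∈ cyl (G.scope i) w := by
  simp only [codeOf_eq_iff hs, mem_scopeList]
  rfl

theorem hit_context (hs : 2 ≤ s) (i k : Fin n) (v w : Fin n → Fin s) :
    G.hit k w (tab n s (2 * i) (codeOf (G.contextList i) v))
      = if k = i then (if w ∈ cyl (G.context i) v then 1 else 0) else 0 := by
  simp only [hit, tab_inj (G.codeOf_contextList_lt hs i v) (G.codeOf_contextList_lt hs k w),
    tab_inj (G.codeOf_contextList_lt hs i v) (G.codeOf_scopeList_lt hs k w)]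
  rw [if_neg (c := 2 * (i : ℕ) = 2 * k + 1 ∧ _) (fun h => by omega), add_zero]
  rcases eq_or_ne k i with rfl | hk
  · simp only [true_and, if_true, eq_comm (a := codeOf _ v), G.codeOf_contextList_eq_iff hs]
  · rw [if_neg hk, if_neg fun h => hk (Fin.ext (by omega))]

theorem hit_scope (hs : 2 ≤ s) (i k : Fin n) (v w : Fin n → Fin s) :
    G.hit k w (tab n s (2 * i + 1) (codeOf (G.scopeList i) v))
      = if k = i then (if w ∈ cyl (G.scope i) v then 1 else 0) else 0 := by
  simp only [hit, tab_inj (G.codeOf_scopeList_lt hs i v) (G.codeOf_contextList_lt hs k w),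
    tab_inj (G.codeOf_scopeList_lt hs i v) (G.codeOf_scopeList_lt hs k w)]
  rw [if_neg (c := 2 * (i : ℕ) + 1 = 2 * k ∧ _) (fun h => by omega), zero_add]
  rcases eq_or_ne k i with rfl | hk
  · simp only [true_and, if_true, eq_comm (a := codeOf _ v), G.codeOf_scopeList_eq_iff hs]
  · rw [if_neg hk, if_neg fun h => hk (Fin.ext (by omega))]

theorem hit_out (hs : 2 ≤ s) (k : Fin n) (w : Fin n → Fin s) {c : ℕ} (hc : c < s ^ n) :
    G.hit k w (tab n s (2 * n) c) = 0 := by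
  simp only [hit, tab_inj hc (G.codeOf_contextList_lt hs k w),
    tab_inj hc (G.codeOf_scopeList_lt hs k w)]
  rw [if_neg fun h => by omega, if_neg fun h => by omega, add_zero]

theorem exists_runs_learner (hs : 2 ≤ s) {N m : ℕ} (S : Fin N → Fin n → Fin s)
    (hm : m ≤ N) :
    ∃ ν, Runs (sampleInput S) (G.learner s m) (fun _ => 0) ν ∧ G.Holds (used N m) S ν := by
  set μ : Mem := Function.update (Function.update (fun _ => 0) 2 (s : ℚ)) 9 1 with hμ
  have hinit : Runs (sampleInput S) [.const 2 s, .const 9 1] (fun _ => 0) μ := by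
    simp only [Runs, run, Instr.step, PMF.pure_bind]
    rfl
  obtain ⟨ν, hrun, -, -, hν⟩ := G.exists_runs_sampleBlocks S hm (μ := μ) (by simp [hμ])
    (by simp [hμ])
  have hsum : ∀ t c, ν (tab n s t c) = ∑ j ∈ used N m, ∑ i, G.hit i (S j) (tab n s t c) :=
    fun t c => by
      have := le_tab n s t c
      rw [hν _ this, hμ, Function.update_of_ne (by omega), Function.update_of_ne (by omega),
        zero_add]
  refine ⟨ν, hinit.append hrun, fun i v => ?_, fun i v => ?_, fun c hc => ?_⟩
  · simp_rw [hsum, G.hit_context hs, Finset.sum_ite_eq', Finset.mem_univ, if_true]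
    rw [countIn, Finset.card_filter, Nat.cast_sum]
    exact Finset.sum_congr rfl fun j _ => by split_ifs <;> simp
  · simp_rw [hsum, G.hit_scope hs, Finset.sum_ite_eq', Finset.mem_univ, if_true]
    rw [countIn, Finset.card_filter, Nat.cast_sum]
    exact Finset.sum_congr rfl fun j _ => by split_ifs <;> simp
  · rw [hsum]
    exact Finset.sum_eq_zero fun j _ => Finset.sum_eq_zero fun i _ => G.hit_out hs i (S j) hc

theorem coupled_learned (hs : 2 ≤ s) (P : PMF (Fin n → Fin s)) {N m : ℕ} (hm : m ≤ N) :
    Coupled (learned P N (G.learner s m)) (iid P N) fun μ S => G.Holds (used N m) S μ := by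
  refine (Coupled.refl _).bind_left ?_
  rintro S _ rfl
  obtain ⟨ν, hrun, hν⟩ := G.exists_runs_learner hs S hm
  rw [show run _ _ _ = _ from hrun]
  exact Coupled.pure hν

end ADMG

/-! ### The evaluator -/

theorem length_flatMap_le {κ κ' : Type*} {f : κ → List κ'} {b : ℕ} (l : List κ)
    (hf : ∀ j ∈ l, (f j).length ≤ b) : (l.flatMap f).length ≤ l.length * b := by
  rw [List.length_flatMap]
  simpa using List.sum_le_card_nsmul (l.map fun j => (f j).length) b (by simpa using hf)

/-- The assignment that is `v` in `D` and `u` elsewhere. -/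
def glue {κ β : Type*} (D : Finset κ) (v : κ → β) (u : {j // j ∉ D} → β) : κ → β :=
  fun j => if h : j ∈ D then v j else u ⟨j, h⟩

theorem glue_of_mem {κ β : Type*} {D : Finset κ} {v : κ → β} {u : {j // j ∉ D} → β} {j : κ}
    (h : j ∈ D) : glue D v u j = v j := dif_pos h

theorem glue_of_notMem {κ β : Type*} {D : Finset κ} {v : κ → β} {u : {j // j ∉ D} → β} {j : κ}
    (h : j ∉ D) : glue D v u j = u ⟨j, h⟩ := dif_neg h

theorem sum_ite_mem_cyl {κ β R : Type*} [Fintype κ] [Fintype β] [AddCommMonoid R] (D : Finset κ)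
    (v : κ → β) [DecidablePred (· ∈ cyl D v)] (g : (κ → β) → R) :
    (∑ w, if w ∈ cyl D v then g w else 0) = ∑ u, g (glue D v u) := by
  have hglue : ∀ w ∈ cyl D v, glue D v (fun j => w j) = w := fun w hw => by
    funext j
    by_cases hj : j ∈ D
    · rw [glue_of_mem hj, hw j hj]
    · rw [glue_of_notMem hj]
  rw [← Finset.sum_filter]
  refine Finset.sum_nbij' (fun w j => w j) (glue D v) (by simp)
    (fun u _ => Finset.mem_filter.2 ⟨Finset.mem_univ _, fun j hj => glue_of_mem hj⟩)
    (fun w hw => hglue w (Finset.mem_filter.1 hw).2)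
    (fun u _ => funext fun j => glue_of_notMem j.2)
    (fun w hw => by rw [hglue w (Finset.mem_filter.1 hw).2])

theorem readOff_eq_iff {n s : ℕ} {F : Finset (Fin n)} {X : Fin n} {x : Fin s}
    {v w : Fin n → Fin s} :
    (readOff F X x w = fun j : F => v j) ↔ (X ∈ F → v X = x) ∧ w ∈ cyl (F.erase X) v := by
  simp only [funext_iff, Subtype.forall, readOff]
  refine ⟨fun h => ⟨fun hX => ?_, fun j hj => ?_⟩, fun ⟨hX, hw⟩ j hj => ?_⟩
  · rw [← h X hX, Function.update_self]
  · rw [← h j (Finset.mem_of_mem_erase hj), Function.update_of_ne (Finset.ne_of_mem_erase hj)]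
  · rcases eq_or_ne j X with rfl | hjX
    · rw [Function.update_self, hX hj]
    · rw [Function.update_of_ne hjX, hw j (Finset.mem_erase.2 ⟨hjX, hj⟩)]

theorem queryInput_apply {n s : ℕ} {F : Finset (Fin n)} (w : F → Fin s) (j : F) :
    queryInput w ((j : Fin n) : ℕ) = (w j : ℕ) :=
  dif_pos ⟨j.1.2, j.2⟩

/-- The program that writes the content of cell `7` to cell `0` if the query agrees with the
intervention `X := x`, and `0` otherwise. -/
def checkQuery {n s : ℕ} (F : Finset (Fin n)) (X : Fin n) (x : Fin s) : List Instr :=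
  if X ∈ F then
    [.read 3 X, .const 4 (x : ℕ), .compare 1 3 4, .compare 3 4 3, .times 7 7 1, .times 0 7 3]
  else [.const 1 1, .times 0 7 1]

theorem length_checkQuery_le {n s : ℕ} (F : Finset (Fin n)) (X : Fin n) (x : Fin s) :
    (checkQuery F X x).length ≤ 6 := by
  unfold checkQuery
  split_ifs <;> simp

theorem exists_runs_checkQuery {n s : ℕ} (F : Finset (Fin n)) (X : Fin n) (x : Fin s)
    (v : Fin n → Fin s) (μ : Mem) :
    ∃ ν, Runs (queryInput fun j : F => v j) (checkQuery F X x) μ ν ∧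
      ν 0 = if X ∈ F → v X = x then μ 7 else 0 := by
  by_cases hX : X ∈ F
  · have hinput := queryInput_apply (fun j : F => v j) ⟨X, hX⟩
    rw [checkQuery, if_pos hX]
    refine ⟨_, by simp only [Runs, run, Instr.step, PMF.pure_bind]; rfl, ?_⟩
    simp [hinput, hX, ← ite_and, le_antisymm_iff, and_comm]
  · rw [checkQuery, if_neg hX]
    exact ⟨_, by simp only [Runs, run, Instr.step, PMF.pure_bind]; rfl, by simp [hX]⟩

namespace ADMG

variable {n : ℕ} (G : ADMG n) {s : ℕ} (X : Fin n) (x : Fin s)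

/-- The cell that holds the value of variable `j` as seen by variable `i`. -/
def seenCell (i j : Fin n) : ℕ := if j = X ∧ i ∉ G.cComp X then 20 + n else 20 + j

theorem seenCell_bounds (i j : Fin n) : 20 ≤ G.seenCell X i j ∧ G.seenCell X i j ≤ 20 + n := by
  unfold seenCell
  split_ifs <;> omega

theorem twist_self (i : Fin n) (v : Fin n → Fin s) : G.twist X x i v i = v i := by
  unfold twist
  split_ifs with h
  · rfl
  · exact Function.update_of_ne (fun hi : i = X => h (hi ▸ G.self_mem_cComp i)) _ _

variable {X x} in
theorem apply_seenCell {v : Fin n → Fin s} {μ : Mem} (hx : μ (20 + n) = (x : ℕ))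
    (hv : ∀ j : Fin n, μ (20 + j) = (v j : ℕ)) (i j : Fin n) :
    μ (G.seenCell X i j) = (G.twist X x i v j : ℕ) := by
  unfold seenCell twist
  by_cases hi : i ∈ G.cComp X
  · simp [hi, hv]
  · rcases eq_or_ne j X with rfl | hj
    · simp [hi, hx]
    · simp [hi, hj, hv]

variable {N : ℕ} (J : Finset (Fin N)) (l : ℕ) (S : Fin N → Fin n → Fin s)

/-- The estimate `est` as a rational number, which is what the machine computes. -/
def estQ (i : Fin n) (v : Fin n → Fin s) : ℚ :=
  (countIn J (cyl (G.scope i) v) S + l) / (countIn J (cyl (G.context i) v) S + s * l)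

theorem cast_estQ (i : Fin n) (v : Fin n → Fin s) : (G.estQ J l S i v : ℝ) = G.est J l S i v := by
  simp [estQ, est]

/-- The memory `μ` holds what the evaluation of the estimate needs besides the values of the
variables. -/
structure Ready (μ : Mem) : Prop where
  alphabet : μ 2 = s
  smoothing : μ 5 = l
  denominator : μ 6 = s * l
  intervention : μ (20 + n) = (x : ℕ)
  counts : G.Holds J S μ

variable {G x J l S}

theorem Holds.congr {μ ν : Mem} (h : G.Holds J S μ) (hν : ∀ a, 21 + n ≤ a → ν a = μ a) :
    G.Holds J S ν :=
  ⟨fun i v => by rw [hν _ (le_tab _ _ _ _), h.context],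
    fun i v => by rw [hν _ (le_tab _ _ _ _), h.scope],
    fun c hc => by rw [hν _ (le_tab _ _ _ _), h.out c hc]⟩

theorem Ready.congr {μ ν : Mem} (h : G.Ready x J l S μ)
    (hν : ∀ a, a = 2 ∨ a = 5 ∨ a = 6 ∨ 20 + n ≤ a → ν a = μ a) : G.Ready x J l S ν :=
  ⟨by rw [hν 2 (by omega), h.alphabet], by rw [hν 5 (by omega), h.smoothing],
    by rw [hν 6 (by omega), h.denominator], by rw [hν _ (by omega), h.intervention],
    h.counts.congr fun a ha => hν a (by omega)⟩

variable (G s)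

/-- The program that multiplies cell `8` by the estimated conditional probability of the value of
variable `i`. -/
def multFactor (i : Fin n) : List Instr :=
  horner ((G.contextList i).map (G.seenCell X i)) ++
    [.const 3 (tab n s (2 * i) 0 : ℕ), .plus 3 3 1, .load 4 3, .plus 4 4 6,
      .times 1 1 2, .plus 1 1 (20 + i), .const 3 (tab n s (2 * i + 1) 0 : ℕ), .plus 3 3 1,
      .load 3 3, .plus 3 3 5, .divide 4 3 4, .times 8 8 4]

variable {s}

theorem exists_runs_multFactor (inp : ℕ → ℚ) (i : Fin n) {v : Fin n → Fin s} {μ : Mem}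
    (hμ : G.Ready x J l S μ) (hv : ∀ j : Fin n, μ (20 + j) = (v j : ℕ)) :
    ∃ ν, Runs inp (G.multFactor s X i) μ ν ∧
      ν 8 = μ 8 * G.estQ J l S i (G.twist X x i v) ∧
      ∀ a, a ≠ 1 → a ≠ 3 → a ≠ 4 → a ≠ 8 → ν a = μ a := by
  have hcode := runs_horner inp (cell := G.seenCell X i) (l := G.contextList i) hμ.alphabet
    (fun j _ => by have := (G.seenCell_bounds X i j).1; omega)
    (fun j _ => G.apply_seenCell hμ.intervention hv i j)
  set w := G.twist X x i v with hw
  set c := codeOf (G.contextList i) w with hc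
  set c' := codeOf (G.scopeList i) w with hc'
  have hstep : ((c' : ℕ) : ℚ) = c * s + (v i : ℕ) := by
    rw [hc', scopeList, codeOf_cons, hw, G.twist_self, ← hw, ← hc]
    push_cast
    ring
  have hcontext := hμ.counts.context i w
  have hscope := hμ.counts.scope i w
  have htab := le_tab n s (2 * i) c
  have htab' := le_tab n s (2 * i + 1) c'
  refine ⟨_, hcode.append (by simp only [Runs, run, Instr.step, PMF.pure_bind]; rfl), ?_,
    fun a a1 a3 a4 a8 => by simp [Function.update_apply, a1, a3, a4, a8]⟩
  have hvar : ∀ k < 20, 20 + (i : ℕ) ≠ k := by omega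
  have hentry : ∀ k < 20, tab n s (2 * i) c ≠ k := by omega
  have hentry' : ∀ k < 20, tab n s (2 * i + 1) c' ≠ k := by omega
  simp only [Function.update_apply, hvar 1 (by norm_num), hvar 3 (by norm_num),
    hvar 4 (by norm_num), if_false, if_true, hμ.alphabet, hμ.smoothing, hμ.denominator, hv,
    ← hstep, floor_tab, hentry 1 (by norm_num), hentry 3 (by norm_num), hentry' 1 (by norm_num),
    hentry' 3 (by norm_num), hentry' 4 (by norm_num), Nat.reduceEqDiff, OfNat.ofNat_ne_one,
    OfNat.one_ne_ofNat]
  rw [hcontext, hscope, estQ]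

theorem exists_runs_multFactors (inp : ℕ → ℚ) {v : Fin n → Fin s} {μ : Mem}
    (hμ : G.Ready x J l S μ) (hv : ∀ j : Fin n, μ (20 + j) = (v j : ℕ)) (is : List (Fin n)) :
    ∃ ν, Runs inp (is.flatMap (G.multFactor s X)) μ ν ∧
      ν 8 = μ 8 * (is.map fun i => G.estQ J l S i (G.twist X x i v)).prod ∧
      ∀ a, a ≠ 1 → a ≠ 3 → a ≠ 4 → a ≠ 8 → ν a = μ a := by
  refine exists_runs_flatMap (fun is ν =>
    ν 8 = μ 8 * (is.map fun i => G.estQ J l S i (G.twist X x i v)).prod ∧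
      ∀ a, a ≠ 1 → a ≠ 3 → a ≠ 4 → a ≠ 8 → ν a = μ a)
    (fun is i ν ⟨hprod, hkeep⟩ => ?_) (by simp) is
  obtain ⟨ξ, hrun, hfactor, hkeep'⟩ := G.exists_runs_multFactor X inp i
    (hμ.congr fun a _ => hkeep a (by omega) (by omega) (by omega) (by omega))
    (fun j => by rw [hkeep _ (by omega) (by omega) (by omega) (by omega), hv])
  refine ⟨ξ, hrun, ?_, fun a a1 a3 a4 a8 => by rw [hkeep' a a1 a3 a4 a8, hkeep a a1 a3 a4 a8]⟩
  rw [hfactor, hprod, List.map_append, List.prod_append, List.map_singleton, List.prod_singleton,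
    mul_assoc]

variable (s)

/-- The program that adds the estimated probability of an assignment to cell `7`. The assignment
is given by `u` outside of `D`, and by the variable cells in `D`. -/
def addTerm (D : Finset (Fin n)) (u : {j // j ∉ D} → Fin s) : List Instr :=
  ((Finset.univ : Finset {j // j ∉ D}).toList.map fun j => .const (20 + (j : ℕ)) (u j : ℕ)) ++
    ([.const 8 1] ++ ((List.finRange n).flatMap (G.multFactor s X) ++ [.plus 7 7 8]))

variable {s}

theorem exists_runs_assignOutside (inp : ℕ → ℚ) {D : Finset (Fin n)} {v : Fin n → Fin s} {μ : Mem}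
    (hv : ∀ j ∈ D, μ (20 + j) = (v j : ℕ)) (u : {j // j ∉ D} → Fin s) :
    ∃ ν, Runs inp ((Finset.univ : Finset {j // j ∉ D}).toList.map fun j : {j // j ∉ D} =>
        .const (20 + (j : ℕ)) (u j : ℕ)) μ ν ∧
      (∀ j : Fin n, ν (20 + j) = ((glue D v u j : Fin s) : ℕ)) ∧
      ∀ a, a < 20 ∨ 20 + n ≤ a → ν a = μ a := by
  obtain ⟨ν, hrun, hcell, hkeep⟩ := exists_runs_assign (inp := inp)
    (I := fun j : {j // j ∉ D} => .const (20 + (j : ℕ)) (u j : ℕ)) (fun _ _ => rfl)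
    (varCell_injective.comp Subtype.val_injective) (Finset.univ : Finset {j // j ∉ D}).toList μ
  refine ⟨ν, hrun, fun j => ?_, fun a ha => hkeep a fun j _ => ?_⟩
  · by_cases hj : j ∈ D
    · rw [glue_of_mem hj, hkeep _ fun i _ h => i.2 (varCell_injective h ▸ hj), hv j hj]
    · rw [glue_of_notMem hj]
      exact hcell ⟨j, hj⟩ (by simp)
  · have := j.1.2
    omega

theorem exists_runs_addTerm (inp : ℕ → ℚ) {D : Finset (Fin n)} {v : Fin n → Fin s} {μ : Mem}
    (hμ : G.Ready x J l S μ) (hv : ∀ j ∈ D, μ (20 + j) = (v j : ℕ)) (u : {j // j ∉ D} → Fin s) :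
    ∃ ν, Runs inp (G.addTerm s X D u) μ ν ∧
      ν 7 = μ 7 + ∏ i, G.estQ J l S i (G.twist X x i (glue D v u)) ∧
      G.Ready x J l S ν ∧ ∀ j ∈ D, ν (20 + j) = (v j : ℕ) := by
  obtain ⟨μ₁, hassign, hcell, hkeep₁⟩ := exists_runs_assignOutside inp hv u
  set μ₂ := Function.update μ₁ 8 1 with hμ₂
  have hone : Runs inp [.const 8 1] μ₁ μ₂ := by
    simp only [Runs, run, Instr.step, PMF.pure_bind]
    rfl
  have hkeep₂ : ∀ a, a ≠ 8 → μ₂ a = μ₁ a := fun a ha => Function.update_of_ne ha _ _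
  have hready₂ : G.Ready x J l S μ₂ := hμ.congr fun a ha => by
    rw [hkeep₂ a (by omega), hkeep₁ a (by omega)]
  have hv₂ : ∀ j : Fin n, μ₂ (20 + j) = ((glue D v u j : Fin s) : ℕ) := fun j => by
    rw [hkeep₂ _ (by omega), hcell]
  obtain ⟨μ₃, hmult, hprod, hkeep₃⟩ := G.exists_runs_multFactors X inp hready₂ hv₂ (List.finRange n)
  rw [← List.ofFn_eq_map, List.prod_ofFn, hμ₂, Function.update_self, one_mul] at hprod
  have hadd : Runs inp [.plus 7 7 8] μ₃ (Function.update μ₃ 7 (μ₃ 7 + μ₃ 8)) := by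
    simp only [Runs, run, Instr.step, PMF.pure_bind]
  refine ⟨_, hassign.append (hone.append (hmult.append hadd)), ?_, hready₂.congr fun a _ => ?_,
    fun j hj => ?_⟩
  · rw [Function.update_self, hprod, hkeep₃ 7 (by omega) (by omega) (by omega) (by omega),
      hkeep₂ 7 (by omega), hkeep₁ 7 (by omega)]
  · rw [Function.update_of_ne (by omega), hkeep₃ a (by omega) (by omega) (by omega) (by omega)]
  · rw [Function.update_of_ne (by omega), hkeep₃ _ (by omega) (by omega) (by omega) (by omega),
      hv₂, glue_of_mem hj]

theorem exists_runs_addTerms (inp : ℕ → ℚ) {D : Finset (Fin n)} {v : Fin n → Fin s} {μ : Mem}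
    (hμ : G.Ready x J l S μ) (hv : ∀ j ∈ D, μ (20 + j) = (v j : ℕ))
    (us : List ({j // j ∉ D} → Fin s)) :
    ∃ ν, Runs inp (us.flatMap (G.addTerm s X D)) μ ν ∧
      ν 7 = μ 7 + (us.map fun u => ∏ i, G.estQ J l S i (G.twist X x i (glue D v u))).sum := by
  have hstep : ∀ us u ν, (ν 7 = μ 7 +
        (us.map fun u => ∏ i, G.estQ J l S i (G.twist X x i (glue D v u))).sum ∧
      G.Ready x J l S ν ∧ ∀ j ∈ D, ν (20 + j) = (v j : ℕ)) →
      ∃ ξ, Runs inp (G.addTerm s X D u) ν ξ ∧ (ξ 7 = μ 7 +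
        ((us ++ [u]).map fun u => ∏ i, G.estQ J l S i (G.twist X x i (glue D v u))).sum ∧
      G.Ready x J l S ξ ∧ ∀ j ∈ D, ξ (20 + j) = (v j : ℕ)) := by
    rintro us u ν ⟨hsum, hready, hvar⟩
    obtain ⟨ξ, hrun, hterm, hready', hvar'⟩ := G.exists_runs_addTerm X inp hready hvar u
    refine ⟨ξ, hrun, ?_, hready', hvar'⟩
    rw [hterm, hsum, List.map_append, List.sum_append, List.map_singleton, List.sum_singleton,
      add_assoc]
  obtain ⟨ν, hrun, hsum, -⟩ := exists_runs_flatMap _ hstep ⟨by simp, hμ, hv⟩ us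
  exact ⟨ν, hrun, hsum⟩

/-- The evaluator for the estimate of the interventional distribution on `F`. -/
def evaluator (x : Fin s) (F : Finset (Fin n)) (l : ℕ) : List Instr :=
  [.const 2 s, .const 5 l, .const 6 (s * l), .const (20 + n) (x : ℕ), .const 7 0] ++
    (((F.erase X).toList.map fun j => .read (20 + (j : ℕ)) j) ++
      ((Finset.univ : Finset ({j // j ∉ F.erase X} → Fin s)).toList.flatMap
        (G.addTerm s X (F.erase X)) ++ checkQuery F X x))

theorem exists_runs_ready (inp : ℕ → ℚ) {μ : Mem} (hμ : G.Holds J S μ) (x : Fin s) (l : ℕ) :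
    ∃ ν, Runs inp [.const 2 s, .const 5 l, .const 6 (s * l), .const (20 + n) (x : ℕ), .const 7 0]
      μ ν ∧ ν 7 = 0 ∧ G.Ready x J l S ν := by
  refine ⟨_, by simp only [Runs, run, Instr.step, PMF.pure_bind]; rfl, Function.update_self ..,
    ?_, ?_, ?_, ?_, hμ.congr fun a ha => ?_⟩
  · rw [Function.update_of_ne (by omega), Function.update_of_ne (by omega),
      Function.update_of_ne (by omega), Function.update_of_ne (by omega), Function.update_self]
  · rw [Function.update_of_ne (by omega), Function.update_of_ne (by omega),
      Function.update_of_ne (by omega), Function.update_self]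
  · rw [Function.update_of_ne (by omega), Function.update_of_ne (by omega), Function.update_self]
  · rw [Function.update_of_ne (by omega), Function.update_self]
  · iterate 5 rw [Function.update_of_ne (by omega)]

theorem exists_runs_evaluator {μ : Mem} (hμ : G.Holds J S μ) (x : Fin s) (F : Finset (Fin n))
    (l : ℕ) (v : Fin n → Fin s) :
    ∃ ν, Runs (queryInput fun j : F => v j) (G.evaluator X x F l) μ ν ∧
      ν 0 = if X ∈ F → v X = x then
        ∑ u, ∏ i, G.estQ J l S i (G.twist X x i (glue (F.erase X) v u)) else 0 := by
  set inp := queryInput fun j : F => v j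
  obtain ⟨μ₁, hinit, hzero, hready₁⟩ := G.exists_runs_ready inp hμ x l
  obtain ⟨μ₂, hread, hcell, hkeep⟩ := exists_runs_assign (inp := inp)
    (I := fun j : Fin n => .read (20 + (j : ℕ)) j) (fun _ _ => rfl) varCell_injective
    (F.erase X).toList μ₁
  have hkeep₂ : ∀ a, a < 20 ∨ 20 + n ≤ a → μ₂ a = μ₁ a := fun a ha => hkeep a fun j _ => by omega
  obtain ⟨μ₃, hadd, hsum⟩ := G.exists_runs_addTerms X inp (hready₁.congr fun a ha =>
    hkeep₂ a (by omega)) (fun j hj => (hcell j (Finset.mem_toList.2 hj)).trans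
      (queryInput_apply (fun j : F => v j) ⟨j, Finset.mem_of_mem_erase hj⟩))
    (Finset.univ : Finset ({j // j ∉ F.erase X} → Fin s)).toList
  rw [hkeep₂ 7 (by omega), hzero, zero_add, Finset.sum_map_toList] at hsum
  obtain ⟨ν, hcheck, hν⟩ := exists_runs_checkQuery F X x v μ₃
  exact ⟨ν, hinit.append (hread.append (hadd.append hcheck)), by rw [hν, hsum]⟩

theorem isCloseEvaluator_evaluator [NeZero s] {X : Fin n} {μ : Mem} (hμ : G.Holds J S μ)
    (hl : 0 < l) {F : Finset (Fin n)} {D : PMF (F → Fin s)} {ε : ℝ}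
    (hD : tvDist D ((G.estPMF J S X x hl).map (readOff F X x)) ≤ ε) :
    IsCloseEvaluator (G.evaluator X x F l) μ D ε := by
  refine ⟨_, hD, fun w => ?_⟩
  obtain ⟨v, hv⟩ := exists_extension F w
  obtain rfl : (fun j : F => v j) = w := funext hv
  obtain ⟨ν, hrun, hvalue⟩ := G.exists_runs_evaluator X hμ x F l v
  rw [show run _ _ _ = _ from hrun, PMF.pure_map, hvalue, map_toReal]
  simp only [readOff_eq_iff, ite_and, estPMF, pmfOfReal_toReal]
  congr 1
  split_ifs with hX
  · push_cast
    simp only [cast_estQ]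
    convert (sum_ite_mem_cyl (F.erase X) v fun v => ∏ i, G.est J l S i (G.twist X x i v)).symm
  · simp

/-! ### The running time of the evaluator -/

theorem length_multFactor_le (i : Fin n) : (G.multFactor s X i).length ≤ 15 * G.width := by
  have := G.length_contextList_lt i
  simp only [multFactor, List.length_append, length_horner, List.length_map, List.length_cons,
    List.length_nil]
  omega

theorem width_pos (i : Fin n) : 0 < G.width := Nat.zero_lt_of_lt (G.length_contextList_lt i)

theorem length_addTerm_le (D : Finset (Fin n)) (u : {j // j ∉ D} → Fin s) :
    (G.addTerm s X D u).length ≤ 18 * (n * G.width) := by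
  have hmult : ((List.finRange n).flatMap (G.multFactor s X)).length ≤ n * (15 * G.width) := by
    simpa only [List.length_finRange] using
      length_flatMap_le (List.finRange n) fun i _ => G.length_multFactor_le X i
  have hassign : (Finset.univ : Finset {j // j ∉ D}).card ≤ n := by
    simpa only [Finset.card_univ, Fintype.card_fin] using Fintype.card_subtype_le (· ∉ D)
  have hn : n ≤ n * G.width := Nat.le_mul_of_pos_right n (G.width_pos X)
  have hpos := X.pos
  rw [Nat.mul_left_comm] at hmult
  simp only [addTerm, List.length_append, List.length_map, Finset.length_toList, List.length_cons,
    List.length_nil]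
  omega

theorem length_evaluator_le (hs : 2 ≤ s) (x : Fin s) (F : Finset (Fin n)) (l : ℕ) :
    (G.evaluator X x F l).length ≤ 30 * (n * s * G.width * s ^ (n - F.card)) := by
  have hcard : F.card ≤ n := card_finset_fin_le F
  have hpred : F.card ≤ (F.erase X).card + 1 := by
    have := Finset.pred_card_le_card_erase (s := F) (a := X)
    omega
  have herase : (F.erase X).card ≤ n := card_finset_fin_le _
  have hfree : Fintype.card ({j // j ∉ F.erase X} → Fin s) = s ^ (n - (F.erase X).card) := by
    rw [Fintype.card_fun, Fintype.card_fin, Fintype.card_subtype_compl, Fintype.card_fin,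
      Fintype.card_coe]
  have hpow : s ^ (n - (F.erase X).card) ≤ s * s ^ (n - F.card) := by
    rw [← pow_succ']
    exact Nat.pow_le_pow_right (by omega) (by omega)
  have hbody : ((Finset.univ : Finset ({j // j ∉ F.erase X} → Fin s)).toList.flatMap
      (G.addTerm s X (F.erase X))).length ≤ 18 * (n * s * G.width * s ^ (n - F.card)) :=
    calc _ ≤ s ^ (n - (F.erase X).card) * (18 * (n * G.width)) := by
          simpa only [Finset.length_toList, Finset.card_univ, hfree] using
            length_flatMap_le (Finset.univ : Finset ({j // j ∉ F.erase X} → Fin s)).toList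
              fun u _ => G.length_addTerm_le X (F.erase X) u
      _ ≤ s * s ^ (n - F.card) * (18 * (n * G.width)) := Nat.mul_le_mul_right _ hpow
      _ = _ := by ring
  have hn : n ≤ n * s * G.width * s ^ (n - F.card) := by
    have hwidth := G.width_pos X
    rw [mul_assoc, mul_assoc]
    exact Nat.le_mul_of_pos_right n (by positivity)
  have hpos := X.pos
  have hcheck := length_checkQuery_le F X x
  simp only [evaluator, List.length_append, List.length_map, Finset.length_toList,
    List.length_cons, List.length_nil]
  omega

end ADMG

/-! ### Sampling one variable after the other -/

theorem bind_toReal {β γ : Type*} [Fintype β] (p : PMF β) (f : β → PMF γ) (c : γ) :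
    (p.bind f c).toReal = ∑ b, (p b).toReal * (f b c).toReal := by
  rw [PMF.bind_apply, tsum_fintype, ENNReal.toReal_sum fun b _ =>
    ENNReal.mul_ne_top (p.apply_ne_top b) ((f b).apply_ne_top c)]
  simp only [ENNReal.toReal_mul]

theorem pure_toReal {β : Type*} (b c : β) : (PMF.pure b c).toReal = if c = b then 1 else 0 := by
  rw [PMF.pure_apply]
  split_ifs <;> rfl

theorem coin_toReal {q : ℚ} (h0 : 0 ≤ q) (h1 : q ≤ 1) (r : Bool) :
    (coin q r).toReal = if r then (q : ℝ) else 1 - q := by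
  have h0' : (0 : ℝ) ≤ q := mod_cast h0
  have h1' : (q : ℝ) ≤ 1 := mod_cast h1
  have hmin : min (ENNReal.ofReal q) 1 = ENNReal.ofReal q :=
    min_eq_left (ENNReal.ofReal_le_one.2 h1')
  cases r
  · simp [coin, PMF.ofFintype_apply, hmin, ENNReal.toReal_sub_of_le (ENNReal.ofReal_le_one.2 h1'),
      ENNReal.toReal_ofReal h0']
  · simp [coin, PMF.ofFintype_apply, hmin, ENNReal.toReal_ofReal h0']

/-- The law of a number drawn from `0, …, t - 1` with probabilities proportional to the weights `w`,
in the way a program without jumps draws it: the number starts at `0` and is replaced by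
`a = 0, 1, …, t - 1` in turn, each time with probability `w a / ∑ b ≤ a, w b`. -/
def categoricalLaw (w : ℕ → ℚ) : ℕ → PMF ℕ
  | 0 => PMF.pure 0
  | t + 1 => (categoricalLaw w t).bind fun b =>
      (coin (w t / ∑ a ∈ Finset.range (t + 1), w a)).map fun r => if r then t else b

theorem categoricalLaw_succ_toReal {w : ℕ → ℚ} {t : ℕ} (hw : ∀ a < t + 1, 0 < w a) (b : ℕ) :
    (categoricalLaw w (t + 1) b).toReal
      = (w t / ∑ a ∈ Finset.range (t + 1), w a : ℚ) * (if b = t then 1 else 0)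
        + (1 - (w t / ∑ a ∈ Finset.range (t + 1), w a : ℚ)) * (categoricalLaw w t b).toReal := by
  set q := w t / ∑ a ∈ Finset.range (t + 1), w a
  have hw' : ∀ a ∈ Finset.range (t + 1), 0 ≤ w a := fun a ha => (hw a (Finset.mem_range.1 ha)).le
  have hq0 : 0 ≤ q := div_nonneg (hw' t (Finset.self_mem_range_succ t)) (Finset.sum_nonneg hw')
  have hq1 : q ≤ 1 := div_le_one_of_le₀
    (Finset.single_le_sum hw' (Finset.self_mem_range_succ t)) (Finset.sum_nonneg hw')
  have hswap : categoricalLaw w (t + 1)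
      = (coin q).bind fun r => if r then PMF.pure t else categoricalLaw w t := by
    simp only [categoricalLaw, ← PMF.bind_pure_comp]
    rw [PMF.bind_comm]
    refine congrArg (coin q).bind (funext fun r => ?_)
    cases r
    · exact PMF.bind_pure _
    · exact PMF.bind_const _ (PMF.pure t)
  rw [hswap, bind_toReal, Fintype.sum_bool, coin_toReal hq0 hq1, coin_toReal hq0 hq1]
  simp only [if_true, Bool.false_eq_true, if_false, pure_toReal]
  congr

theorem categoricalLaw_toReal_mul_sum {w : ℕ → ℚ} {t : ℕ} (hw : ∀ a < t, 0 < w a) (b : ℕ) :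
    (categoricalLaw w t b).toReal * (∑ a ∈ Finset.range t, w a : ℚ)
      = if b < t then (w b : ℝ) else 0 := by
  induction t with
  | zero => simp
  | succ t ih =>
    have hpos : (0 : ℝ) < (∑ a ∈ Finset.range (t + 1), w a : ℚ) :=
      mod_cast Finset.sum_pos (fun a ha => hw a (Finset.mem_range.1 ha))
        ⟨t, Finset.self_mem_range_succ t⟩
    have hsum : ((∑ a ∈ Finset.range (t + 1), w a : ℚ) : ℝ)
        = (∑ a ∈ Finset.range t, w a : ℚ) + w t := by
      rw [Finset.sum_range_succ, Rat.cast_add]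
    have hstep : (categoricalLaw w (t + 1) b).toReal * (∑ a ∈ Finset.range (t + 1), w a : ℚ)
        = w t * (if b = t then 1 else 0)
          + (categoricalLaw w t b).toReal * (∑ a ∈ Finset.range t, w a : ℚ) := by
      rw [categoricalLaw_succ_toReal hw, Rat.cast_div]
      field_simp
      rw [hsum]
      ring
    rw [hstep, ih fun a ha => hw a (by omega)]
    rcases lt_trichotomy b t with hb | rfl | hb
    · rw [if_neg hb.ne, if_pos hb, if_pos (by omega), mul_zero, zero_add]
    · rw [if_pos rfl, if_neg (lt_irrefl _), if_pos (by omega), mul_one, add_zero]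
    · rw [if_neg hb.ne', if_neg (by omega), if_neg (by omega), mul_zero, zero_add]

namespace IsChain

variable {ι : Type*} [Fintype ι] [DecidableEq ι] {s : ℕ} {rank : ι → ℕ} {r : ι → (ι → Fin s) → ℝ}
  (hr : IsChain rank r) (h0 : ∀ i v, 0 ≤ r i v)

/-- The conditional distribution of variable `i` given the values `v` of the others. -/
def condPMF (i : ι) (v : ι → Fin s) : PMF (Fin s) :=
  pmfOfReal (fun a => r i (Function.update v i a)) (fun _ => h0 i _) (hr.sum_one i v)

/-- The law of the assignment obtained from `v` by drawing anew the variables of a list, one after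
the other. -/
def seqLaw : List ι → (ι → Fin s) → PMF (ι → Fin s)
  | [], v => PMF.pure v
  | i :: l, v => (hr.condPMF h0 i v).bind fun a => seqLaw l (Function.update v i a)

theorem seqLaw_toReal {l : List ι} (hl : l.Pairwise fun i j => rank i < rank j)
    (v w : ι → Fin s) :
    (hr.seqLaw h0 l v w).toReal
      = if ∀ j ∉ l, w j = v j then (l.map fun i => r i w).prod else 0 := by
  induction l generalizing v with
  | nil =>
    rw [seqLaw, pure_toReal]
    simp [funext_iff]
  | cons i l ih =>
    obtain ⟨hil, hl'⟩ := List.pairwise_cons.1 hl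
    have hi : i ∉ l := fun h => (hil i h).false
    have hagree : (∀ j ∉ l, w j = Function.update v i (w i) j) ↔ ∀ j ∉ i :: l, w j = v j := by
      refine forall_congr' fun j => ?_
      rcases eq_or_ne j i with rfl | hji <;> simp [*]
    rw [seqLaw, bind_toReal, Finset.sum_eq_single (w i)]
    · rw [ih hl', condPMF, pmfOfReal_toReal, mul_ite, mul_zero]
      refine if_ctx_congr hagree (fun h => ?_) fun _ => rfl
      rw [List.map_cons, List.prod_cons]
      congr 1
      exact hr.dep i fun j hj => (hagree.2 h j fun hjl => (hil j hjl).not_ge hj).symm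
    · intro a _ ha
      rw [ih hl', if_neg, mul_zero]
      intro h
      exact ha (by simpa using (h i hi).symm)
    · exact fun h => (h (Finset.mem_univ _)).elim

theorem seqLaw_eq [NeZero s] (hrank : Function.Injective rank) {l : List ι}
    (hl : l.Pairwise fun i j => rank i < rank j) (hall : ∀ i, i ∈ l) (v : ι → Fin s) :
    hr.seqLaw h0 l v = pmfOfReal (fun w => ∏ i, r i w)
      (fun w => Finset.prod_nonneg fun i _ => h0 i w) (hr.sum_prod hrank) := by
  refine pmf_ext_toReal fun w => ?_
  have hnodup : l.Nodup := hl.imp fun h heq => (heq ▸ h).false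
  rw [hr.seqLaw_toReal h0 hl, pmfOfReal_toReal, if_pos fun j hj => (hj (hall j)).elim,
    ← List.prod_toFinset _ hnodup]
  exact Finset.prod_congr (by ext i; simp [hall]) fun _ _ => rfl

end IsChain

theorem exists_pairwise_lt {ι : Type*} [Finite ι] {rank : ι → ℕ}
    (hrank : Function.Injective rank) :
    ∃ l : List ι, (∀ i, i ∈ l) ∧ l.Pairwise fun i j => rank i < rank j := by
  have := Fintype.ofFinite ι
  let _ : LinearOrder ι := LinearOrder.lift' rank hrank
  exact ⟨Finset.univ.sort (· ≤ ·), fun i => (Finset.mem_sort _).2 (Finset.mem_univ i),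
    (Finset.sortedLT_sort Finset.univ).pairwise⟩

/-- The vertices in a topological order. -/
def ADMG.order {n : ℕ} (G : ADMG n) : List (Fin n) :=
  (exists_pairwise_lt G.rank_injective).choose

theorem ADMG.mem_order {n : ℕ} (G : ADMG n) (i : Fin n) : i ∈ G.order :=
  (exists_pairwise_lt G.rank_injective).choose_spec.1 i

theorem ADMG.pairwise_order {n : ℕ} (G : ADMG n) :
    G.order.Pairwise fun i j => G.rank i < G.rank j :=
  (exists_pairwise_lt G.rank_injective).choose_spec.2

theorem iid_succ {β : Type*} [Fintype β] (P : PMF β) (t : ℕ) :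
    iid P (t + 1) = (iid P t).bind fun T => P.map fun b => (Fin.snoc T b : Fin (t + 1) → β) := by
  refine pmf_ext_toReal fun T => ?_
  have hsnoc : ∀ (T' : Fin t → β) b, (Fin.snoc T' b : Fin (t + 1) → β) = T ↔
      T' = Fin.init T ∧ b = T (Fin.last t) := fun T' b =>
    ⟨fun h => h ▸ ⟨(Fin.init_snoc (α := fun _ => β) b T').symm,
        (Fin.snoc_last (α := fun _ => β) b T').symm⟩,
      fun h => by rw [h.1, h.2, Fin.snoc_init_self]⟩
  simp only [bind_toReal, iid_toReal, map_toReal, hsnoc, ite_and, Fin.prod_univ_castSucc]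
  simp [Fin.init]

theorem countIn_snoc {β : Type*} {t : ℕ} (A : Set β) (T : Fin t → β) (b : β) :
    countIn Finset.univ A (Fin.snoc T b : Fin (t + 1) → β)
      = countIn Finset.univ A T + if b ∈ A then 1 else 0 := by
  simp only [countIn, Finset.card_filter, Fin.sum_univ_castSucc, Fin.snoc_castSucc, Fin.snoc_last]

namespace ADMG

variable {n : ℕ} (G : ADMG n) {s : ℕ}

/-! ### The sampler -/

/-- The program that replaces the value of variable `i` by `a` with the probability that the law
`categoricalLaw` asks for. Cell `3` holds the address of the count for `a`, cell `5` the virtual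
count, cell `6` the sum of the weights so far, and cell `10` the number `1`. -/
def drawStep (i : Fin n) (a : ℕ) : List Instr :=
  [.load 4 3, .plus 4 4 5, .plus 6 6 4, .divide 4 4 6] ++ (.flip 8 4 ::
    [.const 4 a, .minus 4 4 (20 + i), .times 4 4 8, .plus (20 + i) (20 + i) 4, .plus 3 3 10])

/-- The memories `μ` and `ν` agree outside of the scratch registers of the sampler and the cell of
variable `i`. -/
def AgreeExcept (i : Fin n) (μ ν : Mem) : Prop :=
  ∀ a, a = 2 ∨ a = 5 ∨ a = 9 ∨ a = 10 ∨ 20 ≤ a ∧ a ≠ 20 + (i : ℕ) → ν a = μ a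

theorem exists_runs_weight (inp : ℕ → ℚ) {w W : ℚ} {adr : ℕ} {μ : Mem} (h3 : μ 3 = adr)
    (hw : μ adr + μ 5 = w) (h6 : μ 6 = W) :
    ∃ ν, Runs inp [.load 4 3, .plus 4 4 5, .plus 6 6 4, .divide 4 4 6] μ ν ∧
      ν 4 = w / (W + w) ∧ ν 6 = W + w ∧ ∀ a, a ≠ 4 → a ≠ 6 → ν a = μ a :=
  ⟨_, by simp only [Runs, run, Instr.step, PMF.pure_bind]; rfl, by simp [h3, hw, h6],
    by simp [h3, hw, h6], fun a h4 h6 => by simp [h4, h6]⟩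

theorem exists_runs_replace (inp : ℕ → ℚ) (i : Fin n) (a : ℕ) {r : Bool} {adr : ℕ} {b : ℚ}
    {μ : Mem} (h3 : μ 3 = adr) (h8 : μ 8 = if r then 1 else 0) (h10 : μ 10 = 1)
    (hb : μ (20 + i) = b) :
    ∃ ν, Runs inp [.const 4 a, .minus 4 4 (20 + i), .times 4 4 8, .plus (20 + (i : ℕ)) (20 + i) 4,
        .plus 3 3 10] μ ν ∧ ν 3 = (adr + 1 : ℕ) ∧ ν (20 + i) = (if r then (a : ℚ) else b) ∧
      ∀ c, c ≠ 3 → c ≠ 4 → c ≠ 20 + (i : ℕ) → ν c = μ c := by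
  have hvar : ∀ k < 20, 20 + (i : ℕ) ≠ k := by omega
  refine ⟨_, by simp only [Runs, run, Instr.step, PMF.pure_bind]; rfl, ?_, ?_, fun c c3 c4 ci => ?_⟩
  · simp [Function.update_apply, (hvar 3 _).symm, (hvar 10 _).symm, h3, h10]
  · cases r <;> simp [Function.update_apply, hvar 3, hvar 4, h8, hb]
  · simp [Function.update_apply, c3, c4, ci]

theorem coupled_drawStep (inp : ℕ → ℚ) (i : Fin n) (a : ℕ) {w W b : ℚ} {adr : ℕ} {μ : Mem}
    (h3 : μ 3 = adr) (h10 : μ 10 = 1) (hw : μ adr + μ 5 = w) (h6 : μ 6 = W) (hb : μ (20 + i) = b) :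
    Coupled (run inp (drawStep i a) μ) (coin (w / (W + w))) fun ν r =>
      AgreeExcept i μ ν ∧ ν 3 = (adr + 1 : ℕ) ∧ ν 6 = W + w ∧
        ν (20 + i) = if r then (a : ℚ) else b := by
  obtain ⟨μ₁, hweight, hquot, hsum, hkeep⟩ := exists_runs_weight inp h3 hw h6
  rw [drawStep, run_append, show run inp _ μ = _ from hweight, PMF.pure_bind, run, Instr.step,
    hquot, PMF.bind_map]
  refine (Coupled.refl _).bind_left ?_
  rintro r _ rfl
  set μ₂ := Function.update μ₁ 8 (if r then 1 else 0)
  have hkeep₂ : ∀ c, c ≠ 4 → c ≠ 6 → c ≠ 8 → μ₂ c = μ c := fun c c4 c6 c8 => by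
    rw [← hkeep c c4 c6]
    exact Function.update_of_ne c8 ..
  obtain ⟨ν, hreplace, hadr, hval, hkeep₃⟩ := exists_runs_replace inp i a (r := r) (μ := μ₂)
    (by rw [hkeep₂ 3 (by omega) (by omega) (by omega), h3]) (Function.update_self ..)
    (by rw [hkeep₂ 10 (by omega) (by omega) (by omega), h10])
    (by rw [hkeep₂ _ (by omega) (by omega) (by omega), hb])
  rw [Function.comp_apply, show run inp _ μ₂ = _ from hreplace]
  refine Coupled.pure ⟨fun c hc => ?_, hadr, ?_, hval⟩
  · rw [hkeep₃ c (by omega) (by omega) (by omega), hkeep₂ c (by omega) (by omega) (by omega)]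
  · rw [hkeep₃ 6 (by omega) (by omega) (by omega), ← hsum]
    exact Function.update_of_ne (by omega) ..

theorem coupled_drawSteps (inp : ℕ → ℚ) (i : Fin n) {adr : ℕ} {μ : Mem} (h3 : μ 3 = adr)
    (h6 : μ 6 = 0) (h10 : μ 10 = 1) (hb : μ (20 + i) = 0) (hadr : 21 + n ≤ adr) (t : ℕ) :
    Coupled (run inp ((List.range t).flatMap (drawStep i)) μ)
      (categoricalLaw (fun a => μ (adr + a) + μ 5) t) fun ν b =>
      AgreeExcept i μ ν ∧ ν 3 = (adr + t : ℕ) ∧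
        ν 6 = ∑ a ∈ Finset.range t, (μ (adr + a) + μ 5) ∧ ν (20 + i) = (b : ℚ) := by
  induction t with
  | zero => exact Coupled.pure ⟨fun _ _ => rfl, h3, h6, by simpa using hb⟩
  | succ t ih =>
    rw [List.range_succ, List.flatMap_append, List.flatMap_singleton, run_append, categoricalLaw,
      Finset.sum_range_succ]
    refine ih.bind fun ν b ⟨hagree, ν3, ν6, νb⟩ => ?_
    refine (coupled_drawStep inp i t ν3 (by rw [hagree 10 (by omega), h10])
      (by rw [hagree (adr + t) (by omega), hagree 5 (by omega)]) ν6 νb).map_right ?_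
    rintro ξ r ⟨hagree', ξ3, ξ6, ξb⟩
    refine ⟨fun c hc => by rw [hagree' c hc, hagree c hc], ξ3, ξ6, ?_⟩
    rw [ξb]
    cases r <;> rfl

/-- The program that draws a value for variable `i`, given the values of its context. -/
def drawVar (s : ℕ) (X i : Fin n) : List Instr :=
  horner ((G.contextList i).map (G.seenCell X i)) ++
    ([.times 1 1 2, .const 3 (tab n s (2 * i + 1) 0 : ℕ), .plus 3 3 1, .const 6 0,
      .const (20 + i) 0] ++ (List.range s).flatMap (drawStep i))

variable (X : Fin n) (x : Fin s) {M : ℕ} (J : Finset (Fin M)) (S : Fin M → Fin n → Fin s) {l : ℕ}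

/-- The memory `μ` between the steps of the sampler: it holds the assignment `v` and the table `o`
of what has been tallied so far, in steps of `q`. -/
structure Sampling (l : ℕ) (q : ℚ) (v : Fin n → Fin s) (o : ℕ → ℚ) (μ : Mem) : Prop where
  alphabet : μ 2 = s
  smoothing : μ 5 = l
  step : μ 9 = q
  one : μ 10 = 1
  intervention : μ (20 + n) = (x : ℕ)
  value (j : Fin n) : μ (20 + j) = (v j : ℕ)
  scope (i : Fin n) (v : Fin n → Fin s) :
    μ (tab n s (2 * i + 1) (codeOf (G.scopeList i) v)) = countIn J (cyl (G.scope i) v) S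
  out (c : ℕ) (hc : c < s ^ n) : μ (tab n s (2 * n) c) = o c

variable {G x J S} in
theorem Sampling.of_agreeExcept {q : ℚ} {v : Fin n → Fin s} {o : ℕ → ℚ} {μ ν : Mem} {i : Fin n}
    {a : Fin s} (h : G.Sampling x J S l q v o μ) (hν : AgreeExcept i μ ν)
    (ha : ν (20 + i) = (a : ℕ)) : G.Sampling x J S l q (Function.update v i a) o ν := by
  have htab : ∀ t c, ν (tab n s t c) = μ (tab n s t c) := fun t c => by
    have := le_tab n s t c
    exact hν _ (by omega)
  refine ⟨by rw [hν 2 (by omega), h.alphabet], by rw [hν 5 (by omega), h.smoothing],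
    by rw [hν 9 (by omega), h.step], by rw [hν 10 (by omega), h.one],
    by rw [hν _ (by omega), h.intervention], fun j => ?_, fun i v => by rw [htab, h.scope],
    fun c hc => by rw [htab, h.out c hc]⟩
  rcases eq_or_ne j i with rfl | hji
  · rw [ha, Function.update_self]
  · have := Fin.val_ne_of_ne hji
    rw [hν _ (by omega), h.value, Function.update_of_ne hji]

variable {x J S}

theorem exists_runs_startDraw (inp : ℕ → ℚ) (i : Fin n) {q : ℚ} {v : Fin n → Fin s} {o : ℕ → ℚ}
    {μ : Mem} (h : G.Sampling x J S l q v o μ) :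
    ∃ ν adr, Runs inp (horner ((G.contextList i).map (G.seenCell X i)) ++ [.times 1 1 2,
        .const 3 (tab n s (2 * i + 1) 0 : ℕ), .plus 3 3 1, .const 6 0, .const (20 + (i : ℕ)) 0])
        μ ν ∧ AgreeExcept i μ ν ∧ ν 3 = (adr : ℕ) ∧ ν 6 = 0 ∧ ν (20 + i) = 0 ∧ 21 + n ≤ adr ∧
      ∀ a : Fin s, ν (adr + a)
        = countIn J (cyl (G.scope i) (Function.update (G.twist X x i v) i a)) S := by
  have hcode := runs_horner inp (cell := G.seenCell X i) (l := G.contextList i) h.alphabet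
    (fun j _ => by have := (G.seenCell_bounds X i j).1; omega)
    (fun j _ => G.apply_seenCell h.intervention h.value i j)
  set z := G.twist X x i v
  set c := codeOf (G.contextList i) z
  have hadr := le_tab n s (2 * i + 1) (c * s)
  have hvar : ∀ k < 20, k ≠ 20 + (i : ℕ) := by omega
  have hscope : ∀ a : Fin s, codeOf (G.scopeList i) (Function.update z i a) = c * s + a := by
    intro a
    have htail : codeOf (G.contextList i) (Function.update z i a) = c :=
      congrArg (Nat.ofDigits s) (List.map_congr_left fun j hj => by
        rw [Function.update_of_ne (Finset.ne_of_mem_erase (G.mem_contextList.1 hj))])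
    rw [scopeList, codeOf_cons, Function.update_self, htail, mul_comm, add_comm]
  refine ⟨_, tab n s (2 * i + 1) (c * s),
    hcode.append (by simp only [Runs, run, Instr.step, PMF.pure_bind]; rfl), ?hagree, ?_, ?_, ?_,
    hadr, fun a => ?_⟩
  case hagree =>
    intro a ha
    iterate 6 rw [Function.update_of_ne (by omega)]
  · simp [hvar 3, h.alphabet, tab]
  · simp [hvar 6]
  · simp
  · iterate 6 rw [Function.update_of_ne (by omega)]
    rw [show tab n s (2 * i + 1) (c * s) + a = tab n s (2 * i + 1) (c * s + a) by
      unfold tab; omega, ← hscope, h.scope]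

variable [NeZero s] (x J S)

/-- The estimated conditional distribution of variable `i`. -/
def drawPMF (hl : 0 < l) (i : Fin n) (v : Fin n → Fin s) : PMF (Fin s) :=
  (G.isChain_twist X x (G.isChain_est J S hl)).condPMF (fun i _ => (G.est_pos J S hl i _).le) i v

theorem categoricalLaw_eq_map_drawPMF (hl : 0 < l) (i : Fin n) (v : Fin n → Fin s) {w : ℕ → ℚ}
    (hw : ∀ a : Fin s,
      w a = countIn J (cyl (G.scope i) (Function.update (G.twist X x i v) i a)) S + l) :
    categoricalLaw w s = (G.drawPMF X x J S hl i v).map fun a : Fin s => (a : ℕ) := by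
  have hpos : ∀ a < s, 0 < w a := fun a ha => by
    rw [hw ⟨a, ha⟩]
    positivity
  have hsum : ((∑ a ∈ Finset.range s, w a : ℚ) : ℝ)
      = countIn J (cyl (G.context i) (G.twist X x i v)) S + s * l := by
    rw [Finset.sum_range, Finset.sum_congr rfl fun a _ => hw a, Finset.sum_add_distrib,
      ← Nat.cast_sum, G.sum_countIn_scope]
    simp
  have hden := G.est_den_pos J S hl i (G.twist X x i v)
  refine pmf_ext_toReal fun b => mul_right_cancel₀ (hsum ▸ hden.ne') ?_
  have hdraw : ∀ a, (G.drawPMF X x J S hl i v a).toReal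
      = w a / (∑ a ∈ Finset.range s, w a : ℚ) := fun a => by
    rw [drawPMF, IsChain.condPMF, pmfOfReal_toReal, twist_update, est, cyl_context_update, hsum,
      hw a]
    push_cast
    rfl
  rw [categoricalLaw_toReal_mul_sum hpos, map_toReal]
  simp only [hdraw]
  split_ifs with hb
  · rw [Finset.sum_eq_single ⟨b, hb⟩ (fun a _ ha => if_neg fun h => ha (Fin.ext h)) (by simp),
      if_pos rfl, div_mul_cancel₀ _ (hsum ▸ hden.ne')]
  · rw [Finset.sum_eq_zero fun (a : Fin s) _ => if_neg fun h => hb (by omega), zero_mul]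

variable {x J S}

theorem coupled_drawVar (inp : ℕ → ℚ) (hl : 0 < l) (i : Fin n) {q : ℚ} {v : Fin n → Fin s}
    {o : ℕ → ℚ} {μ : Mem} (h : G.Sampling x J S l q v o μ) :
    Coupled (run inp (G.drawVar s X i) μ) (G.drawPMF X x J S hl i v) fun ν a =>
      G.Sampling x J S l q (Function.update v i a) o ν := by
  obtain ⟨μ₁, adr, hstart, hagree, h3, h6, hi, hadr, hcount⟩ := G.exists_runs_startDraw X inp i h
  have hdraw := coupled_drawSteps inp i h3 h6 (by rw [hagree 10 (by omega), h.one]) hi hadr s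
  rw [G.categoricalLaw_eq_map_drawPMF X x J S hl i v fun a => by
    rw [hcount, hagree 5 (by omega), h.smoothing]] at hdraw
  rw [drawVar, ← List.append_assoc, run_append, show run inp _ μ = _ from hstart, PMF.pure_bind]
  have hval := hdraw.of_map_right Fin.val_injective
  exact hval.mono fun ν a ⟨hagree', _, _, ha⟩ =>
    h.of_agreeExcept (fun c hc => by rw [hagree' c hc, hagree c hc]) ha

theorem coupled_drawVars (inp : ℕ → ℚ) (hl : 0 < l) {q : ℚ} {o : ℕ → ℚ} (is : List (Fin n))
    {v : Fin n → Fin s} {μ : Mem} (h : G.Sampling x J S l q v o μ) :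
    Coupled (run inp (is.flatMap (G.drawVar s X)) μ)
      ((G.isChain_twist X x (G.isChain_est J S hl)).seqLaw
        (fun i _ => (G.est_pos J S hl i _).le) is v)
      fun ν w => G.Sampling x J S l q w o ν := by
  induction is generalizing v μ with
  | nil => exact Coupled.pure h
  | cons i is ih =>
    rw [List.flatMap_cons, run_append, IsChain.seqLaw]
    exact (G.coupled_drawVar X inp hl i h).bind fun ν a hν => ih hν

end ADMG

namespace ADMG

variable {n : ℕ} {s : ℕ}

/-! ### The empirical distribution -/

section Output

variable {F : Finset (Fin n)}

/-- The index of the entry of the output table for an assignment to `F`. -/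
def outCode (w : F → Fin s) : ℕ := codeOf (Finset.univ : Finset F).toList w

theorem outCode_inj (hs : 2 ≤ s) {w w' : F → Fin s} : outCode w = outCode w' ↔ w = w' := by
  rw [outCode, outCode, codeOf_eq_iff hs, funext_iff]
  simp only [Finset.mem_toList, Finset.mem_univ, true_imp_iff]

theorem outCode_lt (hs : 2 ≤ s) (w : F → Fin s) : outCode w < s ^ n := by
  refine (codeOf_lt_of_nodup hs (Finset.nodup_toList _) w).trans_le
    (Nat.pow_le_pow_right (by omega) ?_)
  rw [Fintype.card_coe]
  exact card_finset_fin_le F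

variable (n s F) in
/-- The program that looks up the queried assignment in the output table. -/
def lookup : List Instr :=
  [.const 2 s] ++ (((Finset.univ : Finset F).toList.map fun j : F =>
      .read (20 + ((j : Fin n) : ℕ)) (j : Fin n)) ++
    (horner ((Finset.univ : Finset F).toList.map fun j : F => 20 + ((j : Fin n) : ℕ)) ++
      [.const 3 (tab n s (2 * n) 0 : ℕ), .plus 3 3 1, .load 0 3]))

theorem exists_runs_lookup (w : F → Fin s) (μ : Mem) :
    ∃ ν, Runs (queryInput w) (lookup n s F) μ ν ∧ ν 0 = μ (tab n s (2 * n) (outCode w)) := by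
  have hbase : Runs (queryInput w) [.const 2 s] μ (Function.update μ 2 s) := by
    simp only [Runs, run, Instr.step, PMF.pure_bind]
  obtain ⟨μ₁, hread, hcell, hkeep⟩ := exists_runs_assign (inp := queryInput w)
    (I := fun j : F => .read (20 + ((j : Fin n) : ℕ)) (j : Fin n)) (fun _ _ => rfl)
    (varCell_injective.comp Subtype.val_injective) (Finset.univ : Finset F).toList
    (Function.update μ 2 s)
  have hkeep' : ∀ a, a < 20 ∨ 20 + n ≤ a → μ₁ a = Function.update μ 2 (s : ℚ) a :=
    fun a ha => hkeep a fun j _ => by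
      have := j.1.2
      omega
  have hcode := runs_horner (queryInput w) (cell := fun j : F => 20 + ((j : Fin n) : ℕ))
    (l := (Finset.univ : Finset F).toList) (v := w) (μ := μ₁)
    (by rw [hkeep' 2 (by omega), Function.update_self]) (fun j _ => by omega)
    (fun j hj => (hcell j hj).trans (queryInput_apply w j))
  have hle := le_tab n s (2 * n) (outCode w)
  refine ⟨_, hbase.append (hread.append (hcode.append
    (by simp only [Runs, run, Instr.step, PMF.pure_bind]; rfl))), ?_⟩
  simp only [Function.update_self, Function.update_of_ne (by norm_num : (1 : ℕ) ≠ 3), floor_tab]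
  change Function.update _ 3 _ (tab n s (2 * n) (outCode w)) = _
  rw [Function.update_of_ne (by omega), Function.update_of_ne (by omega),
    Function.update_of_ne (by omega), hkeep' _ (by omega), Function.update_of_ne (by omega)]

theorem length_lookup (F : Finset (Fin n)) : (lookup n s F).length = 3 * F.card + 5 := by
  simp only [lookup, List.length_append, List.length_map, Finset.length_toList, length_horner,
    Finset.card_univ, Fintype.card_coe, List.length_cons, List.length_nil]
  ring

end Output

variable (G : ADMG n) (X : Fin n) (x : Fin s) {M : ℕ} {J : Finset (Fin M)}
  {S : Fin M → Fin n → Fin s} {l : ℕ} {q : ℚ}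

/-- The cell that holds the value of `j` after the intervention. -/
def outCell (j : Fin n) : ℕ := if j = X then 20 + n else 20 + j

variable (s) in
/-- The program that adds the content of cell `9` to the entry of the output table that belongs to
the drawn assignment. -/
def tally (F : Finset (Fin n)) : List Instr :=
  horner ((Finset.univ : Finset F).toList.map fun j : F => outCell X j) ++ bump n s (2 * n)

variable {G x} in
theorem Sampling.tally (hs : 2 ≤ s) {v : Fin n → Fin s} {o : ℕ → ℚ} {μ ν : Mem} {c : ℕ}
    (h : G.Sampling x J S l q v o μ) (hc : c < s ^ n) (hν : ∀ a, a ≠ 1 → a ≠ 3 → a ≠ 4 →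
      ν a = μ a + if a = tab n s (2 * n) c then q else 0) :
    G.Sampling x J S l q v (fun c' => o c' + if c' = c then q else 0) ν := by
  have htab : ∀ t c', ν (tab n s t c') = μ (tab n s t c')
      + if tab n s t c' = tab n s (2 * n) c then q else 0 := fun t c' => by
    have := le_tab n s t c'
    exact hν _ (by omega) (by omega) (by omega)
  have hlow : ∀ a, a < 21 + n → a ≠ 1 → a ≠ 3 → a ≠ 4 → ν a = μ a := fun a ha a1 a3 a4 => by
    have := le_tab n s (2 * n) c
    rw [hν a a1 a3 a4, if_neg (by omega), add_zero]
  refine ⟨?_, ?_, ?_, ?_, ?_, fun j => ?_, fun i w => ?_, fun c' hc' => ?_⟩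
  · rw [hlow 2 (by omega) (by omega) (by omega) (by omega), h.alphabet]
  · rw [hlow 5 (by omega) (by omega) (by omega) (by omega), h.smoothing]
  · rw [hlow 9 (by omega) (by omega) (by omega) (by omega), h.step]
  · rw [hlow 10 (by omega) (by omega) (by omega) (by omega), h.one]
  · rw [hlow _ (by omega) (by omega) (by omega) (by omega), h.intervention]
  · rw [hlow _ (by omega) (by omega) (by omega) (by omega), h.value]
  · rw [htab, h.scope, if_neg, add_zero]
    rw [tab_inj (G.codeOf_scopeList_lt hs i w) hc]
    omega
  · rw [htab, h.out c' hc']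
    simp only [tab_inj hc' hc, true_and]

theorem exists_runs_tally (hs : 2 ≤ s) (inp : ℕ → ℚ) (F : Finset (Fin n)) {v : Fin n → Fin s}
    {o : ℕ → ℚ} {μ : Mem} (h : G.Sampling x J S l q v o μ) :
    ∃ ν, Runs inp (tally s X F) μ ν ∧ G.Sampling x J S l q v
      (fun c => o c + if c = outCode (readOff F X x v) then q else 0) ν := by
  have hcode := runs_horner inp (cell := fun j : F => outCell X j)
    (l := (Finset.univ : Finset F).toList) (v := readOff F X x v) h.alphabet
    (fun j _ => by unfold outCell; split_ifs <;> omega) (fun j _ => by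
      unfold outCell readOff
      split_ifs with hj
      · rw [h.intervention, hj, Function.update_self]
      · rw [h.value, Function.update_of_ne hj])
  obtain ⟨ν, hbump, hν⟩ := exists_runs_bump inp n s (2 * n) (Function.update_self 1 _ μ)
  refine ⟨ν, hcode.append hbump, h.tally hs (outCode_lt hs _) fun a a1 a3 a4 => ?_⟩
  rw [hν a a3 a4, Function.update_of_ne a1, Function.update_of_ne (by norm_num), h.step]
  rfl

variable (s) in
/-- The program that draws one assignment from the estimated distribution and tallies it. -/
def round (F : Finset (Fin n)) : List Instr := G.order.flatMap (G.drawVar s X) ++ tally s X F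

/-- The program that stores the empirical distribution of `N` draws. -/
def tabulator (F : Finset (Fin n)) (l N : ℕ) : List Instr :=
  [.const 2 s, .const 5 l, .const 9 (1 / N), .const 10 1, .const (20 + n) (x : ℕ)] ++
    (((List.finRange n).map fun j : Fin n => .const (20 + (j : ℕ)) 0) ++
      (List.range N).flatMap fun _ => G.round s X F)

theorem exists_runs_startRounds (inp : ℕ → ℚ) {μ : Mem} (hμ : G.Holds J S μ) (l : ℕ) (q : ℚ) :
    ∃ ν v, Runs inp ([.const 2 s, .const 5 l, .const 9 q, .const 10 1, .const (20 + n) (x : ℕ)] ++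
        (List.finRange n).map fun j : Fin n => .const (20 + (j : ℕ)) 0) μ ν ∧
      G.Sampling x J S l q v (fun _ => 0) ν := by
  have : NeZero s := ⟨fun hs => (hs ▸ x).elim0⟩
  set μ₁ := Function.update (Function.update (Function.update (Function.update
    (Function.update μ 2 (s : ℚ)) 5 (l : ℚ)) 9 q) 10 1) (20 + n) ((x : ℕ) : ℚ) with hμ₁
  have hinit : Runs inp [.const 2 s, .const 5 l, .const 9 q, .const 10 1, .const (20 + n) (x : ℕ)]
      μ μ₁ := by
    simp only [Runs, run, Instr.step, PMF.pure_bind, hμ₁]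
  have hvar : ∀ k < 20, k ≠ 20 + n := by omega
  obtain ⟨ν, hzero, hcell, hkeep⟩ := exists_runs_assign (inp := inp)
    (I := fun j : Fin n => .const (20 + (j : ℕ)) 0) (fun _ _ => rfl) varCell_injective
    (List.finRange n) μ₁
  have hkeep' : ∀ a, a < 20 ∨ 20 + n ≤ a → ν a = μ₁ a := fun a ha => hkeep a fun j _ => by omega
  have htab : ∀ t c, ν (tab n s t c) = μ (tab n s t c) := fun t c => by
    have := le_tab n s t c
    rw [hkeep' _ (by omega), hμ₁]
    iterate 5 rw [Function.update_of_ne (by omega)]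
  refine ⟨ν, fun _ => 0, hinit.append hzero, ?_, ?_, ?_, ?_, ?_, fun j => ?_, fun i w => ?_,
    fun c hc => ?_⟩
  · simp [hkeep' 2, hμ₁, hvar 2]
  · simp [hkeep' 5, hμ₁, hvar 5]
  · simp [hkeep' 9, hμ₁, hvar 9]
  · simp [hkeep' 10, hμ₁, hvar 10]
  · simp [hkeep' (20 + n), hμ₁]
  · simp [hcell j (List.mem_finRange j)]
  · rw [htab, hμ.scope]
  · rw [htab, hμ.out c hc]

variable [NeZero s]

theorem coupled_round (hs : 2 ≤ s) (inp : ℕ → ℚ) (hl : 0 < l) (F : Finset (Fin n))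
    {v : Fin n → Fin s} {o : ℕ → ℚ} {μ : Mem} (h : G.Sampling x J S l q v o μ) :
    Coupled (run inp (G.round s X F) μ) (G.estPMF J S X x hl) fun ν w =>
      G.Sampling x J S l q w (fun c => o c + if c = outCode (readOff F X x w) then q else 0) ν := by
  have hdraw := G.coupled_drawVars X inp hl G.order h
  rw [IsChain.seqLaw_eq _ _ G.rank_injective G.pairwise_order G.mem_order] at hdraw
  rw [round, run_append]
  refine hdraw.bind_left fun ν w hν => ?_
  obtain ⟨ξ, htally, hξ⟩ := G.exists_runs_tally X x hs inp F hν
  rw [show run inp _ ν = _ from htally]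
  exact Coupled.pure hξ

theorem coupled_rounds (hs : 2 ≤ s) (inp : ℕ → ℚ) (hl : 0 < l) (F : Finset (Fin n))
    {v : Fin n → Fin s} {μ : Mem} (h : G.Sampling x J S l q v (fun _ => 0) μ) (t : ℕ) :
    Coupled (run inp ((List.range t).flatMap fun _ => G.round s X F) μ)
      (iid (G.estPMF J S X x hl) t) fun ν T => ∃ v, G.Sampling x J S l q v
        (fun c => countIn Finset.univ {w | c = outCode (readOff F X x w)} T * q) ν := by
  induction t with
  | zero =>
    refine Coupled.pure_left fun T => ⟨v, ?_⟩
    simpa [countIn] using h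
  | succ t ih =>
    rw [List.range_succ, List.flatMap_append, List.flatMap_singleton, run_append, iid_succ]
    refine ih.bind fun ν T ⟨u, hu⟩ => ?_
    refine (G.coupled_round X x hs inp hl F hu).map_right fun ξ w hξ => ⟨w, ?_⟩
    convert hξ using 2 with c
    rw [countIn_snoc]
    push_cast
    simp only [Set.mem_ofPred_eq]
    split_ifs <;> ring

theorem coupled_tabulator (hs : 2 ≤ s) (inp : ℕ → ℚ) (hl : 0 < l) (F : Finset (Fin n))
    (N : ℕ) {μ : Mem} (hμ : G.Holds J S μ) :
    Coupled (run inp (G.tabulator X x F l N) μ) (iid (G.estPMF J S X x hl) N) fun ν T =>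
      ∃ v, G.Sampling x J S l (1 / N) v
        (fun c => countIn Finset.univ {w | c = outCode (readOff F X x w)} T * (1 / N)) ν := by
  obtain ⟨ν, v, hstart, hν⟩ := G.exists_runs_startRounds x inp hμ l (1 / N)
  rw [tabulator, ← List.append_assoc, run_append, show run inp _ μ = _ from hstart, PMF.pure_bind]
  exact G.coupled_rounds X x hs inp hl F hν N

end ADMG

section Empirical

variable {β γ : Type*} (g : β → γ) {N : ℕ} (T : Fin N → β)

theorem sum_countIn_fiber (A : Finset γ) :
    ∑ w ∈ A, countIn Finset.univ {b | g b = w} T = countIn Finset.univ {b | g b ∈ A} T := by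
  unfold countIn
  rw [Finset.card_eq_sum_card_fiberwise (f := fun j => g (T j)) (t := A)
    (by intro j hj; simpa using hj)]
  refine Finset.sum_congr rfl fun w hw => congrArg Finset.card (Finset.ext fun j => ?_)
  simp only [Finset.mem_filter, Finset.mem_univ, true_and, Set.mem_ofPred_eq]
  exact ⟨fun h => ⟨h ▸ hw, h⟩, And.right⟩

theorem sum_map_toReal_eq_prob (P : PMF β) (A : Finset γ) :
    ∑ w ∈ A, (P.map g w).toReal = prob P {b | g b ∈ A} := by
  rw [show {b | g b ∈ A} = g ⁻¹' A from rfl, ← prob_map, prob, PMF.toOuterMeasure_apply_finset,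
    ENNReal.toReal_sum fun w _ => PMF.apply_ne_top _ w]

variable [Fintype γ]

/-- The empirical distribution of `g` on the sample `T`. -/
def empirical (hN : 0 < N) : PMF γ :=
  pmfOfReal (fun w => (countIn Finset.univ {b | g b = w} T : ℝ) / N) (fun _ => by positivity) <| by
    rw [← Finset.sum_div, ← Nat.cast_sum, sum_countIn_fiber]
    have : (N : ℝ) ≠ 0 := by exact_mod_cast hN.ne'
    simp [countIn, this]

theorem tvDist_eq_sum_filter_le (p q : PMF γ) :
    tvDist p q = ∑ w with (p w).toReal ≤ (q w).toReal, ((q w).toReal - (p w).toReal) := by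
  have hzero : ∑ w, ((q w).toReal - (p w).toReal) = 0 := by
    rw [Finset.sum_sub_distrib, sum_toReal, sum_toReal, sub_self]
  have habs : ∀ w, |(p w).toReal - (q w).toReal|
      = 2 * (if (p w).toReal ≤ (q w).toReal then (q w).toReal - (p w).toReal else 0)
        - ((q w).toReal - (p w).toReal) := fun w => by
    split_ifs with h
    · rw [abs_of_nonpos (by linarith)]; ring
    · rw [abs_of_nonneg (by linarith)]; ring
  rw [tvDist, Finset.sum_congr rfl fun w _ => habs w, Finset.sum_sub_distrib, hzero,
    ← Finset.mul_sum, sub_zero, mul_div_cancel_left₀ _ two_ne_zero, Finset.sum_filter]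

variable (P : PMF β)

/-- The samples for which the empirical frequency of some event is far from its probability. -/
def badDraws (N : ℕ) (l : ℝ) : Set (Fin N → β) :=
  ⋃ A : Finset γ, deviates P Finset.univ {b | g b ∈ A} l

variable {g P T} in
theorem sq_tvDist_empirical_le (hN : 0 < N) {l : ℝ} (hl : 0 < l) (hT : T ∉ badDraws g P N l) :
    (N * tvDist (P.map g) (empirical g T hN)) ^ 2 ≤ 4 * l * (N + l) := by
  have hN' : (N : ℝ) ≠ 0 := by exact_mod_cast hN.ne'
  set A := Finset.univ.filter fun w => (P.map g w).toReal ≤ (empirical g T hN w).toReal with hA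
  have hcount : N * ∑ w ∈ A, (empirical g T hN w).toReal
      = countIn Finset.univ {b | g b ∈ A} T := by
    simp only [empirical, pmfOfReal_toReal]
    rw [← Finset.sum_div, ← Nat.cast_sum, sum_countIn_fiber, mul_div_cancel₀ _ hN']
  have hdev := sq_sub_le_of_notMem_deviates fun h => hT (Set.mem_iUnion_of_mem A h)
  rw [Finset.card_univ, Fintype.card_fin] at hdev
  rw [tvDist_eq_sum_filter_le, ← hA, Finset.sum_sub_distrib, mul_sub, hcount,
    sum_map_toReal_eq_prob]
  refine hdev.trans ?_
  gcongr
  exact mul_le_of_le_one_right (Nat.cast_nonneg N) (prob_le_one P _)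

theorem prob_iid_badDraws_le [Fintype β] {l : ℝ} (hl : 0 < l) :
    prob (iid P N) (badDraws g P N l) ≤ 2 ^ Fintype.card γ * (2 * Real.exp (-l)) := by
  refine (prob_iUnion_le _ _).trans
    ((Finset.sum_le_sum fun A _ => prob_iid_deviates_le P _ _ hl).trans_eq ?_)
  rw [Finset.sum_const, nsmul_eq_mul, Finset.card_univ, Fintype.card_finset, Nat.cast_pow,
    Nat.cast_ofNat]

end Empirical

theorem tvDist_empirical_le {β γ : Type*} [Fintype γ] {g : β → γ} {P : PMF β} {N : ℕ}
    {T : Fin N → β} (hN : 0 < N) {l ε : ℝ} (hl : 0 < l) (hε : 0 ≤ ε)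
    (hlN : 4 * l * (N + l) ≤ (N * ε) ^ 2) (hT : T ∉ badDraws g P N l) :
    tvDist (P.map g) (empirical g T hN) ≤ ε :=
  le_of_mul_le_mul_left (abs_le_of_sq_le_sq' ((sq_tvDist_empirical_le hN hl hT).trans hlN)
    (by positivity)).2 (by exact_mod_cast hN : (0 : ℝ) < N)

namespace ADMG

variable {n : ℕ} (G : ADMG n) {s : ℕ} (X : Fin n)

variable {G X} in
theorem Sampling.isCloseEvaluator_lookup {x : Fin s} (hs : 2 ≤ s) {M : ℕ} {J : Finset (Fin M)}
    {S : Fin M → Fin n → Fin s} {l : ℕ} {F : Finset (Fin n)} {N : ℕ} (hN : 0 < N)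
    {T : Fin N → Fin n → Fin s} {v : Fin n → Fin s} {μ : Mem}
    (h : G.Sampling x J S l (1 / N) v
      (fun c => countIn Finset.univ {w | c = outCode (readOff F X x w)} T * (1 / N)) μ)
    {D : PMF (F → Fin s)} {ε : ℝ} (hD : tvDist D (empirical (readOff F X x) T hN) ≤ ε) :
    IsCloseEvaluator (lookup n s F) μ D ε := by
  refine ⟨_, hD, fun w => ?_⟩
  obtain ⟨ν, hrun, hν⟩ := exists_runs_lookup w μ
  have hfiber : {u : Fin n → Fin s | outCode w = outCode (readOff F X x u)}
      = {u | readOff F X x u = w} := by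
    ext u
    rw [Set.mem_ofPred_eq, outCode_inj hs, eq_comm, Set.mem_ofPred_eq]
  rw [show run _ _ _ = _ from hrun, PMF.pure_map, hν, h.out _ (outCode_lt hs w), empirical,
    pmfOfReal_toReal, hfiber]
  push_cast
  rw [mul_one_div]

/-! ### Running times -/

theorem length_sampleBlock_le (j : ℕ) : (G.sampleBlock s j).length ≤ 14 * (n * G.width) := by
  have hstep : ∀ i ∈ List.finRange n, (G.countStep s i).length ≤ 13 * G.width := by
    intro i _
    have hcontext := G.length_contextList_lt i
    simp only [countStep, bump, List.length_append, length_horner, List.length_map,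
      List.length_cons, List.length_nil]
    omega
  have hsteps := length_flatMap_le _ hstep
  rw [List.length_finRange, Nat.mul_left_comm] at hsteps
  have hn : n ≤ n * G.width := by
    rcases n.eq_zero_or_pos with rfl | hn
    · exact Nat.zero_le _
    · exact Nat.le_mul_of_pos_right n (G.width_pos ⟨0, hn⟩)
  simp only [sampleBlock, List.length_append, List.length_map, List.length_finRange]
  omega

theorem length_learner_le {m : ℕ} (hm : 0 < m) (hn : 0 < n) :
    (G.learner s m).length ≤ 16 * (m * n * G.width) := by
  have hblocks := length_flatMap_le (List.range m) fun j _ => G.length_sampleBlock_le (s := s) j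
  rw [List.length_range, Nat.mul_left_comm, ← mul_assoc m] at hblocks
  have hpos : 1 ≤ m * n * G.width := Nat.mul_pos (Nat.mul_pos hm hn) (G.width_pos ⟨0, hn⟩)
  simp only [learner, List.length_append, List.length_cons, List.length_nil]
  omega

theorem length_order_le : G.order.length ≤ n := by
  have hnodup : G.order.Nodup := G.pairwise_order.imp fun {_ _} h he => h.ne (by rw [he])
  simpa using hnodup.length_le_card

theorem length_drawVar_le (hs : 2 ≤ s) (i : Fin n) :
    (G.drawVar s X i).length ≤ 14 * (s * G.width) := by
  have hcontext := G.length_contextList_lt i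
  have hsteps := length_flatMap_le (List.range s) (f := drawStep i) (b := 10)
    fun a _ => by simp [drawStep]
  rw [List.length_range] at hsteps
  have hwidth : s ≤ s * G.width := Nat.le_mul_of_pos_right s (G.width_pos i)
  have halphabet : 2 * G.width ≤ s * G.width := Nat.mul_le_mul_right _ hs
  simp only [drawVar, List.length_append, length_horner, List.length_map, List.length_cons,
    List.length_nil]
  omega

theorem length_round_le (hs : 2 ≤ s) (F : Finset (Fin n)) :
    (G.round s X F).length ≤ 18 * (n * s * G.width) := by
  have hdraws : (G.order.flatMap (G.drawVar s X)).length ≤ 14 * (n * s * G.width) := by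
    calc _ ≤ G.order.length * (14 * (s * G.width)) :=
          length_flatMap_le _ fun i _ => G.length_drawVar_le X hs i
      _ ≤ n * (14 * (s * G.width)) := Nat.mul_le_mul_right _ G.length_order_le
      _ = 14 * (n * s * G.width) := by ring
  have hF : F.card ≤ n := card_finset_fin_le F
  have hn : 2 * n ≤ n * s * G.width := by
    calc 2 * n = n * 2 * 1 := by ring
      _ ≤ n * s * G.width := by
        gcongr
        exact G.width_pos X
  have := X.pos
  simp only [round, tally, bump, List.length_append, length_horner, List.length_map,
    Finset.length_toList, List.length_cons, List.length_nil, Finset.card_univ, Fintype.card_coe]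
  omega

theorem length_tabulator_le (hs : 2 ≤ s) (x : Fin s) (F : Finset (Fin n)) (l : ℕ) {N : ℕ}
    (hN : 0 < N) : (G.tabulator X x F l N).length ≤ 21 * (n * s * G.width * N) := by
  have hrounds := length_flatMap_le (List.range N) fun _ _ => G.length_round_le X hs F
  rw [List.length_range, Nat.mul_left_comm, mul_comm N] at hrounds
  have hn : 2 * n ≤ n * s * G.width * N := by
    calc 2 * n = n * 2 * 1 * 1 := by ring
      _ ≤ n * s * G.width * N := by
        gcongr
        · exact G.width_pos X
        · exact hN
  have := X.pos
  simp only [tabulator, List.length_append, List.length_cons, List.length_nil, List.length_map,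
    List.length_finRange]
  omega

end ADMG

namespace ADMG

variable {n : ℕ} {G : ADMG n} {s : ℕ} [NeZero s] {X : Fin n} {x : Fin s} {F : Finset (Fin n)}
  {P : PMF (Fin n → Fin s)} {N m l : ℕ} {hl : 0 < l} {B : Set (Fin N → Fin n → Fin s)}
  {D : PMF (F → Fin s)} {ε η : ℝ}

theorem one_sub_le_prob_isCloseEvaluator_evaluator (hs : 2 ≤ s) (hm : m ≤ N)
    (hB : prob (iid P N) B ≤ η)
    (hD : ∀ S ∉ B, tvDist D ((G.estPMF (used N m) S X x hl).map (readOff F X x)) ≤ ε) :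
    1 - η ≤ prob (learned P N (G.learner s m))
      {μ | IsCloseEvaluator (G.evaluator X x F l) μ D ε} := by
  refine one_sub_le_prob (((G.coupled_learned hs P hm).prob_le fun μ S hS hμ => ?_).trans hB)
  by_contra hgood
  exact hμ (G.isCloseEvaluator_evaluator hS hl (hD S hgood))

theorem one_sub_le_prob_isCloseEvaluator_lookup (hs : 2 ≤ s) (hm : m ≤ N)
    (hB : prob (iid P N) B ≤ η)
    (hD : ∀ S ∉ B, tvDist D ((G.estPMF (used N m) S X x hl).map (readOff F X x)) ≤ ε)
    {K : ℕ} (hK : 0 < K) {t ε' η' : ℝ} (ht : 0 < t) (hε' : 0 ≤ ε')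
    (hη' : 2 ^ s ^ F.card * (2 * Real.exp (-t)) ≤ η') (htK : 4 * t * (K + t) ≤ (K * ε') ^ 2) :
    1 - (η + η') ≤ prob ((learned P N (G.learner s m)).bind
        (run (fun _ => 0) (G.tabulator X x F l K)))
      {μ | IsCloseEvaluator (lookup n s F) μ D (ε + ε')} := by
  set g := readOff F X x
  let Q S := G.estPMF (used N m) S X x hl
  have hcoupled : Coupled ((learned P N (G.learner s m)).bind
      (run (fun _ => 0) (G.tabulator X x F l K)))
      ((iid P N).bind fun S => (iid (Q S) K).map (Prod.mk S))
      fun ν ST => ∃ v, G.Sampling x (used N m) ST.1 l (1 / K) v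
        (fun c => countIn Finset.univ {w | c = outCode (g w)} ST.2 * (1 / K)) ν :=
    (G.coupled_learned hs P hm).bind fun μ S hS =>
      (G.coupled_tabulator X x hs _ hl F K hS).map_right fun _ _ h => h
  have hbad : ∀ Q : PMF (Fin n → Fin s), prob (iid Q K) (badDraws g Q K t) ≤ η' := fun Q =>
    (prob_iid_badDraws_le g Q ht).trans (by simpa using hη')
  refine one_sub_le_prob ((hcoupled.prob_le
    (B := {ST | ST.1 ∈ B ∨ ST.2 ∈ badDraws g (Q ST.1) K t}) ?_).trans ?_)
  · rintro ν ⟨S, T⟩ ⟨v, hv⟩ hν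
    by_contra hgood
    rw [Set.mem_ofPred_eq, not_or] at hgood
    exact hν (hv.isCloseEvaluator_lookup hs hK ((tvDist_triangle _ ((Q S).map g) _).trans
      (add_le_add (hD S hgood.1) (tvDist_empirical_le hK ht hε' htK hgood.2))))
  · refine (prob_bind_le _ _ B _ ((prob_nonneg _ _).trans (hbad (PMF.pure fun _ => 0)))
      fun S hS => ?_).trans (add_le_add_left hB η')
    rw [prob_map]
    exact (prob_mono fun T hT => hT.resolve_left hS).trans (hbad (Q S))

/-- With probability at least `1 - δ`, the program `E` evaluates an `ε`-approximation of the
interventional distribution on `F` from the data that `L` returns on `m` samples, and so does `Q`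
from the data that `B` makes of them. -/
def Learns (G : ADMG n) (X : Fin n) (x : Fin s) (F : Finset (Fin n)) (α ε δ : ℝ) (m : ℕ)
    (L E B Q : List Instr) : Prop :=
  ∀ M : CBN G s, M.StronglyPositive X α →
    1 - δ ≤ prob (learned M.obs m L) {μ | IsCloseEvaluator E μ (marginal (M.interv X x) F) ε} ∧
    1 - δ ≤ prob ((learned M.obs m L).bind (run (fun _ => 0) B))
      {μ | IsCloseEvaluator Q μ (marginal (M.interv X x) F) ε}

theorem learns_learner (hs : 2 ≤ s) (hid : G.Identifiable X) {α ρ δ : ℝ} (hρ : 0 ≤ ρ)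
    (hdom : ∀ M : CBN G s, M.StronglyPositive X α → M.Dominated X x ρ) (hm : 0 < m) (hmN : m ≤ N)
    (hl : 0 < l) (hε : 0 < ε) (hδ : 0 < δ)
    (hlδ : 4 * n * (s : ℝ) ^ G.width * Real.exp (-l) ≤ δ / 2)
    (hlm : ρ * (n * (s : ℝ) ^ G.width * (1320 * l) / m) ≤ (ε / 2) ^ 2)
    {K : ℕ} (hK : 0 < K) {t : ℝ} (ht : 0 < t)
    (htδ : 2 ^ s ^ F.card * (2 * Real.exp (-t)) ≤ δ / 2)
    (htK : 4 * t * (K + t) ≤ (K * (ε / 2)) ^ 2) :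
    G.Learns X x F α ε δ N (G.learner s m) (G.evaluator X x F l) (G.tabulator X x F l K)
      (lookup n s F) := by
  intro M hM
  have hbad : prob (iid M.obs N) (M.badSamples (used N m) l) ≤ δ / 2 :=
    (M.prob_iid_badSamples_le _ hl).trans hlδ
  have hclose : ∀ S ∉ M.badSamples (used N m) l, tvDist (marginal (M.interv X x) F)
      ((G.estPMF (used N m) S X x hl).map (readOff F X x)) ≤ ε / 2 := fun S hS => by
    have hused : (used N m).Nonempty := Finset.card_pos.1 ((card_used hmN).symm ▸ hm)
    have hsq := M.sq_tvDist_map_readOff_estPMF_le hid F hρ (hdom M hM) hl hused hS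
    rw [card_used hmN] at hsq
    exact (abs_le_of_sq_le_sq' (hsq.trans hlm) (by linarith)).2
  constructor
  · exact one_sub_le_prob_isCloseEvaluator_evaluator hs hmN (hbad.trans (by linarith))
      fun S hS => (hclose S hS).trans (by linarith)
  · simpa only [add_halves] using one_sub_le_prob_isCloseEvaluator_lookup hs hmN hbad hclose hK ht
      (by linarith) htδ htK

theorem learns_of_subsingleton [Subsingleton (Fin s)] {α δ : ℝ} (hε : 0 ≤ ε) (hδ : 0 ≤ δ) (m : ℕ)
    (L B : List Instr) : G.Learns X x F α ε δ m L [.const 0 1] B [.const 0 1] := by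
  have hclose : ∀ (D : PMF (F → Fin s)) (μ : Mem), IsCloseEvaluator [.const 0 1] μ D ε := by
    refine fun D μ => ⟨D, by simpa [tvDist] using hε, fun w => ?_⟩
    have hsum := sum_toReal D
    rw [Fintype.sum_subsingleton _ w] at hsum
    rw [hsum]
    simp [run, Instr.step, PMF.pure_map]
  intro M _
  constructor <;>
  · refine one_sub_le_prob ?_
    simp [hclose, prob, hδ]

end ADMG

theorem CBN.StronglyPositive.mul_lt_one {n : ℕ} {G : ADMG n} {s : ℕ} [NeZero s] {M : CBN G s}
    {X : Fin n} {α : ℝ} (h : M.StronglyPositive X α) : s * α < 1 := by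
  have hlt : ∀ a : Fin s, α < (M.obs.map (fun w => w X) a).toReal := fun a => by
    rw [← PMF.toOuterMeasure_apply_singleton, ← prob, prob_map]
    exact (h.lt_prob fun _ => a).trans_le
      (prob_mono fun w hw => hw X (G.mem_paPlus.2 (Or.inl (G.self_mem_cComp X))))
  calc s * α = ∑ _a : Fin s, α := by simp
    _ < ∑ a, (M.obs.map (fun w => w X) a).toReal :=
        Finset.sum_lt_sum_of_nonempty ⟨0, Finset.mem_univ _⟩ fun a _ => hlt a
    _ = 1 := sum_toReal _

/-! ### Choice of the parameters -/

theorem exists_nat_between {c r : ℝ} (hc : 0 ≤ c) (hr : 1 ≤ r) :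
    ∃ m : ℕ, c * r ≤ m ∧ m ≤ (c + 1) * r :=
  ⟨⌈c * r⌉₊, Nat.le_ceil _, (Nat.ceil_lt_add_one (by positivity)).le.trans (by linarith)⟩

theorem exists_nat_mul_exp_neg_le {y δ : ℝ} (hδ : 0 < δ) (hy : δ < y) :
    ∃ l : ℕ, 0 < l ∧ y * Real.exp (-l) ≤ δ ∧ l ≤ Real.log (y / δ) + 1 := by
  have hy0 : 0 < y := hδ.trans hy
  have hlog : 0 < Real.log (y / δ) := Real.log_pos ((one_lt_div hδ).2 hy)
  refine ⟨⌈Real.log (y / δ)⌉₊, Nat.ceil_pos.2 hlog, ?_, (Nat.ceil_lt_add_one hlog.le).le⟩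
  have hexp : y / δ ≤ Real.exp ⌈Real.log (y / δ)⌉₊ :=
    (Real.log_le_iff_le_exp (by positivity)).1 (Nat.le_ceil _)
  rw [Real.exp_neg, ← div_eq_mul_inv, div_le_iff₀ (Real.exp_pos _), ← div_le_iff₀' hδ]
  exact hexp

theorem exists_confidence {y w δ : ℝ} (hy : 1 ≤ y) (hyw : Real.log y ≤ w)
    (hw : 2 * Real.log 2 ≤ w) (hδ : 0 < δ) (hδ1 : δ ≤ 1) :
    ∃ l : ℕ, 0 < l ∧ 4 * y * Real.exp (-l) ≤ δ / 2 ∧ l ≤ 5 * w * (1 + Real.log (1 / δ)) := by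
  obtain ⟨l, hl, hexp, hle⟩ := exists_nat_mul_exp_neg_le (y := 4 * y) (half_pos hδ) (by linarith)
  refine ⟨l, hl, hexp, hle.trans ?_⟩
  have hlog2 := Real.log_two_gt_d9
  have hD : 0 ≤ Real.log (1 / δ) := Real.log_nonneg (one_le_one_div hδ hδ1)
  have hlog : Real.log (4 * y / (δ / 2)) = 3 * Real.log 2 + Real.log y + Real.log (1 / δ) := by
    rw [show 4 * y / (δ / 2) = 2 ^ 3 * y * (1 / δ) by field_simp; norm_num,
      Real.log_mul (by positivity) (by positivity), Real.log_mul (by positivity) (by positivity),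
      Real.log_pow]
    norm_cast
  have hwD : Real.log (1 / δ) ≤ 5 * w * Real.log (1 / δ) :=
    le_mul_of_one_le_left hD (by linarith)
  rw [hlog]
  linarith

theorem exists_sample_size {y ρ ε δ T : ℝ} {K : ℕ} (hK : 0 < K) (hKy : 2 ^ K ≤ y) (hρ : 1 ≤ ρ)
    (hε : 0 < ε) (hε1 : ε ≤ 1) (hδ : 0 < δ) (hδ1 : δ ≤ 1) (hT : ρ * y / ε ^ 2 ≤ T) :
    ∃ l m : ℕ, 0 < l ∧ 0 < m ∧ 4 * y * Real.exp (-l) ≤ δ / 2 ∧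
      ρ * (y * (1320 * l) / m) ≤ (ε / 2) ^ 2 ∧
      (K * m : ℝ) ≤ 60000 * T * Real.log (2 + T) ^ 2 * (1 + Real.log (1 / δ)) := by
  have hy : 2 ≤ y := (le_self_pow₀ one_le_two hK.ne').trans hKy
  have hyY : y ≤ ρ * y / ε ^ 2 := by
    rw [le_div_iff₀ (by positivity)]
    exact (mul_le_of_le_one_right (by linarith) (pow_le_one₀ hε.le hε1)).trans
      (le_mul_of_one_le_left (by linarith) hρ)
  have hD : 0 ≤ Real.log (1 / δ) := Real.log_nonneg (one_le_one_div hδ hδ1)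
  have hlog2 := Real.log_two_gt_d9
  have hw : 2 * Real.log 2 ≤ Real.log (2 + T) := by
    rw [← Real.log_rpow two_pos]
    exact Real.log_le_log (by positivity) (by norm_num; linarith)
  have hwK : (K : ℝ) ≤ 2 * Real.log (2 + T) := by
    have hlog : K * Real.log 2 ≤ Real.log (2 + T) := by
      rw [← Real.log_pow]
      exact Real.log_le_log (by positivity) (by linarith)
    nlinarith
  obtain ⟨l, hl, hlδ, hlw⟩ := exists_confidence (by linarith)
    (Real.log_le_log (by linarith) (by linarith) : Real.log y ≤ Real.log (2 + T)) hw hδ hδ1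
  have hl1 : (1 : ℝ) ≤ l := by exact_mod_cast hl
  obtain ⟨m, hm, hmY⟩ := exists_nat_between (c := 5280) (by norm_num)
    (one_le_mul_of_one_le_of_one_le (by linarith : 1 ≤ ρ * y / ε ^ 2) hl1)
  have hm0 : (0 : ℝ) < m := lt_of_lt_of_le (by positivity) hm
  refine ⟨l, m, hl, by exact_mod_cast hm0, hlδ, ?_, ?_⟩
  · calc ρ * (y * (1320 * l) / m) = 5280 * (ρ * y / ε ^ 2 * l) / m * (ε / 2) ^ 2 := by
          field_simp; norm_num
      _ ≤ (ε / 2) ^ 2 := mul_le_of_le_one_left (by positivity) ((div_le_one hm0).2 hm)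
  · set w := Real.log (2 + T)
    have hw0 : 0 ≤ w := by linarith
    have hT0 : 0 ≤ T := by linarith
    calc (K * m : ℝ) ≤ 2 * w * ((5280 + 1) * (T * (5 * w * (1 + Real.log (1 / δ))))) := by
          gcongr
          exact hmY.trans (by gcongr)
      _ = 52810 * (T * w ^ 2 * (1 + Real.log (1 / δ))) := by ring
      _ ≤ 60000 * (T * w ^ 2 * (1 + Real.log (1 / δ))) :=
        mul_le_mul_of_nonneg_right (by norm_num) (by positivity)
      _ = 60000 * T * w ^ 2 * (1 + Real.log (1 / δ)) := by ring

theorem exists_draw_count {a : ℕ} (ha : 0 < a) {ε δ : ℝ} (hε : 0 < ε) (hε1 : ε ≤ 1) (hδ : 0 < δ)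
    (hδ1 : δ ≤ 1) :
    ∃ (N : ℕ) (t : ℝ), 0 < N ∧ 0 < t ∧ 2 ^ a * (2 * Real.exp (-t)) ≤ δ / 2 ∧
      4 * t * (N + t) ≤ (N * (ε / 2)) ^ 2 ∧
      N ≤ 99 * (a / ε ^ 2) * (1 + Real.log (1 / δ)) := by
  have ha1 : (1 : ℝ) ≤ a := by exact_mod_cast ha
  have hε2 : ε ^ 2 ≤ 1 := pow_le_one₀ hε.le hε1
  have hD : 0 ≤ Real.log (1 / δ) := Real.log_nonneg (one_le_one_div hδ hδ1)
  have hlog2 := Real.log_two_gt_d9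
  have hlog2' := Real.log_two_lt_d9
  set t : ℝ := a * Real.log 2 + 2 * Real.log 2 + Real.log (1 / δ) with ht
  have ht1 : 1 ≤ t := by nlinarith
  have ht3 : t ≤ 3 * a * (1 + Real.log (1 / δ)) := by
    have haD : Real.log (1 / δ) ≤ a * Real.log (1 / δ) := le_mul_of_one_le_left hD ha1
    nlinarith
  have hexp : Real.exp (-t) = (2 ^ a * 2 ^ 2 * (1 / δ))⁻¹ := by
    rw [Real.exp_neg, ht, Real.exp_add, Real.exp_add, Real.exp_log (by positivity), ← Real.log_pow,
      Real.exp_log (by positivity), two_mul, Real.exp_add, Real.exp_log two_pos, sq]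
  obtain ⟨N, hN, hNt⟩ := exists_nat_between (c := 32) (r := t / ε ^ 2) (by norm_num)
    ((one_le_div (by positivity)).2 (hε2.trans ht1))
  have hN0 : (0 : ℝ) < N := lt_of_lt_of_le (by positivity) hN
  refine ⟨N, t, by exact_mod_cast hN0, by linarith, ?_, ?_, ?_⟩
  · rw [hexp]
    field_simp
    norm_num
  · rw [← mul_div_assoc, div_le_iff₀ (by positivity)] at hN
    have htN : t ≤ N := by nlinarith
    calc 4 * t * (N + t) ≤ 4 * t * (N + N) := by gcongr
      _ = 32 * t * N / 4 := by ring
      _ ≤ N * ε ^ 2 * N / 4 := by gcongr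
      _ = (N * (ε / 2)) ^ 2 := by ring
  · calc (N : ℝ) ≤ (32 + 1) * (t / ε ^ 2) := hNt
      _ ≤ (32 + 1) * (3 * a * (1 + Real.log (1 / δ)) / ε ^ 2) := by gcongr
      _ = 99 * (a / ε ^ 2) * (1 + Real.log (1 / δ)) := by ring

namespace ADMG

variable {n : ℕ} {G : ADMG n} {s : ℕ} [NeZero s] {X : Fin n} {x : Fin s} {F : Finset (Fin n)}
  {α ε δ T : ℝ}

theorem maxCComp_pos (i : Fin n) : 0 < G.maxCComp :=
  (Finset.card_pos.2 ⟨i, G.self_mem_cComp i⟩).trans_le (G.card_cComp_le i)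

theorem not_dir_of_inDegree_eq_zero (h : G.inDegree = 0) (i j : Fin n) : ¬ G.dir i j := fun hij =>
  have hpos : 0 < (G.parents j).card := Finset.card_pos.2 ⟨i, by simpa [parents] using hij⟩
  (hpos.trans_le (G.card_parents_le j)).ne' h

theorem exists_dominating (x : Fin s) (hid : G.Identifiable X) (hα : 0 < α) (hsα : s * α < 1) :
    ∃ ρ : ℝ, 1 ≤ ρ ∧
      ρ * (s : ℝ) ^ G.width ≤ (s : ℝ) ^ (2 * G.maxCComp * G.inDegree) / α ^ G.maxCComp ∧
      ∀ M : CBN G s, M.StronglyPositive X α → M.Dominated X x ρ := by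
  have hs : (1 : ℝ) ≤ s := by exact_mod_cast NeZero.one_le
  have hα1 : α ≤ 1 := by nlinarith
  have hk := G.maxCComp_pos X
  unfold width
  by_cases hd : G.inDegree = 0
  · refine ⟨1, le_rfl, ?_, fun M _ => M.dominated_of_no_edges X x (not_dir_of_inDegree_eq_zero hd)⟩
    rw [hd, mul_zero, mul_zero, zero_add, pow_zero, one_mul, le_div_iff₀ (by positivity), ← mul_pow]
    exact pow_le_one₀ (by positivity) hsα.le
  · refine ⟨α⁻¹, (one_le_inv₀ hα).2 hα1, ?_, fun M hM => hM.dominated x hid hα⟩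
    have hkd : G.maxCComp ≤ G.maxCComp * G.inDegree :=
      Nat.le_mul_of_pos_right _ (Nat.pos_of_ne_zero hd)
    have hwidth : G.maxCComp * G.inDegree + G.maxCComp ≤ 2 * G.maxCComp * G.inDegree := by
      rw [mul_assoc]
      omega
    have hαk : α ^ G.maxCComp ≤ α := pow_le_of_le_one hα.le hα1 hk.ne'
    rw [div_eq_inv_mul]
    gcongr

theorem learns_const_or_exists_stronglyPositive (hε : 0 ≤ ε) (hδ : 0 ≤ δ) :
    G.Learns X x F α ε δ 0 [] [.const 0 1] [] [.const 0 1] ∨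
      2 ≤ s ∧ ∃ M : CBN G s, M.StronglyPositive X α := by
  by_cases hM : ∃ M : CBN G s, M.StronglyPositive X α
  · rcases subsingleton_or_nontrivial (Fin s) with _ | hs
    · exact .inl (learns_of_subsingleton hε hδ 0 [] [])
    · exact .inr ⟨Fin.nontrivial_iff_two_le.1 hs, hM⟩
  · exact .inl fun M h => (hM ⟨M, h⟩).elim

theorem exists_learns (x : Fin s) (F : Finset (Fin n)) (hid : G.Identifiable X) (hα : 0 < α)
    (hε : 0 < ε) (hε1 : ε ≤ 1) (hδ : 0 < δ) (hδ1 : δ ≤ 1)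
    (hT : (s : ℝ) ^ (2 * G.maxCComp * G.inDegree) * n / (α ^ G.maxCComp * ε ^ 2) ≤ T) :
    ∃ (m : ℕ) (L E B Q : List Instr),
      m ≤ 60000 * T * Real.log (2 + T) ^ 2 * (1 + Real.log (1 / δ)) ∧
      L.length ≤ 16 * (m * n) ∧
      E.length ≤ 30 * (n * s * G.width * s ^ (n - F.card)) ∧
      B.length ≤ 2079 * (n * s * G.width * ((s : ℝ) ^ F.card / ε ^ 2)) * (1 + Real.log (1 / δ)) ∧
      Q.length ≤ 3 * F.card + 5 ∧
      G.Learns X x F α ε δ m L E B Q := by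
  have hD : 0 ≤ Real.log (1 / δ) := Real.log_nonneg (one_le_one_div hδ hδ1)
  have hT0 : 0 ≤ T := le_trans (by positivity) hT
  have hn := X.pos
  have hs0 : 0 < s := NeZero.pos s
  have hwidth := G.width_pos X
  rcases learns_const_or_exists_stronglyPositive (G := G) (X := X) (x := x) (F := F) (α := α) hε.le
    hδ.le with htriv | ⟨hs, M₀, hM₀⟩
  · refine ⟨0, _, _, _, _, ?_, by simp, ?_, ?_, by simp, htriv⟩
    · rw [Nat.cast_zero]
      positivity
    · have hpos : 0 < n * s * G.width * s ^ (n - F.card) := by positivity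
      simpa using by omega
    · rw [List.length_nil, Nat.cast_zero]
      positivity
  obtain ⟨ρ, hρ, hρs, hdom⟩ := exists_dominating x hid hα hM₀.mul_lt_one
  have hρT : ρ * (n * (s : ℝ) ^ G.width) / ε ^ 2 ≤ T :=
    calc ρ * (n * (s : ℝ) ^ G.width) / ε ^ 2 = ρ * (s : ℝ) ^ G.width * n / ε ^ 2 := by ring
      _ ≤ (s : ℝ) ^ (2 * G.maxCComp * G.inDegree) / α ^ G.maxCComp * n / ε ^ 2 := by gcongr
      _ = (s : ℝ) ^ (2 * G.maxCComp * G.inDegree) * n / (α ^ G.maxCComp * ε ^ 2) := by field_simp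
      _ ≤ T := hT
  have hwidth2 : (2 : ℝ) ^ G.width ≤ n * (s : ℝ) ^ G.width := by
    exact_mod_cast (Nat.pow_le_pow_left hs _).trans (Nat.le_mul_of_pos_left _ hn)
  obtain ⟨l, m, hl, hm, hlδ, hlm, hmT⟩ :=
    exists_sample_size hwidth hwidth2 hρ hε hε1 hδ hδ1 hρT
  obtain ⟨N, t, hN, ht, htδ, htN, hNε⟩ :=
    exists_draw_count (a := s ^ F.card) (by positivity) hε hε1 hδ hδ1
  -- Only `m` samples are read: drawing `G.width` times as many makes the learner linear in their
  -- number, without a factor for the scopes.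
  refine ⟨G.width * m, _, _, _, _, by exact_mod_cast hmT,
    (G.length_learner_le hm hn).trans_eq (by ring), G.length_evaluator_le X hs x F l, ?_,
    (length_lookup F).le, learns_learner hs hid (by linarith) hdom hm
      (Nat.le_mul_of_pos_left m hwidth) hl hε hδ (by simpa only [mul_assoc] using hlδ)
      hlm hN ht htδ htN⟩
  have hlen := G.length_tabulator_le X hs x F l hN
  calc ((G.tabulator X x F l N).length : ℝ) ≤ 21 * (n * s * G.width * N) := by exact_mod_cast hlen
    _ ≤ 21 * (n * s * G.width * (99 * ((s : ℝ) ^ F.card / ε ^ 2) * (1 + Real.log (1 / δ)))) := by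
      gcongr
      exact_mod_cast hNε
    _ = _ := by ring

end ADMG

end CausalLearning

end

open CausalLearning in
theorem mainTheorem2 :
    -- absolute constants: `C` for the `O`, `c` for the power of the logarithm in the soft-`O`
    ∃ (C : ℝ) (c : ℕ), 0 < C ∧
    ∀ (n s : ℕ) [NeZero s] (G : ADMG n) (X : Fin n) (x : Fin s) (F : Finset (Fin n))
      (α ε δ : ℝ),
    G.Identifiable X → 0 < α → 0 < ε → ε < 1 → 0 < δ → δ < 1 →
    ∀ (k d f : ℕ) (T : ℝ), k = G.maxCComp → d = G.inDegree → f = F.card →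
      T = (s : ℝ) ^ (2 * k * d) * n / (α ^ k * ε ^ 2) →
    -- `m` samples, a learner `L`, an evaluator `E` that works on the data returned by `L`,
    -- a tabulating program `B` that also works on these data, and a table look-up `Q`
    ∃ (m : ℕ) (L E B Q : List Instr),
      (m : ℝ) ≤ C * T * Real.log (2 + T) ^ c * (1 + Real.log (1 / δ)) ∧
      (L.length : ℝ) ≤ C * (m * n * (s : ℝ) ^ (2 * k * d)) ∧
      (E.length : ℝ) ≤ C * (n * s * (k * d + k) * (s : ℝ) ^ (n - f)) ∧
      (B.length : ℝ) ≤
        C * (n * s * (k * d + k) * ((s : ℝ) ^ f / ε ^ 2)) * (1 + Real.log (1 / δ)) ∧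
      (Q.length : ℝ) ≤ C * (f + 1) ∧
      ∀ M : CBN G s, M.StronglyPositive X α →
        1 - δ ≤ ((learned M.obs m L).toOuterMeasure
          {μ | IsCloseEvaluator E μ (marginal (M.interv X x) F) ε}).toReal ∧
        1 - δ ≤ (((learned M.obs m L).bind (run (fun _ => 0) B)).toOuterMeasure
          {μ | IsCloseEvaluator Q μ (marginal (M.interv X x) F) ε}).toReal := by
  refine ⟨60000, 2, by norm_num, ?_⟩
  rintro n s _ G X x F α ε δ hid hα hε hε1 hδ hδ1 k d f T rfl rfl rfl hT
  obtain ⟨m, L, E, B, Q, hm, hL, hE, hB, hQ, hlearns⟩ :=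
    ADMG.exists_learns x F hid hα hε hε1.le hδ hδ1.le hT.ge
  have hD : 0 ≤ Real.log (1 / δ) := Real.log_nonneg (one_le_one_div hδ hδ1.le)
  have hs : (1 : ℝ) ≤ (s : ℝ) ^ (2 * G.maxCComp * G.inDegree) :=
    one_le_pow₀ (by exact_mod_cast NeZero.one_le)
  have hwidth : (G.maxCComp * G.inDegree + G.maxCComp : ℝ) = G.width := by
    exact_mod_cast rfl
  rw [hwidth]
  refine ⟨m, L, E, B, Q, hm, ?_, ?_, ?_, ?_, hlearns⟩
  · calc (L.length : ℝ) ≤ 16 * (m * n * 1) := by exact_mod_cast hL.trans_eq (by ring)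
      _ ≤ 60000 * (m * n * (s : ℝ) ^ (2 * G.maxCComp * G.inDegree)) := by gcongr; norm_num
  · calc (E.length : ℝ) ≤ 30 * (n * s * G.width * (s : ℝ) ^ (n - F.card)) := by exact_mod_cast hE
      _ ≤ 60000 * (n * s * G.width * (s : ℝ) ^ (n - F.card)) := by gcongr; norm_num
  · refine hB.trans ?_
    gcongr
    norm_num
  · calc (Q.length : ℝ) ≤ 3 * F.card + 5 := by exact_mod_cast hQ
      _ ≤ 60000 * (F.card + 1) := by linarith [F.card.cast_nonneg (α := ℝ)]
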